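/- **Theorem 5.** Let $K$ be a field of characteristic $\ne 2$ with an involution $a\mapsto\bar a$ (a ring automorphism with $\bar{\bar a}=a$, possibly the identity). Let $\varepsilon\in\{1,-1\}$, and $\varepsilon=1$ if the involution is not the identity. *Notation.* For a matrix $M=[m_{ij}]$ put $M^*=[\bar m_{ji}]$. For $f(x)=a_0x^n+\dots+a_n\in K[x]$ put $\bar f(x)=\bar a_0x^n+\dots+\bar a_n$ and, if $a_n\neq0$, $f^\vee(x)=\bar a_n^{-1}(\bar a_nx^n+\dots+\bar a_1x+\bar a_0)$. A *Frobenius block* is an $n\times n$ matrix $\Phi$ with ones directly below the diagonal, last column $(-c_n,\dots,-c_1)^T$ and zeros elsewhere, whose characteristic polynomial $\chi_\Phi=x^n+c_1x^{n-1}+\dots+c_n$ ($n\ge 1$) is a power $p_\Phi^s$, $s\ge1$, of a monic polynomial $p_\Phi$ irreducible over $K$. For each Frobenius block $\Phi$ for which there is a nonsingular matrix $B$ with $B=\varepsilon B^*=\Phi^*B\Phi$, fix one such matrix and denote it by $\Phi_{(\varepsilon)}$; otherwise we say that $\Phi_{(\varepsilon)}$ does not exist. (If $\Phi_{(\varepsilon)}$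 exists, then $\Phi$ is nonsingular and $p_\Phi=p_\Phi^\vee$, so that $f(\kappa)^\circ=\bar f(\kappa^{-1})$ is a well-defined involution of the field $K[\kappa]=K[x]/p_\Phi K[x]$, $\kappa$ being the class of $x$.) For such $\Phi$, a Laurent polynomial $q$ is called *$\Phi$-stationary* if, with $\deg p_\Phi\in\{2r,2r+1\}$, $$q(x)=\bar a_rx^{-r}+\dots+\bar a_1x^{-1}+a_0+a_1x+\dots+a_rx^r,\qquad a_0=\bar a_0,\ a_1,\dots,a_r\in K,$$ and, in the case $\deg p_\Phi=2r$: $a_r=0$ if the involution on $K$ is the identity; $a_r=\bar a_r$ if it is not the identity and $p_\Phi(0)\ne1$; $a_r=-\bar a_r$ if it is not the identity and $p_\Phi(0)=1$. Let $F$ be a nondegenerate $\varepsilon$-Hermitian form on a finite-dimensional vector space $V$ over $K$ (semilinear in the first and linear in the second argument, $F(x,y)=\varepsilon\overline{F(y,x)}$), and let $A$ be an isometric operator: a linear map $A\colon V\to V$ with $F(Ax,Ay)=F(x,y)$ for all $x,y$. *Existence.* There is a basis of $V$ in which the pair $(A,F)$, with $F$ given by the matrix $[F(e_i,e_j)]$,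 is a direct sum of pairs of matrices of the following types: (i) $\left(\Phi\oplus\Phi^{*-1},\ \begin{bmatrix}0&\varepsilon I_n\\ I_n&0\end{bmatrix}\right)$, where $\Phi$ is a nonsingular $n\times n$ Frobenius block for which $\Phi_{(\varepsilon)}$ does not exist; (ii) $A_\Phi^{q}=(\Phi,\ \Phi_{(\varepsilon)}q(\Phi))$, where $\Phi$ is a Frobenius block for which $\Phi_{(\varepsilon)}$ exists and $q\neq0$ is $\Phi$-stationary. *Uniqueness.* The summands are determined, up to permutation, to exactly the following extent: if $(A,F)$ is given in some basis by one direct sum of pairs of types (i) and (ii), then another such direct sum gives $(A,F)$ in some basis if and only if it can be obtained from the first, up to permutation of summands, by * replacing, in some of the summands of type (i), the block $\Phi$ by the Frobenius block $\Psi$ with $\chi_\Psi=\chi_\Phi^\vee$, and * replacing, for each $\Phi$, the whole group of summands $A_\Phi^{q_1}\oplus\dots\oplus A_\Phi^{q_s}$ of type (ii) with this $\Phi$ by a group $A_\Phi^{q'_1}\oplus\dots\oplus A_\Phi^{q'_s}$ such that the Hermitian forms $q_1(\kappa)x_1^\circ x_1+\dots+q_s(\kappa)x_s^\circ x_s$ and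 $q'_1(\kappa)x_1^\circ x_1+\dots+q'_s(\kappa)x_s^\circ x_s$ are equivalent over the field $K[\kappa]$ with the involution $\circ$. -/

import Mathlib

namespace IsometricPairs

open Polynomial
open scoped LaurentPolynomial

noncomputable section

/-- For `f = a₀ xⁿ + ⋯ + aₙ` with `aₙ ≠ 0`, the polynomial
`f^∨ = āₙ⁻¹ (āₙ xⁿ + ⋯ + ā₁ x + ā₀)`. -/
def vee {K : Type*} [Field K] [StarRing K] (f : K[X]) : K[X] :=
  C (star (f.coeff 0))⁻¹ * (f.map (starRingEnd K)).reverse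

theorem vee_pow {K : Type*} [Field K] [StarRing K] (f : K[X]) (s : ℕ) :
    vee (f ^ s) = vee f ^ s := by
  induction s with
  | zero => 
    have h : (1 : K[X]).reverse = 1 := by rw [← Polynomial.C_1, reverse_C]
    simp [vee, h]
  | succ s ih =>
    rw [pow_succ, pow_succ, ← ih]
    simp only [vee, Polynomial.map_mul, mul_coeff_zero, star_mul', reverse_mul_of_domain,
      mul_inv, C_mul]
    ring

/-- A Frobenius block, given by its characteristic polynomial `χ = p ^ s`,
where `p` is monic and irreducible and `s ≥ 1`. -/
structure FrobeniusBlock (K : Type*) [Field K] where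
  p : K[X]
  s : ℕ
  monic : p.Monic
  irreducible : Irreducible p
  s_pos : 0 < s

namespace FrobeniusBlock

instance {K : Type*} [Field K] (Φ : FrobeniusBlock K) : Fact (Irreducible Φ.p) :=
  ⟨Φ.irreducible⟩

/-- The characteristic polynomial of the block. -/
def chi {K : Type*} [Field K] (Φ : FrobeniusBlock K) : K[X] := Φ.p ^ Φ.s

/-- The size `n` of the block. -/
def size {K : Type*} [Field K] (Φ : FrobeniusBlock K) : ℕ := Φ.chi.natDegree

/-- The matrix of the block: ones below the diagonal, and last column
`(-cₙ, …, -c₁)` where `χ = xⁿ + c₁ xⁿ⁻¹ + ⋯ + cₙ`. -/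
def mat {K : Type*} [Field K] (Φ : FrobeniusBlock K) :
    Matrix (Fin Φ.size) (Fin Φ.size) K :=
  Matrix.of fun i j =>
    if (j : ℕ) + 1 = Φ.size then -Φ.chi.coeff i
    else if (i : ℕ) = j + 1 then 1 else 0

/-- `B` is a nonsingular matrix with `B = ε B* = Φ* B Φ`. -/
def IsForm {K : Type*} [Field K] [StarRing K] (ε : K) (Φ : FrobeniusBlock K)
    (B : Matrix (Fin Φ.size) (Fin Φ.size) K) : Prop :=
  IsUnit B ∧ B = ε • B.conjTranspose ∧ B = Φ.mat.conjTranspose * B * Φ.mat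

/-- The matrix `Φ_(ε)` exists. -/
def HasForm {K : Type*} [Field K] [StarRing K] (ε : K) (Φ : FrobeniusBlock K) : Prop :=
  ∃ B, Φ.IsForm ε B

theorem charpoly_mat {K : Type*} [Field K] (Φ : FrobeniusBlock K) :
    Φ.mat.charpoly = Φ.chi := by
  have hm : Φ.chi.Monic := Φ.monic.pow Φ.s
  have h1 := charpoly_leftMulMatrix (AdjoinRoot.powerBasis hm.ne_zero)
  have h2 := AdjoinRoot.minpoly_powerBasis_gen_of_monic hm
  rw [PowerBasis.leftMulMatrix, PowerBasis.minpolyGen_eq, h2] at h1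
  exact h1

/-- If `Φ_(ε)` exists then `p_Φ = p_Φ^∨`. -/
theorem HasForm.p_eq_vee {K : Type*} [Field K] [StarRing K] {ε : K} {Φ : FrobeniusBlock K}
    (h : Φ.HasForm ε) : Φ.p = vee Φ.p := by
  obtain ⟨B, hB, -, hΦ⟩ := h
  obtain ⟨U, rfl⟩ := hB
  have hdet : IsUnit Φ.mat := by
    rw [Matrix.isUnit_iff_isUnit_det, isUnit_iff_ne_zero]
    intro h0
    have := congrArg Matrix.det hΦ
    rw [Matrix.det_mul, h0, mul_zero] at this
    exact (isUnit_iff_ne_zero.mp ((Matrix.isUnit_iff_isUnit_det _).mp U.isUnit)) this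
  have hdet' : IsUnit Φ.mat.conjTranspose := by
    simpa [Matrix.star_eq_conjTranspose] using hdet.star
  have hdd := (Matrix.isUnit_iff_isUnit_det _).mp hdet'
  have hconj : (U : Matrix _ _ K) * Φ.mat * (U : Matrix _ _ K)⁻¹ = Φ.mat.conjTranspose⁻¹ := by
    have e1 : Φ.mat.conjTranspose * ((U : Matrix _ _ K) * Φ.mat * (U : Matrix _ _ K)⁻¹) = 1 := by
      rw [← mul_assoc, ← mul_assoc, ← hΦ]
      exact Matrix.mul_nonsing_inv _ ((Matrix.isUnit_iff_isUnit_det _).mp U.isUnit)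
    exact (Matrix.inv_eq_right_inv e1).symm
  have hstar : Φ.mat.conjTranspose.charpoly = Φ.chi.map (starRingEnd K) := by
    have : Φ.mat.conjTranspose = (Φ.mat.map (starRingEnd K)).transpose := rfl
    rw [this, Matrix.charpoly_transpose, Matrix.charpoly_map, charpoly_mat]
  have hchi : Φ.chi = vee Φ.chi := by
    have h1 := Matrix.charpoly_units_conj U Φ.mat
    rw [hconj, Matrix.charpoly_inv _ hdet', charpoly_mat,
      ← Matrix.reverse_charpoly, hstar] at h1
    rw [vee]
    conv_lhs => rw [← h1]
    congr 1
    have h2 := Matrix.det_eq_sign_charpoly_coeff Φ.mat.conjTranspose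
    rw [hstar, coeff_map] at h2
    rw [h2, Ring.inverse_eq_inv', mul_inv, C_mul, ← mul_assoc]
    have : ((-1 : K[X]) ^ Fintype.card (Fin Φ.size)) *
        C ((-1 : K) ^ Fintype.card (Fin Φ.size))⁻¹ = 1 := by
      rw [← inv_pow, C_pow, ← mul_pow]
      simp [inv_neg]
    rw [this, one_mul]
    rfl
  rw [chi, vee_pow] at hchi
  have hd : Φ.p ∣ vee Φ.p :=
    Φ.irreducible.prime.dvd_of_dvd_pow (hchi ▸ dvd_pow_self _ Φ.s_pos.ne')
  have h0 : Φ.p.coeff 0 ≠ 0 := by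
    intro h0
    have : Φ.p ^ Φ.s = 0 := by
      rw [hchi, vee, h0]
      simp [Φ.s_pos.ne']
    exact pow_ne_zero _ Φ.monic.ne_zero this
  have hlead : (vee Φ.p).Monic := by
    rw [vee, Monic, leadingCoeff_mul, leadingCoeff_C, reverse_leadingCoeff, trailingCoeff,
      natTrailingDegree_eq_zero_of_constantCoeff_ne_zero (by simpa using h0)]
    have h1 : star (Φ.p.coeff 0) ≠ 0 := star_ne_zero.mpr h0
    simpa [starRingEnd_apply] using inv_mul_cancel₀ h1
  refine (eq_of_monic_of_dvd_of_natDegree_le Φ.monic hlead hd ?_).symm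
  rw [vee]
  refine (natDegree_C_mul_le _ _).trans ((reverse_natDegree_le _).trans ?_)
  exact natDegree_map_le

end FrobeniusBlock

/-- If `p = p^∨` is irreducible, the involution `f(κ) ↦ f̄(κ⁻¹)` of the field
`K[κ] = K[x]/p K[x]`. -/
def circ {K : Type*} [Field K] [StarRing K] (p : K[X]) [Fact (Irreducible p)]
    (h : p = vee p) : AdjoinRoot p →+* AdjoinRoot p :=
  AdjoinRoot.lift ((AdjoinRoot.of p).comp (starRingEnd K)) (AdjoinRoot.root p)⁻¹ (by
    have hp : Irreducible p := Fact.out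
    have hr : AdjoinRoot.root p ≠ 0 := by
      intro h0
      have h1 : p ∣ X := by
        rw [← AdjoinRoot.mk_eq_zero, AdjoinRoot.mk_X, h0]
      obtain ⟨c, hc⟩ := h1
      have h2 : p.coeff 0 = 0 := by
        have hX : Irreducible (X : K[X]) := irreducible_X
        rcases hX.isUnit_or_isUnit hc with hu | hu
        · exact absurd hu hp.not_isUnit
        · have h3 := congrArg (fun f => f.coeff 0) hc
          simp only [coeff_X_zero, mul_coeff_zero] at h3
          rcases mul_eq_zero.mp h3.symm with h4 | h4
          · exact h4
          · obtain ⟨u, hu0, rfl⟩ := isUnit_iff.mp hu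
            simp only [coeff_C_zero] at h4
            exact absurd h4 hu0.ne_zero
      apply hp.ne_zero
      rw [h, vee, h2]
      simp
    have e : eval₂ (AdjoinRoot.of p) (AdjoinRoot.root p) (vee p) = 0 := by
      rw [← h, AdjoinRoot.eval₂_root]
    have hc : (star (p.coeff 0))⁻¹ ≠ 0 := by
      intro h0
      apply hp.ne_zero
      rw [h, vee, h0]
      simp
    rw [vee, eval₂_mul, eval₂_C] at e
    have e2 := (mul_eq_zero.mp e).resolve_left
      (by simpa using hc)
    have : Invertible (AdjoinRoot.root p)⁻¹ := invertibleOfNonzero (inv_ne_zero hr)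
    have e3 := (eval₂_reverse_eq_zero_iff (AdjoinRoot.of p) (AdjoinRoot.root p)⁻¹
      (p.map (starRingEnd K))).mp (by simpa [invOf_eq_inv] using e2)
    rwa [eval₂_map] at e3)

/-- The value `q(x) = ∑ aₖ xᵏ` of a Laurent polynomial at an invertible element `x`. -/
def laurentEval {K R : Type*} [Field K] [Semiring R] [Module K R] [Pow R ℤ]
    (q : K[T;T⁻¹]) (x : R) : R :=
  q.coeff.sum fun k a => a • x ^ k

/-- `q = ā_r x⁻ʳ + ⋯ + a₀ + ⋯ + a_r xʳ` with `a₀ = ā₀`, where `deg p` is `2r` or `2r + 1`,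
and where, if `deg p = 2r`: `a_r = 0` for the identity involution on `K`, while for a
nonidentity involution `a_r = ā_r` if `p(0) ≠ 1` and `a_r = -ā_r` if `p(0) = 1`. -/
def IsStationaryForm {K : Type*} [Field K] [StarRing K] (p : K[X]) (q : K[T;T⁻¹]) : Prop :=
  (∀ k : ℤ, q.coeff (-k) = star (q.coeff k)) ∧
  (∀ k : ℤ, ((p.natDegree / 2 : ℕ) : ℤ) < k → q.coeff k = 0) ∧
  (Even p.natDegree →
    ((∀ a : K, star a = a) → q.coeff ((p.natDegree / 2 : ℕ) : ℤ) = 0) ∧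
    ((∃ a : K, star a ≠ a) → p.eval 0 ≠ 1 →
      q.coeff ((p.natDegree / 2 : ℕ) : ℤ) = star (q.coeff ((p.natDegree / 2 : ℕ) : ℤ))) ∧
    ((∃ a : K, star a ≠ a) → p.eval 0 = 1 →
      q.coeff ((p.natDegree / 2 : ℕ) : ℤ) = -star (q.coeff ((p.natDegree / 2 : ℕ) : ℤ))))

/-- A list of summands: blocks `block₁ i` of the summands
`(Φ ⊕ Φ*⁻¹, [I ⧹ ε I])` and pairs `(block₂ j, q j)` of the summands `(Φ, Φ_(ε) q(Φ))`. -/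
structure Summands (K : Type*) [Field K] where
  m : ℕ
  block₁ : Fin m → FrobeniusBlock K
  l : ℕ
  block₂ : Fin l → FrobeniusBlock K
  q : Fin l → K[T;T⁻¹]

namespace Summands

/-- The conditions on the summands of both types. -/
def IsAdmissible {K : Type*} [Field K] [StarRing K] (ε : K) (D : Summands K) : Prop :=
  (∀ i, IsUnit (D.block₁ i).mat ∧ ¬ (D.block₁ i).HasForm ε) ∧
  (∀ j, (D.block₂ j).HasForm ε ∧ D.q j ≠ 0 ∧ IsStationaryForm (D.block₂ j).p (D.q j))

/-- The index set of the direct sum. -/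
abbrev Index {K : Type*} [Field K] (D : Summands K) : Type :=
  (Σ i : Fin D.m, Fin (D.block₁ i).size ⊕ Fin (D.block₁ i).size) ⊕
    (Σ j : Fin D.l, Fin (D.block₂ j).size)

/-- The direct sum of the first members of the pairs. -/
def opMatrix {K : Type*} [Field K] [StarRing K] (D : Summands K) :
    Matrix D.Index D.Index K :=
  Matrix.fromBlocks
    (Matrix.blockDiagonal' fun i =>
      Matrix.fromBlocks (D.block₁ i).mat 0 0 ((D.block₁ i).mat.conjTranspose)⁻¹)
    0 0
    (Matrix.blockDiagonal' fun j => (D.block₂ j).mat)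

/-- The direct sum of the second members of the pairs, where `c Φ` is the fixed matrix
`Φ_(ε)` and `[A ⧹ B]` is the block matrix with rows `(0, B)` and `(A, 0)`. -/
def formMatrix {K : Type*} [Field K] (ε : K)
    (c : (Φ : FrobeniusBlock K) → Matrix (Fin Φ.size) (Fin Φ.size) K) (D : Summands K) :
    Matrix D.Index D.Index K :=
  Matrix.fromBlocks
    (Matrix.blockDiagonal' fun _ => Matrix.fromBlocks 0 (ε • 1) 1 0)
    0 0
    (Matrix.blockDiagonal' fun j =>
      c (D.block₂ j) * laurentEval (D.q j) (D.block₂ j).mat)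

/-- In some basis, `A` and `F` are given by the direct sum `D`; the matrix of the form `F`,
which is semilinear in the first argument, is `[F(eᵢ, eⱼ)]`. -/
def Represents {K : Type*} [Field K] [StarRing K] (ε : K)
    (c : (Φ : FrobeniusBlock K) → Matrix (Fin Φ.size) (Fin Φ.size) K) (D : Summands K)
    {V : Type*} [AddCommGroup V] [Module K V] (A : V →ₗ[K] V)
    (F : V →ₗ⋆[K] V →ₗ[K] K) : Prop :=
  ∃ b : Module.Basis D.Index K V,
    LinearMap.toMatrix b b A = D.opMatrix ∧
    (Matrix.of fun i j => F (b i) (b j)) = D.formMatrix ε c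

end Summands

/-- Equivalence of the Hermitian forms `∑ aᵢ xᵢ° xᵢ` and `∑ bⱼ yⱼ° yⱼ` over a field `L` with
involution `τ`: a linear bijection that carries one to the other. -/
def HermitianEquivalent {L : Type*} [Field L] (τ : L →+* L) {I J : Type*} [Fintype I]
    [Fintype J] (a : I → L) (b : J → L) : Prop :=
  ∃ e : (I → L) ≃ₗ[L] (J → L), ∀ x y : I → L,
    ∑ j, b j * τ (e x j) * e y j = ∑ i, a i * τ (x i) * y i

open Classical in
/-- The freedom in the choice of the summands. Summands of the first type are matched by a
bijection, up to replacement of `Φ` by the block with characteristic polynomial `χ_Φ^∨`.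
For every `Φ` the whole groups of summands of the second type with this `Φ` have equivalent
Hermitian forms `∑ q_j(κ) x_j° x_j` over `K[κ] = K[x]/p_Φ K[x]`. -/
def Summands.Equivalent {K : Type*} [Field K] [StarRing K] (ε : K) (D D' : Summands K) : Prop :=
  (∃ σ : Fin D.m ≃ Fin D'.m, ∀ i,
    (D'.block₁ (σ i)).chi = (D.block₁ i).chi ∨
      (D'.block₁ (σ i)).chi = vee (D.block₁ i).chi) ∧
  ∀ (Φ : FrobeniusBlock K) (h : Φ.HasForm ε),
    HermitianEquivalent (circ Φ.p h.p_eq_vee)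
      (fun j : {j : Fin D.l // D.block₂ j = Φ} =>
        laurentEval (D.q j) (AdjoinRoot.root Φ.p))
      (fun j : {j : Fin D'.l // D'.block₂ j = Φ} =>
        laurentEval (D'.q j) (AdjoinRoot.root Φ.p))

end

end IsometricPairs

open IsometricPairs

set_option linter.unusedSectionVars false

/-! The operator `A` is invertible, so `V` is a module over R = K[T;T⁻¹] with T acting as `A`.
Isometry means that the adjoint of r is σ(r), where σ(∑ aₖTᵏ) = ∑ āₖT⁻ᵏ. The pair (A, F) thus
becomes an R-module with a σ-invariant form. A submodule on which the form is nondegenerate splits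
off orthogonally, so existence reduces, by induction on the dimension, to finding one summand
(`exists_summand`).

Let p^(k+1) be the exact power of an irreducible p in the minimal polynomial of `A`. There are v
killed by p^(k+1) and w killed by σ(p)^(k+1) with F(w, pᵏv) ≠ 0. Suppose that the block with
characteristic polynomial p^(k+1) carries a form. A polarization argument gives y with F(y, pᵏry) ≠
0 for some r (`exists_anisotropic`). Then F(y, ry) = ℓ(nr), where ℓ is the functional attached to
Φ_(ε), and n is prime to p and fixed by σ modulo p^(k+1). As 2 is invertible, Newton's method finds
a square root of q/n for the stationary q congruent to n modulo p, and rescaling y by it turns n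
into q (`exists_isCyclicForm`). If the block carries no form, then either p and σ(p) are coprime and
v, w are automatically isotropic, or F(v, pᵏrv) vanishes for all r and v, w can be corrected to
isotropic vectors (`exists_isHyperbolic`).

For uniqueness, consider the vectors killed by p^(k+1) modulo those that pᵏ maps into p^(k+1)V. This
space over the residue field depends on V alone. Its dimension counts the summands R/(p^(k+1))
(`exists_residue_equiv`), and the values F(x, pᵏry) recover from it the form ∑ qⱼxⱼ°xⱼ
(`hermitianEquivalent_of_decompositions`). A summand of type (i) contributes Φ together with its
dual, so only the unordered pair can be recovered.

Conversely, an equivalence over the residue field is lifted modulo p^(k+1): if a Hermitian matrix H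
is congruent to a diagonal D modulo p, then D⁻¹H is unipotent, and the inverse of its square root
carries H to D (`exists_transform_of_isNilpotent`, `exists_replacement`). -/

namespace IsometricPairs

open Polynomial
open scoped LaurentPolynomial

/-! ### Newton's method: square roots of unipotent elements and roots fixed by an endomorphism. -/

section SquareRoot

open scoped IsMulCommutative in
/-- In a ring in which `2` is invertible with inverse `h`, an element `N` with `N - 1` nilpotent
has a square root in the subring generated by `N` and `h`. -/
theorem exists_sq_eq_of_isNilpotent_sub_one {M : Type*} [Ring M] {N h : M} (hh : 2 * h = 1)
    (hN : IsNilpotent (N - 1)) : ∃ t ∈ Subring.closure {N, h}, t * t = N := by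
  have hcomm : ∀ x ∈ ({N, h} : Set M), ∀ y ∈ ({N, h} : Set M), x * y = y * x := by
    -- 2 is central, hence so is its inverse.
    have h2 : ∀ x : M, x * h = h * x := fun x => by
      have hh' : h * 2 = 1 := by
        rw [mul_two, ← two_mul]; exact hh
      calc x * h = h * 2 * (x * h) := by rw [hh', one_mul]
        _ = h * (x * (2 * h)) := by rw [two_mul, mul_two]; noncomm_ring
        _ = h * x := by rw [hh, mul_one]
    rintro x (rfl | rfl) y (rfl | rfl) <;> first | rfl | (exact h2 _) | (exact (h2 _).symm)
  generalize hC : Subring.closure ({N, h} : Set M) = C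
  have : IsMulCommutative C := hC ▸ Subring.isMulCommutative_closure hcomm
  let N' : C := ⟨N, hC ▸ Subring.subset_closure (by simp)⟩
  let h' : C := ⟨h, hC ▸ Subring.subset_closure (by simp)⟩
  have hh' : (2 : C) * h' = 1 := by
    rw [two_mul]
    exact Subtype.ext ((two_mul h).symm.trans hh)
  have hN' : IsNilpotent (N' - 1) := by
    obtain ⟨n, hn⟩ := hN
    exact ⟨n, Subtype.ext (by simpa using hn)⟩
  -- Newton's method for X² - N starting at 1: the value 1 - N is nilpotent and the derivative 2 is
  -- a unit. It applies because the subring generated by N and h is commutative.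
  obtain ⟨t, ⟨-, ht⟩, -⟩ := existsUnique_nilpotent_sub_and_aeval_eq_zero
    (R := C) (S := C) (P := X ^ 2 - Polynomial.C N') (x := 1)
    (by simpa using (hN'.neg : IsNilpotent (-(N' - 1))))
    (by
      simp only [derivative_sub, derivative_X_pow, derivative_C]
      simpa using IsUnit.of_mul_eq_one h' hh')
  refine ⟨t, t.2, ?_⟩
  have : t ^ 2 = N' := by simpa [sub_eq_zero] using ht
  rw [← pow_two]
  exact congrArg Subtype.val this

/-- A root obtained by Newton's method from a point fixed by a ring endomorphism `τ` is fixed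
by `τ`, if the polynomial is. -/
theorem exists_fixed_root {S : Type*} [CommRing S] (τ : S →+* S) {P : S[X]} (hP : P.map τ = P)
    {x : S} (hx : τ x = x) (h₀ : IsNilpotent (P.eval x)) (h₁ : IsUnit (P.derivative.eval x)) :
    ∃ z, P.eval z = 0 ∧ τ z = z ∧ IsNilpotent (x - z) := by
  obtain ⟨z, ⟨hz, hz'⟩, huniq⟩ := existsUnique_nilpotent_sub_and_aeval_eq_zero
    (R := S) (S := S) (P := P) (x := x) (by simpa using h₀) (by simpa using h₁)
  rw [coe_aeval_eq_eval] at hz'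
  -- `τ z` is again a root, and it differs from `τ x = x` by a nilpotent element, so the uniqueness
  -- of the Newton root forces `τ z = z`.
  refine ⟨z, hz', huniq (τ z) ⟨?_, ?_⟩, hz⟩
  · have := hz.map τ
    rwa [map_sub, hx] at this
  · change eval (τ z) P = 0
    conv_lhs => rw [← hP]
    rw [eval_map_apply, hz', map_zero]

end SquareRoot

/-! ### Functionals that make the quotient R/(g) a Frobenius algebra. -/

section Functionals

variable {K R : Type*} [Field K] [CommRing R] [Algebra K R]

/-- A linear functional on `R` whose kernel contains the ideal `(g)`, but no larger ideal. -/
structure IsFrobenius (g : R) (ψ : R →ₗ[K] K) : Prop where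
  map_mul_eq_zero : ∀ r, ψ (g * r) = 0
  dvd : ∀ r, (∀ t, ψ (t * r) = 0) → g ∣ r

theorem IsFrobenius.map_eq {g : R} {ψ : R →ₗ[K] K} (h : IsFrobenius g ψ) {a b : R}
    (hab : g ∣ a - b) : ψ a = ψ b := by
  obtain ⟨c, hc⟩ := hab
  rw [← sub_eq_zero, ← map_sub, hc, h.map_mul_eq_zero]

theorem dvd_or_isCoprime {p : R} (hp : (Ideal.span {p}).IsMaximal) (a : R) :
    p ∣ a ∨ IsCoprime p a := by
  by_cases h : p ∣ a
  · exact Or.inl h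
  · refine Or.inr ?_
    obtain ⟨b, hb⟩ := hp.exists_inv (x := a) (by rwa [Ideal.mem_span_singleton])
    obtain ⟨c, hc, hbc⟩ := hb
    obtain ⟨d, rfl⟩ := Ideal.mem_span_singleton.mp hc
    exact ⟨d, b, by rw [← hbc]; ring⟩

/-- An element is either divisible by a power `p ^ k` or it is `p ^ i * b` with `i < k` and `b`
prime to `p`. -/
theorem pow_dvd_or_eq {p : R} (hp : (Ideal.span {p}).IsMaximal) (a : R) (k : ℕ) :
    p ^ k ∣ a ∨ ∃ i < k, ∃ b, a = p ^ i * b ∧ IsCoprime p b := by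
  induction k with
  | zero => simp
  | succ k ih =>
    rcases ih with ⟨b, rfl⟩ | ⟨i, hi, b, rfl, hb⟩
    · rcases dvd_or_isCoprime hp b with ⟨c, rfl⟩ | hb
      · exact Or.inl ⟨c, by ring⟩
      · exact Or.inr ⟨k, by omega, b, rfl, hb⟩
    · exact Or.inr ⟨i, by omega, b, rfl, hb⟩

/-- The ideals containing p^(k+1) form the chain of the (pⁱ), and each one that is strictly larger
than (p^(k+1)) contains pᵏ. So one nonzero value on (pᵏ) is enough. -/
theorem isFrobenius_of_ne_zero {p : R} (hp : (Ideal.span {p}).IsMaximal) {k : ℕ}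
    {ψ : R →ₗ[K] K} (h : ∀ r, ψ (p ^ (k + 1) * r) = 0) {r₀ : R} (h₀ : ψ (p ^ k * r₀) ≠ 0) :
    IsFrobenius (p ^ (k + 1)) ψ where
  map_mul_eq_zero := h
  dvd r hr := by
    rcases pow_dvd_or_eq hp r (k + 1) with hd | ⟨i, hi, b, rfl, hb⟩
    · exact hd
    · exfalso
      obtain ⟨x, y, hxy⟩ := hb
      apply h₀
      have e : p ^ k * r₀ = p ^ (k + 1) * (x * r₀) + (p ^ (k - i) * y * r₀) * (p ^ i * b) := by
        obtain ⟨j, rfl⟩ : ∃ j, k = i + j := ⟨k - i, by omega⟩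
        rw [Nat.add_sub_cancel_left]
        calc p ^ (i + j) * r₀ = p ^ (i + j) * r₀ * (x * p + y * b) := by rw [hxy, mul_one]
          _ = _ := by ring
      rw [e, map_add, h, hr, add_zero]

/-- The pairing (x, y) ↦ ψ(xy) on the finite-dimensional quotient R/(g) is nondegenerate, so every
functional on the quotient is a multiple of ψ. -/
theorem IsFrobenius.exists_eq {g : R} {ψ : R →ₗ[K] K} (hψ : IsFrobenius g ψ)
    [FiniteDimensional K (R ⧸ Ideal.span {g})] {φ : R →ₗ[K] K} (hφ : ∀ r, φ (g * r) = 0) :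
    ∃ n, ∀ r, φ r = ψ (n * r) := by
  let S := R ⧸ Ideal.span {g}
  have key : ∀ θ : R →ₗ[K] K, (∀ r, θ (g * r) = 0) →
      ∃ θ' : S →ₗ[K] K, ∀ r, θ' (Ideal.Quotient.mk _ r) = θ r := fun θ hθ => by
    refine ⟨((Ideal.span {g}).restrictScalars K).liftQ θ ?_, fun r => rfl⟩
    intro x hx
    obtain ⟨c, rfl⟩ := Ideal.mem_span_singleton.mp hx
    exact hθ c
  obtain ⟨ψ', hψ'⟩ := key ψ hψ.map_mul_eq_zero
  obtain ⟨φ', hφ'⟩ := key φ hφ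
  let m : S →ₗ[K] S →ₗ[K] K := (LinearMap.mul K S).compr₂ ψ'
  have hinj : Function.Injective m := by
    rw [injective_iff_map_eq_zero]
    intro x hx
    obtain ⟨x, rfl⟩ := Ideal.Quotient.mk_surjective x
    rw [Ideal.Quotient.eq_zero_iff_mem, Ideal.mem_span_singleton]
    refine hψ.dvd x fun t => ?_
    have := LinearMap.congr_fun hx (Ideal.Quotient.mk _ t)
    simp only [m, LinearMap.compr₂_apply, LinearMap.mul_apply', LinearMap.zero_apply] at this
    rw [← map_mul, hψ'] at this
    rw [mul_comm, this]
  have hsurj := (LinearMap.injective_iff_surjective_of_finrank_eq_finrank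
    (Subspace.dual_finrank_eq (K := K) (V := S)).symm).mp hinj
  obtain ⟨n, hn⟩ := hsurj φ'
  obtain ⟨n, rfl⟩ := Ideal.Quotient.mk_surjective n
  refine ⟨n, fun r => ?_⟩
  have := LinearMap.congr_fun hn (Ideal.Quotient.mk _ r)
  simp only [m, LinearMap.compr₂_apply, LinearMap.mul_apply'] at this
  rw [← map_mul, hψ', hφ'] at this
  exact this.symm

end Functionals

end IsometricPairs

namespace IsometricPairs

open Polynomial
open scoped LaurentPolynomial

/-! ### Invariant forms over an algebra with involution, and hyperbolic pairs. -/

section Forms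

variable {K R V : Type*} [Field K] [StarRing K] [CommRing R] [Algebra K R]
  [AddCommGroup V] [Module K V] [Module R V] [IsScalarTower K R V]

/-- `σ` is an involution of the `K`-algebra `R` extending the involution of `K`. -/
structure IsInvolution (K : Type*) {R : Type*} [Field K] [StarRing K] [CommRing R] [Algebra K R]
    (σ : R →+* R) : Prop where
  apply_apply : ∀ r, σ (σ r) = r
  map_algebraMap : ∀ a : K, σ (algebraMap K R a) = algebraMap K R (star a)

theorem IsInvolution.dvd_iff {σ : R →+* R} (hσ : IsInvolution K σ) {a b : R} :
    σ a ∣ b ↔ a ∣ σ b :=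
  ⟨fun h => hσ.apply_apply a ▸ map_dvd σ h, fun h => hσ.apply_apply b ▸ map_dvd σ h⟩

/-- An `ε`-Hermitian form on an `R`-module, for which the adjoint of `r` is `σ r`. -/
structure IsInvariantForm (σ : R →+* R) (ε : K) (F : V →ₗ⋆[K] V →ₗ[K] K) : Prop where
  symm : ∀ x y, F x y = ε * star (F y x)
  adjoint : ∀ (r : R) (x y : V), F (r • x) y = F x (σ r • y)

/-- The form is nondegenerate on the submodule `U`. -/
def NondegenerateOn (F : V →ₗ⋆[K] V →ₗ[K] K) (U : Submodule R V) : Prop :=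
  ∀ x ∈ U, (∀ y ∈ U, F x y = 0) → x = 0

namespace IsInvariantForm

variable {σ : R →+* R} {ε : K} {F : V →ₗ⋆[K] V →ₗ[K] K}

theorem eq_zero_comm (hF : IsInvariantForm σ ε F) {x y : V} (h : F x y = 0) : F y x = 0 := by
  rw [hF.symm, h, star_zero, mul_zero]

theorem adjoint' (hF : IsInvariantForm σ ε F) (hσ : IsInvolution K σ) (r : R) (x y : V) :
    F x (r • y) = F (σ r • x) y := by
  rw [hF.adjoint, hσ.apply_apply]

theorem apply_smul (hF : IsInvariantForm σ ε F) (r : R) (x y : V) :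
    F x (r • y) = ε * star (F y (σ r • x)) := by
  rw [hF.symm, hF.adjoint]

/-- A functional outside the range of the semilinear map F would be separated from it by an element
of the bidual, that is, by a vector y with all F x y = 0. Nondegeneracy makes y zero. -/
theorem exists_eq (hF : IsInvariantForm σ ε F) [FiniteDimensional K V]
    (h : ∀ x, (∀ y, F x y = 0) → x = 0) (φ : V →ₗ[K] K) : ∃ x, F x = φ := by
  by_contra hφ
  obtain ⟨f, hf, hf'⟩ := Submodule.exists_dual_map_eq_bot_of_notMem (x := φ)
    (p := LinearMap.range F) (fun ⟨x, hx⟩ => hφ ⟨x, hx⟩) inferInstance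
  obtain ⟨y, rfl⟩ := (Module.evalEquiv K V).surjective f
  apply hf
  have : y = 0 := h y fun x => hF.eq_zero_comm (by
    have : (Module.evalEquiv K V y) (F x) ∈ (LinearMap.range F).map (Module.evalEquiv K V y) :=
      ⟨F x, ⟨x, rfl⟩, rfl⟩
    rw [hf'] at this
    simpa using this)
  simp [this]

/-- The restriction of a form to a submodule. -/
def _root_.IsometricPairs.restrictForm (F : V →ₗ⋆[K] V →ₗ[K] K) (U : Submodule R V) :
    U →ₗ⋆[K] U →ₗ[K] K :=
  LinearMap.mk₂'ₛₗ (starRingEnd K) (RingHom.id K) (fun x y => F x y)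
    (fun _ _ _ => by simp) (fun _ _ _ => by simp) (fun _ _ _ => by simp) (fun _ _ _ => by simp)

@[simp] theorem _root_.IsometricPairs.restrictForm_apply (F : V →ₗ⋆[K] V →ₗ[K] K)
    (U : Submodule R V) (x y : U) : restrictForm F U x y = F x y := rfl

theorem restrict (hF : IsInvariantForm σ ε F) (U : Submodule R V) :
    IsInvariantForm σ ε (restrictForm F U) :=
  ⟨fun x y => hF.symm x y, fun r x y => hF.adjoint r x y⟩

/-- The orthogonal complement of a submodule. -/
def orth (hF : IsInvariantForm σ ε F) (U : Submodule R V) : Submodule R V where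
  carrier := {x | ∀ u ∈ U, F u x = 0}
  add_mem' ha hb u hu := by rw [map_add, ha u hu, hb u hu, add_zero]
  zero_mem' u _ := map_zero _
  smul_mem' r x hx u hu := by
    by_cases h : ∃ t, σ t = r
    · obtain ⟨t, rfl⟩ := h
      rw [← hF.adjoint]
      exact hx _ (U.smul_mem _ hu)
    · have : F (r • x) u = 0 := by
        rw [hF.adjoint]
        exact hF.eq_zero_comm (hx _ (U.smul_mem _ hu))
      exact hF.eq_zero_comm this

/-- The restriction of F x to U is represented by a vector u of U, and then x - u is orthogonal to
U. Nondegeneracy is needed on U only. -/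
theorem exists_add_eq (hF : IsInvariantForm σ ε F) [FiniteDimensional K V] {U : Submodule R V}
    (hU : NondegenerateOn F U) (x : V) : ∃ u ∈ U, x - u ∈ hF.orth U := by
  have : FiniteDimensional K U :=
    FiniteDimensional.of_injective (U.subtype.restrictScalars K) U.injective_subtype
  obtain ⟨u, hu⟩ := (hF.restrict U).exists_eq
    (fun x hx => Subtype.ext (hU x x.2 fun y hy => hx ⟨y, hy⟩))
    ((F x).comp (U.subtype.restrictScalars K))
  refine ⟨u, u.2, fun y hy => hF.eq_zero_comm ?_⟩
  have := LinearMap.congr_fun hu ⟨y, hy⟩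
  simp only [restrictForm_apply, LinearMap.comp_apply] at this
  rw [map_sub, LinearMap.sub_apply, this]
  simp

/-- The functional `r ↦ F x (r • y)`. -/
def _root_.IsometricPairs.coefficientFunctional (R : Type*) [CommRing R] [Algebra K R]
    [Module R V] [IsScalarTower K R V] (F : V →ₗ⋆[K] V →ₗ[K] K) (x y : V) : R →ₗ[K] K :=
  (F x).comp ((LinearMap.toSpanSingleton R V y).restrictScalars K)

@[simp] theorem _root_.IsometricPairs.coefficientFunctional_apply
    (F : V →ₗ⋆[K] V →ₗ[K] K) (x y : V) (r : R) :
    coefficientFunctional R F x y r = F x (r • y) := rfl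

end IsInvariantForm

/-- `w` and `w'` generate isotropic submodules that are dual to each other, the annihilator of
`w` being `(g)`. -/
structure IsHyperbolic (σ : R →+* R) (F : V →ₗ⋆[K] V →ₗ[K] K) (g : R) (w w' : V) : Prop where
  isotropic : ∀ r : R, F w (r • w) = 0
  isotropic' : ∀ r : R, F w' (r • w') = 0
  smul_eq_zero : g • w = 0
  smul_eq_zero' : σ g • w' = 0
  dvd : ∀ r : R, (∀ t : R, F w' ((t * r) • w) = 0) → g ∣ r

namespace IsHyperbolic

variable {σ : R →+* R} {ε : K} {F : V →ₗ⋆[K] V →ₗ[K] K} {g : R} {w w' : V}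

theorem isFrobenius (h : IsHyperbolic σ F g w w') :
    IsFrobenius g (coefficientFunctional R F w' w) where
  map_mul_eq_zero r := by
    rw [coefficientFunctional_apply, mul_comm, mul_smul, h.smul_eq_zero, smul_zero, map_zero]
  dvd := h.dvd

theorem symm (h : IsHyperbolic σ F g w w') (hF : IsInvariantForm σ ε F)
    (hσ : IsInvolution K σ) : IsHyperbolic σ F (σ g) w' w where
  isotropic := h.isotropic'
  isotropic' := h.isotropic
  smul_eq_zero := h.smul_eq_zero'
  smul_eq_zero' := by rw [hσ.apply_apply, h.smul_eq_zero]
  dvd r hr := by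
    rw [hσ.dvd_iff]
    refine h.dvd _ fun t => ?_
    have := hr (σ t)
    rw [hF.adjoint' hσ] at this
    simpa [hσ.apply_apply] using hF.eq_zero_comm this

theorem of_associated (h : IsHyperbolic σ F g w w') {g' : R} (hg : Associated g g') :
    IsHyperbolic σ F g' w w' where
  isotropic := h.isotropic
  isotropic' := h.isotropic'
  smul_eq_zero := by
    obtain ⟨u, rfl⟩ := hg
    rw [mul_comm, mul_smul, h.smul_eq_zero, smul_zero]
  smul_eq_zero' := by
    obtain ⟨u, rfl⟩ := hg
    rw [map_mul, mul_comm, mul_smul, h.smul_eq_zero', smul_zero]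
  dvd r hr := hg.symm.dvd.trans (h.dvd r hr)

theorem dvd_of_smul_eq_zero (h : IsHyperbolic σ F g w w') {r : R} (hr : r • w = 0) : g ∣ r :=
  h.dvd r fun t => by rw [mul_smul, hr, smul_zero, map_zero]

/-- If a·w' is orthogonal to Rw, then g divides σ(a), so a lies in (σ g), which kills w'. This is
the nondegeneracy of the pairing between Rw' and Rw. -/
theorem eq_zero_of_mem_span (h : IsHyperbolic σ F g w w') (hF : IsInvariantForm σ ε F)
    (hσ : IsInvolution K σ) {x : V} (hx : x ∈ Submodule.span R {w'})
    (hx' : ∀ t : R, F x (t • w) = 0) : x = 0 := by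
  obtain ⟨a, rfl⟩ := Submodule.mem_span_singleton.mp hx
  have : g ∣ σ a := h.dvd _ fun t => by
    rw [mul_comm, mul_smul, ← hF.adjoint]
    exact hx' t
  obtain ⟨b, rfl⟩ := hσ.dvd_iff.mpr this
  rw [mul_comm, mul_smul, h.smul_eq_zero', smul_zero]

/-- Both halves being isotropic, testing a·w + b·w' against Rw sees only b·w', and testing it
against Rw' sees only a·w. -/
theorem nondegenerateOn (h : IsHyperbolic σ F g w w') (hF : IsInvariantForm σ ε F)
    (hσ : IsInvolution K σ) : NondegenerateOn F (Submodule.span R {w, w'}) := by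
  intro x hx hx'
  obtain ⟨a, b, rfl⟩ := Submodule.mem_span_pair.mp hx
  have h1 : b • w' = 0 := by
    refine h.eq_zero_of_mem_span hF hσ (Submodule.mem_span_singleton.mpr ⟨b, rfl⟩) fun t => ?_
    have := hx' (t • w) (Submodule.smul_mem _ _ (Submodule.subset_span (by simp)))
    rw [map_add, LinearMap.add_apply, hF.adjoint a, smul_smul, h.isotropic, zero_add] at this
    exact this
  have h2 : a • w = 0 := by
    refine (h.symm hF hσ).eq_zero_of_mem_span hF hσ
      (Submodule.mem_span_singleton.mpr ⟨a, rfl⟩) fun t => ?_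
    have := hx' (t • w') (Submodule.smul_mem _ _ (Submodule.subset_span (by simp)))
    rwa [map_add, LinearMap.add_apply, hF.adjoint b, smul_smul, h.isotropic', add_zero] at this
  rw [h1, h2, add_zero]

end IsHyperbolic

end Forms

end IsometricPairs

namespace IsometricPairs

open Polynomial
open scoped LaurentPolynomial

/-! ### Correcting a pair of vectors to a hyperbolic pair. -/

section Lifting

variable {K R V : Type*} [Field K] [StarRing K] [CommRing R] [Algebra K R]
  [AddCommGroup V] [Module K V] [Module R V] [IsScalarTower K R V]

/-- The endomorphism of `R / (g)` induced by `σ`. -/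
def quotientInvolution (σ : R →+* R) {g : R} (h : g ∣ σ g) :
    R ⧸ Ideal.span {g} →+* R ⧸ Ideal.span {g} :=
  Ideal.quotientMap _ σ (by
    rw [Ideal.span_singleton_le_iff_mem, Ideal.mem_comap, Ideal.mem_span_singleton]
    exact h)

@[simp] theorem quotientInvolution_mk (σ : R →+* R) {g : R} (h : g ∣ σ g) (r : R) :
    quotientInvolution σ h (Ideal.Quotient.mk _ r) = Ideal.Quotient.mk _ (σ r) := rfl

theorem mk_eq_mk_iff_dvd {g a b : R} :
    (Ideal.Quotient.mk (Ideal.span {g}) a = Ideal.Quotient.mk (Ideal.span {g}) b) ↔ g ∣ a - b := by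
  rw [Ideal.Quotient.eq, Ideal.mem_span_singleton]

theorem isNilpotent_mk_of_dvd {p a : R} (h : p ∣ a) (k : ℕ) :
    IsNilpotent (Ideal.Quotient.mk (Ideal.span {p ^ k}) a) :=
  ⟨k, by rw [← map_pow, Ideal.Quotient.eq_zero_iff_mem, Ideal.mem_span_singleton]
         exact pow_dvd_pow_of_dvd h k⟩

theorem pow_dvd_map_pow {σ : R →+* R} {p : R} (h : p ∣ σ p) (k : ℕ) : p ^ k ∣ σ (p ^ k) := by
  rw [map_pow]; exact pow_dvd_pow_of_dvd h k

/-- A polynomial equation that is fixed by the involution and can be solved by Newton's method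
modulo a power of `p`. -/
theorem exists_dvd_eval {σ : R →+* R} {p : R} (hpσ : p ∣ σ p) (k : ℕ)
    {P : R[X]} (hP : ∀ i, p ^ k ∣ σ (P.coeff i) - P.coeff i) {x : R} (hx : σ x = x)
    (h₀ : p ∣ P.eval x) (h₁ : IsCoprime p (P.derivative.eval x)) :
    ∃ z, p ^ k ∣ P.eval z ∧ p ^ k ∣ σ z - z := by
  have hg := pow_dvd_map_pow hpσ k
  set π := Ideal.Quotient.mk (Ideal.span {p ^ k}) with hπ
  obtain ⟨z, hz, hz', -⟩ := exists_fixed_root (quotientInvolution σ hg) (P := P.map π) (x := π x)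
    (by
      ext i
      rw [coeff_map, coeff_map, quotientInvolution_mk]
      exact mk_eq_mk_iff_dvd.mpr (hP i))
    (by rw [quotientInvolution_mk, hx])
    (by rw [eval_map_apply]; exact isNilpotent_mk_of_dvd h₀ k)
    (by
      rw [derivative_map, eval_map_apply]
      obtain ⟨a, b, hab⟩ := h₁.pow_left (m := k)
      refine IsUnit.of_mul_eq_one (π b) ?_
      rw [← map_mul, ← map_one π]
      refine mk_eq_mk_iff_dvd.mpr ⟨-a, ?_⟩
      linear_combination hab)
  obtain ⟨z, rfl⟩ := Ideal.Quotient.mk_surjective z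
  refine ⟨z, ?_, mk_eq_mk_iff_dvd.mp hz'⟩
  rw [eval_map_apply, ← map_zero π] at hz
  simpa using mk_eq_mk_iff_dvd.mp hz

theorem isCoprime_algebraMap {p : R} {a : K} (ha : a ≠ 0) : IsCoprime p (algebraMap K R a) :=
  ⟨0, algebraMap K R a⁻¹, by rw [zero_mul, zero_add, ← map_mul, inv_mul_cancel₀ ha, map_one]⟩

variable {σ : R →+* R} {ε : K} {F : V →ₗ⋆[K] V →ₗ[K] K}

/-- Measure all values by φ(r) = F(w, rv): write F(v, rv) = φ(ar), F(w, rw) = φ(dr) and F(v, rw) =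
φ(βr). Then v + xw is isotropic when p^(k+1) divides a + βx + σ(x) + d·x·σ(x). With x = σ(a)σ(z) and
σ(z) ≡ z this becomes a(1 + 2z + mz²) for m = σ(a)d. Since p divides a, the quadratic equation can
be solved from z = -1/2. -/
theorem IsInvariantForm.exists_isotropic (hF : IsInvariantForm σ ε F) (hσ : IsInvolution K σ)
    (h2 : (2 : K) ≠ 0) {p : R} (hp : (Ideal.span {p}).IsMaximal) (hpσ : p ∣ σ p) {k : ℕ}
    [FiniteDimensional K (R ⧸ Ideal.span {p ^ (k + 1)})] {v w : V}
    (hv : p ^ (k + 1) • v = 0) (hw : p ^ (k + 1) • w = 0)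
    (hvv : ∀ r : R, F v ((p ^ k * r) • v) = 0) (hwv : F w (p ^ k • v) ≠ 0) :
    ∃ x, p ∣ x ∧ ∀ r : R, F (v + x • w) (r • (v + x • w)) = 0 := by
  set φ := coefficientFunctional R F w v with hφ
  have hφF : IsFrobenius (p ^ (k + 1)) φ := isFrobenius_of_ne_zero hp
    (fun r => by rw [hφ, coefficientFunctional_apply, mul_comm, mul_smul, hv, smul_zero, map_zero])
    (r₀ := 1) (by rwa [mul_one])
  obtain ⟨a, ha⟩ := hφF.exists_eq (φ := coefficientFunctional R F v v) fun r => by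
    rw [coefficientFunctional_apply, mul_comm, mul_smul, hv, smul_zero, map_zero]
  obtain ⟨d, hd⟩ := hφF.exists_eq (φ := coefficientFunctional R F w w) fun r => by
    rw [coefficientFunctional_apply, mul_comm, mul_smul, hw, smul_zero, map_zero]
  obtain ⟨β, hβ⟩ := hφF.exists_eq (φ := coefficientFunctional R F v w) fun r => by
    rw [coefficientFunctional_apply, mul_comm, mul_smul, hw, smul_zero, map_zero]
  simp only [coefficientFunctional_apply] at ha hd hβ
  -- The factor β records the symmetry of F: exchanging the arguments v and w costs β and an
  -- application of σ.
  have key : ∀ c r, φ (β * σ c * r) = ε * star (φ (c * σ r)) := fun c r => by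
    rw [mul_assoc, ← hβ, hF.symm, hF.adjoint, map_mul, hσ.apply_apply]
    rfl
  -- Otherwise a would be invertible modulo p, and F(w, pᵏv) = φ(pᵏ) would be a value F(v, pᵏrv),
  -- which is zero.
  have hpa : p ∣ a := by
    rcases dvd_or_isCoprime hp a with h | ⟨x, y, hxy⟩
    · exact h
    · exfalso
      apply hwv
      have : φ (p ^ k) = φ (p ^ (k + 1) * x) + φ (a * (p ^ k * y)) := by
        rw [← map_add]
        congr 1
        linear_combination (-p ^ k) * hxy
      rw [hφF.map_mul_eq_zero, ← ha, hvv, add_zero] at this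
      exact this
  -- The symmetry of r ↦ F(v, rv), expressed through φ.
  have hβa : p ^ (k + 1) ∣ β * σ a - a := hφF.dvd _ fun t => by
    rw [mul_sub, map_sub, mul_comm t, key, mul_comm t a, ← ha, sub_eq_zero, ← ha,
      hF.apply_smul t]
  have hβd : p ^ (k + 1) ∣ β * σ d - d := hφF.dvd _ fun t => by
    rw [mul_sub, map_sub, mul_comm t, key, mul_comm t d, ← hd, sub_eq_zero, ← hd,
      hF.apply_smul t]
  have hpa' : p ∣ σ a := hpσ.trans (map_dvd σ hpa)
  set h : R := algebraMap K R 2⁻¹ with hh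
  have hh2 : 2 * h = 1 := by
    rw [hh, ← map_ofNat (algebraMap K R) 2, ← map_mul, mul_inv_cancel₀ h2, map_one]
  have hσh : σ h = h := by
    have : σ h = 2 * h * σ h := by rw [hh2, one_mul]
    calc σ h = 2 * h * σ h := this
      _ = h * σ (2 * h) := by rw [map_mul, map_ofNat]; ring
      _ = h := by rw [hh2, map_one, mul_one]
  set m := σ a * d with hm
  have hσm : p ^ (k + 1) ∣ σ m - m := by
    have : σ m - m = (β * σ d - d) * σ a - (β * σ a - a) * σ d := by
      rw [hm, map_mul, hσ.apply_apply]; ring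
    rw [this]
    exact dvd_sub (hβd.mul_right _) (hβa.mul_right _)
  have hpm : p ∣ m := hpa'.mul_right _
  -- Modulo p the equation is 2z + 1 = 0, with the simple root -1/2, which is fixed by σ.
  obtain ⟨z, hz, hσz⟩ := exists_dvd_eval hpσ (k + 1) (P := C m * X ^ 2 + C 2 * X + C 1) (x := -h)
    (fun i => by
      rcases i with _ | _ | _ | i
      · simp [coeff_one]
      · simp [coeff_X, coeff_one, map_ofNat]
      · simpa [coeff_X, coeff_one] using hσm
      · simp [coeff_one])
    (by rw [map_neg, hσh])
    (by
      have : eval (-h) (C m * X ^ 2 + C 2 * X + C 1) = m * h ^ 2 := by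
        simp only [eval_add, eval_mul, eval_pow, eval_X, eval_C]
        linear_combination -hh2
      rw [this]
      exact hpm.mul_right _)
    (by
      have : eval (-h) (derivative (C m * X ^ 2 + C 2 * X + C 1)) = algebraMap K R 2 - m := by
        simp only [derivative_add, derivative_mul, derivative_C, derivative_X_pow, derivative_X,
          eval_add, eval_mul, eval_C, eval_pow, eval_X, map_ofNat]
        simp
        linear_combination (-m) * hh2
      rw [this]
      obtain ⟨c, hc⟩ := hpm
      rw [hc, sub_eq_add_neg, ← mul_neg]
      exact (isCoprime_algebraMap h2).add_mul_left_right _)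
  simp only [eval_add, eval_mul, eval_pow, eval_X, eval_C] at hz
  refine ⟨σ a * σ z, hpa'.mul_right _, fun r => ?_⟩
  have e : F (v + (σ a * σ z) • w) (r • (v + (σ a * σ z) • w)) =
      φ ((a + β * σ a * σ z + a * z + d * a * z * σ a * σ z) * r) := by
    have e1 : φ (a * z * r) = F ((σ a * σ z) • w) (r • v) := by
      rw [hF.adjoint, smul_smul, map_mul σ, hσ.apply_apply, hσ.apply_apply]; rfl
    have e2 : φ (β * σ a * σ z * r) = F v (r • (σ a * σ z) • w) := by
      rw [smul_smul, hβ]; congr 1; ring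
    have e3 : φ (d * a * z * σ a * σ z * r) = F ((σ a * σ z) • w) (r • (σ a * σ z) • w) := by
      rw [hF.adjoint, smul_smul, smul_smul, hd, map_mul σ, hσ.apply_apply, hσ.apply_apply]
      congr 1; ring
    rw [add_mul, add_mul, add_mul, map_add φ, map_add φ, map_add φ, e1, e2, e3, ← ha, smul_add,
      map_add, map_add, LinearMap.add_apply, LinearMap.add_apply]
    ring
  rw [e, ← map_zero φ]
  apply hφF.map_eq
  rw [sub_zero]
  apply Dvd.dvd.mul_right
  -- Modulo p^(k+1) one may replace βσ(a) by a and σ(z) by z, which leaves a times the quadratic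
  -- polynomial in z.
  have : a + β * σ a * σ z + a * z + d * a * z * σ a * σ z =
      a * (m * z ^ 2 + 2 * z + 1) + (β * σ a - a) * σ z + (σ z - z) * (a + d * a * σ a * z) := by
    rw [hm]; ring
  rw [this]
  exact dvd_add (dvd_add (hz.mul_left _) (hβa.mul_right _)) (hσz.mul_right _)

/-- After v has been made isotropic, w is corrected by a multiple of v'. The isotropy of v' means
that this adds only the two cross terms and does not change the pairing with v'. -/
theorem IsInvariantForm.exists_isHyperbolic (hF : IsInvariantForm σ ε F) (hσ : IsInvolution K σ)
    (h2 : (2 : K) ≠ 0) {p : R} (hp : (Ideal.span {p}).IsMaximal) (hpσ : p ∣ σ p) {k : ℕ}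
    [FiniteDimensional K (R ⧸ Ideal.span {p ^ (k + 1)})] {v w : V}
    (hv : p ^ (k + 1) • v = 0) (hw : p ^ (k + 1) • w = 0)
    (hvv : ∀ r : R, F v ((p ^ k * r) • v) = 0) (hwv : F w (p ^ k • v) ≠ 0) :
    ∃ v' w', IsHyperbolic σ F (p ^ (k + 1)) v' w' := by
  obtain ⟨x, hpx, hx⟩ := hF.exists_isotropic hσ h2 hp hpσ hv hw hvv hwv
  set v' := v + x • w with hv'_def
  have hv' : p ^ (k + 1) • v' = 0 := by rw [smul_add, hv, smul_comm, hw, smul_zero, add_zero]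
  set φ := coefficientFunctional R F w v' with hφ
  have hwv' : φ (p ^ k * 1) ≠ 0 := by
    -- As p divides x, pᵏ kills the added term x·w up to a multiple of p^(k+1)w = 0, so the pairing
    -- of w with pᵏv' is still nonzero.
    obtain ⟨y, rfl⟩ := hpx
    rw [hφ, coefficientFunctional_apply, mul_one, hv'_def, smul_add, smul_smul,
      show p ^ k * (p * y) = y * p ^ (k + 1) by ring, mul_smul, hw, smul_zero, add_zero]
    exact hwv
  have hφF : IsFrobenius (p ^ (k + 1)) φ := isFrobenius_of_ne_zero hp
    (fun r => by rw [hφ, coefficientFunctional_apply, mul_comm, mul_smul, hv', smul_zero, map_zero])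
    hwv'
  obtain ⟨d, hd⟩ := hφF.exists_eq (φ := coefficientFunctional R F w w) fun r => by
    rw [coefficientFunctional_apply, mul_comm, mul_smul, hw, smul_zero, map_zero]
  simp only [coefficientFunctional_apply, hφ] at hd
  -- Each of the two cross terms contributes -F(w, rw)/2, and together they cancel F(w, rw).
  set c : R := -(2⁻¹ : K) • d with hc
  have hcr : ∀ r, F w ((c * r) • v') = -2⁻¹ * F w (r • w) := fun r => by
    rw [hc, hd, smul_mul_assoc, smul_assoc, map_smul, smul_eq_mul]
  have hstar : star (2⁻¹ : K) = 2⁻¹ := by rw [star_inv₀, star_ofNat]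
  clear_value v'
  refine ⟨v', w + c • v', hx, fun r => ?_, hv', ?_, fun r hr => hφF.dvd r fun t => ?_⟩
  · have e1 : F (c • v') (r • w) = -2⁻¹ * F w (r • w) := by
      rw [hF.symm, hF.adjoint, smul_smul, mul_comm (σ r), hcr, hF.apply_smul r w w, star_mul,
        star_neg, hstar]
      ring
    have e2 : F w (r • c • v') = -2⁻¹ * F w (r • w) := by rw [smul_smul, mul_comm, hcr]
    have e3 : F (c • v') (r • c • v') = 0 := by
      rw [hF.adjoint, smul_smul, smul_smul, hx]
    rw [smul_add, map_add (F _), map_add F, LinearMap.add_apply, LinearMap.add_apply, e1, e2, e3]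
    field_simp
    ring
  · obtain ⟨u, hu⟩ := pow_dvd_map_pow hpσ (k + 1)
    rw [hu, mul_comm, mul_smul, smul_add, hw, smul_comm, hv', smul_zero, add_zero, smul_zero]
  · have := hr t
    rwa [map_add F w, LinearMap.add_apply, hF.adjoint, smul_smul, hx, add_zero] at this

end Lifting

end IsometricPairs

namespace IsometricPairs

open Polynomial
open scoped LaurentPolynomial

/-! ### Anisotropic vectors and the normalization of cyclic forms. -/

section Cyclic

variable {K R V : Type*} [Field K] [StarRing K] [CommRing R] [Algebra K R]
  [AddCommGroup V] [Module K V] [Module R V] [IsScalarTower K R V]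
  {σ : R →+* R} {ε : K} {F : V →ₗ⋆[K] V →ₗ[K] K}

theorem not_dvd_algebraMap {p : R} (hp : (Ideal.span {p}).IsMaximal) {a : K} (ha : a ≠ 0) :
    ¬ p ∣ algebraMap K R a := fun h =>
  hp.ne_top (Ideal.eq_top_of_isUnit_mem _ (Ideal.mem_span_singleton.mpr h)
    ((isUnit_iff_ne_zero.mpr ha).map _))

/-- If `(p)` carries an `ε`-Hermitian functional of exponent `k + 1`, then an invariant form that
pairs two vectors annihilated by `p ^ (k + 1)` nontrivially has an anisotropic one. -/
theorem IsInvariantForm.exists_anisotropic [IsDomain R] (hF : IsInvariantForm σ ε F)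
    (hσ : IsInvolution K σ) (h2 : (2 : K) ≠ 0) (hε : ε ≠ 0) {p : R} (hp0 : p ≠ 0)
    (hp : (Ideal.span {p}).IsMaximal) (hpσ : p ∣ σ p) {k : ℕ} {ℓ : R →ₗ[K] K}
    (hℓ : IsFrobenius (p ^ (k + 1)) ℓ) (hℓσ : ∀ r, ℓ (σ r) = ε * star (ℓ r)) {v w : V}
    (hv : p ^ (k + 1) • v = 0) (hw : p ^ (k + 1) • w = 0) (hwv : F w (p ^ k • v) ≠ 0) :
    ∃ y : V, p ^ (k + 1) • y = 0 ∧ ∃ r : R, F y ((p ^ k * r) • y) ≠ 0 := by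
  by_contra! hcon
  set φ := coefficientFunctional R F w v with hφ
  have hφF : IsFrobenius (p ^ (k + 1)) φ := isFrobenius_of_ne_zero hp
    (fun r => by rw [hφ, coefficientFunctional_apply, mul_comm, mul_smul, hv, smul_zero, map_zero])
    (r₀ := 1) (by rwa [mul_one])
  have hpk : p ^ k ≠ 0 := pow_ne_zero _ hp0
  have cancel : ∀ a, p ^ (k + 1) ∣ p ^ k * a → p ∣ a := fun a h => by
    rw [pow_succ] at h
    exact (mul_dvd_mul_iff_left hpk).mp h
  -- σ(p) = pu, where uσ(u) = 1 because σ is an involution.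
  obtain ⟨u, hu⟩ := hpσ
  have huu : u * σ u = 1 := by
    apply mul_left_cancel₀ hp0
    rw [← mul_assoc, ← hu, ← map_mul, ← hu, hσ.apply_apply, mul_one]
  have hunit : IsUnit (u ^ k) := (IsUnit.of_mul_eq_one _ huu).pow k
  have hσpk : ∀ r, σ (p ^ k * r) = p ^ k * u ^ k * σ r := fun r => by
    rw [map_mul, map_pow, hu, mul_pow]
  -- Polarization: y ↦ F(y, pᵏry) vanishes on w, on cv and on w + cv, so the two cross terms cancel.
  have polar : ∀ r c, φ (p ^ k * r * c) = -(ε * star (φ (p ^ k * u ^ k * σ r * c))) := by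
    intro r c
    have hcv : p ^ (k + 1) • c • v = 0 := by rw [smul_comm, hv, smul_zero]
    have h1 := hcon (w + c • v) (by rw [smul_add, hw, hcv, add_zero]) r
    rw [smul_add, map_add (F _), map_add F, LinearMap.add_apply, LinearMap.add_apply,
      hcon w hw, hcon _ hcv, hF.apply_smul _ (c • v), hσpk, smul_smul, smul_smul] at h1
    simp only [hφ, coefficientFunctional_apply]
    linear_combination h1
  -- Polarizing with the pairs (σ(t), c) and (σ(t)c, 1) gives the same left-hand side. Comparing the
  -- right-hand sides shows that σ acts trivially on R/(p).
  have hdvd : ∀ c, p ∣ c - σ c := fun c => by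
    have : p ^ (k + 1) ∣ p ^ k * (u ^ k * (c - σ c)) := hφF.dvd _ fun t => by
      have h1 := polar (σ t) c
      have h2 := polar (σ t * c) 1
      rw [map_mul σ, hσ.apply_apply, mul_one, mul_one, ← mul_assoc (p ^ k) (σ t) c, h1, neg_inj] at h2
      have h3 := star_injective (mul_left_cancel₀ hε h2)
      rw [hσ.apply_apply] at h3
      rw [show t * (p ^ k * (u ^ k * (c - σ c))) =
        p ^ k * u ^ k * t * c - p ^ k * u ^ k * (t * σ c) by ring, map_sub, h3, sub_self]
    exact hunit.dvd_mul_left.mp (cancel _ this)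
  -- A nonzero constant is not divisible by p, so the involution of K is trivial as well.
  have hstar : ∀ a : K, star a = a := fun a => by
    by_contra h
    refine not_dvd_algebraMap hp (a := a - star a) (sub_ne_zero.mpr (Ne.symm h)) ?_
    rw [map_sub, ← hσ.map_algebraMap]
    exact hdvd _
  have swap : ∀ {θ : R →ₗ[K] K}, IsFrobenius (p ^ (k + 1)) θ → ∀ r,
      θ (p ^ k * u ^ k * σ r) = θ (p ^ k * u ^ k * r) := fun hθ r => by
    apply hθ.map_eq
    obtain ⟨c, hc⟩ := hdvd r
    exact ⟨-(u ^ k * c), by linear_combination (-p ^ k * u ^ k) * hc⟩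
  -- With σ trivial modulo p, the form and the functional ℓ impose opposite signs: φ yields εuᵏ ≡ -1
  -- and ℓ yields εuᵏ ≡ 1. Hence p would divide 2.
  have d1 : p ∣ 1 + algebraMap K R ε * u ^ k := by
    refine cancel _ (hφF.dvd _ fun t => ?_)
    have := polar t 1
    rw [mul_one, mul_one, hstar, swap hφF] at this
    rw [show t * (p ^ k * (1 + algebraMap K R ε * u ^ k)) =
      p ^ k * t + algebraMap K R ε * (p ^ k * u ^ k * t) by ring, map_add, this,
      ← Algebra.smul_def, map_smul, smul_eq_mul]
    ring
  have d2 : p ∣ 1 - algebraMap K R ε * u ^ k := by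
    refine cancel _ (hℓ.dvd _ fun t => ?_)
    have := hℓσ (σ (p ^ k * t))
    rw [hσ.apply_apply, hσpk, hstar, swap hℓ] at this
    rw [show t * (p ^ k * (1 - algebraMap K R ε * u ^ k)) =
      p ^ k * t - algebraMap K R ε * (p ^ k * u ^ k * t) by ring, map_sub, this,
      ← Algebra.smul_def, map_smul, smul_eq_mul, sub_self]
  refine not_dvd_algebraMap hp h2 ?_
  have := dvd_add d1 d2
  rwa [show 1 + algebraMap K R ε * u ^ k + (1 - algebraMap K R ε * u ^ k) =
    algebraMap K R 2 by rw [map_ofNat]; ring] at this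

/-- `y` is annihilated by `g`, and the form on the submodule generated by `y` is given by the
functional `ℓ`. -/
structure IsCyclicForm (F : V →ₗ⋆[K] V →ₗ[K] K) (g : R) (ℓ : R → K) (y : V) : Prop where
  smul_eq_zero : g • y = 0
  apply_smul : ∀ r : R, F y (r • y) = ℓ r

theorem IsCyclicForm.nondegenerateOn {g : R} {ℓ : R →ₗ[K] K} {y : V}
    (h : IsCyclicForm F g ℓ y) (hF : IsInvariantForm σ ε F) (hσ : IsInvolution K σ)
    (hℓ : IsFrobenius g ℓ) : NondegenerateOn F (Submodule.span R {y}) := by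
  intro x hx hx'
  obtain ⟨a, rfl⟩ := Submodule.mem_span_singleton.mp hx
  have : g ∣ a := hℓ.dvd a fun t => by
    have := hF.eq_zero_comm (hx' (σ t • y)
      (Submodule.smul_mem _ _ (Submodule.mem_span_singleton_self y)))
    rwa [hF.adjoint, hσ.apply_apply, smul_smul, h.apply_smul] at this
  obtain ⟨c, rfl⟩ := this
  rw [mul_comm, mul_smul, h.smul_eq_zero, smul_zero]

/-- The form on a cyclic submodule is a multiple of a given one. -/
theorem IsInvariantForm.exists_eq_mul (hF : IsInvariantForm σ ε F) (hσ : IsInvolution K σ)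
    {g : R} [FiniteDimensional K (R ⧸ Ideal.span {g})] {ℓ : R →ₗ[K] K}
    (hℓ : IsFrobenius g ℓ) (hℓσ : ∀ r, ℓ (σ r) = ε * star (ℓ r)) {y : V} (hy : g • y = 0) :
    ∃ n, (∀ r : R, F y (r • y) = ℓ (n * r)) ∧ g ∣ n - σ n := by
  obtain ⟨n, hn⟩ := hℓ.exists_eq (φ := coefficientFunctional R F y y) fun r => by
    rw [coefficientFunctional_apply, mul_comm, mul_smul, hy, smul_zero, map_zero]
  simp only [coefficientFunctional_apply] at hn
  refine ⟨n, hn, hℓ.dvd _ fun t => ?_⟩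
  have h1 := hF.apply_smul t y y
  rw [hn, hn, ← hℓσ, map_mul σ, hσ.apply_apply] at h1
  rw [mul_sub, map_sub, mul_comm t, h1, mul_comm t, sub_self]

/-- A cyclic form can be changed within a residue class modulo `p`. -/
theorem IsInvariantForm.exists_isCyclicForm (hF : IsInvariantForm σ ε F)
    (h2 : (2 : K) ≠ 0) {p : R} (hpσ : p ∣ σ p) {k : ℕ} {ℓ : R →ₗ[K] K}
    (hℓ : IsFrobenius (p ^ (k + 1)) ℓ) {y : V} (hy : p ^ (k + 1) • y = 0)
    {n q : R} (hn : ∀ r : R, F y (r • y) = ℓ (n * r)) (hnσ : p ^ (k + 1) ∣ n - σ n)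
    (hpn : IsCoprime p n) (hq : σ q = q) (hqn : p ∣ q - n) :
    ∃ y', IsCyclicForm F (p ^ (k + 1)) (fun r => ℓ (q * r)) y' := by
  -- x is an inverse of n modulo p^(k+1), and so is fixed by σ modulo p^(k+1).
  obtain ⟨b, x, hx⟩ := hpn.pow_left (m := k + 1)
  have hxσ : p ^ (k + 1) ∣ σ x - x := by
    obtain ⟨c, hc⟩ := hnσ
    obtain ⟨d, hd⟩ := pow_dvd_map_pow hpσ (k + 1)
    have h1 : σ b * σ (p ^ (k + 1)) + σ x * σ n = 1 := by
      rw [← map_mul, ← map_mul, ← map_add, hx, map_one]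
    rw [hd] at h1
    have h3 : σ x - x = p ^ (k + 1) * (σ x * b - x * σ b * d + x * σ x * c) := by
      linear_combination (-σ x) * hx + x * h1 + x * σ x * hc
    exact ⟨_, h3⟩
  -- t is a square root of q/n, found near 1 since q ≡ n modulo p. As σ(t) ≡ t, passing from y to ty
  -- multiplies n by σ(t)t ≡ q/n.
  obtain ⟨t, ht, htσ⟩ := exists_dvd_eval hpσ (k + 1) (P := X ^ 2 - C (x * q)) (x := 1)
    (fun i => by
      rcases i with _ | i
      · obtain ⟨c, hc⟩ := hxσ
        simp only [coeff_sub, coeff_X_pow, coeff_C]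
        simp [hq]
        exact ⟨-c * q, by linear_combination (-q) * hc⟩
      · have : (X ^ 2 - C (x * q)).coeff (i + 1) = if i + 1 = 2 then 1 else 0 := by
          simp [coeff_X_pow]
        rw [this]
        split_ifs <;> simp) (map_one σ)
    (by
      have e : eval 1 (X ^ 2 - C (x * q)) = b * p ^ (k + 1) - x * (q - n) := by
        simp only [eval_sub, eval_pow, eval_X, eval_C]
        linear_combination -hx
      rw [e]
      exact dvd_sub ((dvd_pow_self p k.succ_ne_zero).mul_left _) (hqn.mul_left _))
    (by
      have : eval 1 (derivative (X ^ 2 - C (x * q))) = algebraMap K R 2 := by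
        simp [map_ofNat, one_add_one_eq_two]
      rw [this]
      exact isCoprime_algebraMap h2)
  refine ⟨t • y, by rw [smul_comm, hy, smul_zero], fun r => ?_⟩
  rw [hF.adjoint, smul_smul, smul_smul, hn]
  apply hℓ.map_eq
  simp only [eval_sub, eval_pow, eval_X, eval_C] at ht
  obtain ⟨c, hc⟩ := ht
  obtain ⟨d, hd⟩ := htσ
  exact ⟨n * t * r * d + n * c * r - b * q * r, by
    linear_combination n * t * r * hd + n * r * hc + q * r * hx⟩

end Cyclic

end IsometricPairs

namespace IsometricPairs

open Polynomial
open scoped LaurentPolynomial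

/-! ### Multiplicities of the cyclic summands R/(p^(k+1)). -/

section Multiplicity

variable {R V : Type*} [CommRing R] [AddCommGroup V] [Module R V]

/-- The finite family `w` generates the module as a direct sum of cyclic modules `R / (g t)`. -/
structure IsCyclicDecomposition {T : Type*} [Fintype T] (g : T → R) (w : T → V) : Prop where
  exists_eq : ∀ v, ∃ a : T → R, v = ∑ t, a t • w t
  smul_eq_zero : ∀ a : T → R, ∑ t, a t • w t = 0 → ∀ t, a t • w t = 0
  smul_eq_zero_iff : ∀ t (a : R), a • w t = 0 ↔ g t ∣ a

/-- The module `R / (g)` has no direct summand `R / (p ^ (k + 1))`: every element annihilated by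
`p ^ (k + 1)` is mapped by `p ^ k` to a multiple of `p ^ (k + 1)`. -/
def NoSummand (p : R) (k : ℕ) (g : R) : Prop :=
  ∀ a, g ∣ p ^ (k + 1) * a → ∃ b, g ∣ p ^ k * a - p ^ (k + 1) * b

/-- If p' is not associated to p, then p^(k+1) acts invertibly on R/(p'^s) and annihilates only
zero. Otherwise s ≠ k + 1: for s ≤ k the power pᵏ already acts as zero, and for s > k + 1 the
elements killed by p^(k+1) are multiples of p. -/
theorem noSummand_of_not_associated [IsDomain R] {p p' : R} (hp : (Ideal.span {p}).IsMaximal)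
    (hp' : (Ideal.span {p'}).IsMaximal) (hp0 : p ≠ 0) {k s : ℕ}
    (h : ¬ Associated (p' ^ s) (p ^ (k + 1))) : NoSummand p k (p' ^ s) := by
  intro a ha
  rcases dvd_or_isCoprime hp' p with hd | hc
  · have hass : Associated p' p := by
      rw [← Ideal.span_singleton_eq_span_singleton]
      exact (hp.eq_of_le hp'.ne_top (Ideal.span_singleton_le_span_singleton.mpr hd)).symm
    have hs := hass.pow_pow (n := s)
    rcases lt_trichotomy s (k + 1) with hlt | rfl | hgt
    · refine ⟨0, ?_⟩
      rw [mul_zero, sub_zero]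
      exact hs.dvd.trans ((pow_dvd_pow p (by omega)).mul_right _)
    · exact absurd hs h
    · obtain ⟨j, rfl⟩ : ∃ j, s = k + 1 + (j + 1) := ⟨s - k - 2, by omega⟩
      have h1 : p ^ (k + 1) * p ^ (j + 1) ∣ p ^ (k + 1) * a := by
        rw [← pow_add]
        exact hs.symm.dvd.trans ha
      obtain ⟨c, rfl⟩ := (mul_dvd_mul_iff_left (pow_ne_zero _ hp0)).mp h1
      exact ⟨p ^ j * c, by ring_nf; simp⟩
  · refine ⟨0, ?_⟩
    rw [mul_zero, sub_zero]
    exact ((hc.pow (m := s) (n := k + 1)).dvd_of_dvd_mul_left ha).mul_left _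

namespace IsCyclicDecomposition

variable {T : Type*} [Fintype T] {g : T → R} {w : T → V}

theorem sum_comp_eq {J : Type*} [Fintype J] {ι : J → T} (hι : Function.Injective ι)
    (x : J → R) : ∑ j, x j • w (ι j) = ∑ t, Function.extend ι x 0 t • w t :=
  Fintype.sum_of_injective ι hι _ _
    (fun t ht => by rw [Function.extend_apply' _ _ _ (by simpa using ht), Pi.zero_apply, zero_smul])
    (fun j => by rw [hι.extend_apply])

/-- On the summands R/(p^(k+1)), the condition that pᵏ maps a vector into p^(k+1)V detects exactly
the coordinates that vanish in the residue field. The condition itself does not mention the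
decomposition. -/
theorem exists_smul_sum_eq_iff [IsDomain R] (h : IsCyclicDecomposition g w) {p : R} (hp0 : p ≠ 0)
    {k : ℕ} {J : Type*} [Fintype J] {ι : J → T} (hι : Function.Injective ι)
    (hJ : ∀ j, Associated (g (ι j)) (p ^ (k + 1))) (x : J → R) :
    (∃ z : V, p ^ k • ∑ j, x j • w (ι j) = p ^ (k + 1) • z) ↔ ∀ j, p ∣ x j := by
  constructor
  · rintro ⟨z, hz⟩ j
    obtain ⟨b, rfl⟩ := h.exists_eq z
    rw [sum_comp_eq hι, Finset.smul_sum, Finset.smul_sum, ← sub_eq_zero,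
      ← Finset.sum_sub_distrib] at hz
    simp only [smul_smul, ← sub_smul] at hz
    have h1 := h.smul_eq_zero _ hz (ι j)
    rw [h.smul_eq_zero_iff, hι.extend_apply, (hJ j).dvd_iff_dvd_left] at h1
    have h2 : p ^ (k + 1) ∣ p ^ k * x j := by
      have := dvd_add h1 (Dvd.intro (b (ι j)) rfl : p ^ (k + 1) ∣ p ^ (k + 1) * b (ι j))
      rwa [sub_add_cancel] at this
    rw [pow_succ] at h2
    exact (mul_dvd_mul_iff_left (pow_ne_zero _ hp0)).mp h2
  · intro hx
    choose y hy using hx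
    refine ⟨∑ j, y j • w (ι j), ?_⟩
    rw [pow_succ, mul_smul, Finset.smul_sum (r := p)]
    simp only [smul_smul, hy]

theorem smul_sum_eq_zero (h : IsCyclicDecomposition g w) {p : R} {k : ℕ} {J : Type*} [Fintype J]
    {ι : J → T} (hJ : ∀ j, Associated (g (ι j)) (p ^ (k + 1))) (x : J → R) :
    p ^ (k + 1) • ∑ j, x j • w (ι j) = 0 := by
  rw [Finset.smul_sum]
  refine Finset.sum_eq_zero fun j _ => ?_
  rw [smul_comm, (h.smul_eq_zero_iff _ _).mpr (hJ j).dvd, smul_zero]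

/-- The complement to `exists_smul_sum_eq_iff`: the other summands do not contribute to the residue
space, so the chosen generators span it. -/
theorem exists_smul_sub_sum_eq (h : IsCyclicDecomposition g w) {p : R}
    {k : ℕ} {J : Type*} [Fintype J] {ι : J → T} (hι : Function.Injective ι)
    (hT : ∀ t, t ∉ Set.range ι → NoSummand p k (g t)) {v : V} (hv : p ^ (k + 1) • v = 0) :
    ∃ (x : J → R) (z : V), p ^ k • (v - ∑ j, x j • w (ι j)) = p ^ (k + 1) • z := by
  obtain ⟨a, rfl⟩ := h.exists_eq v
  rw [Finset.smul_sum] at hv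
  simp only [smul_smul] at hv
  have ha := h.smul_eq_zero _ hv
  have : ∀ t, ∃ b : R, (p ^ k * (a t - Function.extend ι (a ∘ ι) 0 t)) • w t =
      (p ^ (k + 1) * b) • w t := by
    intro t
    by_cases ht : t ∈ Set.range ι
    · obtain ⟨j, rfl⟩ := ht
      exact ⟨0, by simp [hι.extend_apply]⟩
    · obtain ⟨b, hb⟩ := hT t ht (a t) ((h.smul_eq_zero_iff _ _).mp (ha t))
      refine ⟨b, ?_⟩
      rw [Function.extend_apply' _ _ _ (by simpa using ht), Pi.zero_apply, sub_zero, ← sub_eq_zero,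
        ← sub_smul, h.smul_eq_zero_iff]
      exact hb
  choose b hb using this
  refine ⟨a ∘ ι, ∑ t, b t • w t, ?_⟩
  rw [sum_comp_eq hι, ← Finset.sum_sub_distrib, Finset.smul_sum, Finset.smul_sum]
  refine Finset.sum_congr rfl fun t _ => ?_
  rw [← sub_smul, smul_smul, hb, smul_smul]

end IsCyclicDecomposition

/-- P and P' are both identified with the common range of f and f'. Below they are the coordinate
spaces of two decompositions, and N is a quotient of V. -/
theorem exists_linearEquiv_of_ker_eq {M M' N P P' : Type*} [AddCommGroup M] [AddCommGroup M']
    [AddCommGroup N] [AddCommGroup P] [AddCommGroup P'] [Module R M] [Module R M'] [Module R N]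
    [Module R P] [Module R P'] (f : M →ₗ[R] N) (f' : M' →ₗ[R] N) (e : M →ₗ[R] P)
    (e' : M' →ₗ[R] P') (he : Function.Surjective e) (he' : Function.Surjective e')
    (hf : LinearMap.ker e = LinearMap.ker f) (hf' : LinearMap.ker e' = LinearMap.ker f')
    (hff : LinearMap.range f = LinearMap.range f') :
    ∃ θ : P ≃ₗ[R] P', ∀ m m', θ (e m) = e' m' → f m = f' m' := by
  let α : P ≃ₗ[R] LinearMap.range f := (e.quotKerEquivOfSurjective he).symm ≪≫ₗ
    Submodule.quotEquivOfEq _ _ hf ≪≫ₗ f.quotKerEquivRange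
  let α' : P' ≃ₗ[R] LinearMap.range f' := (e'.quotKerEquivOfSurjective he').symm ≪≫ₗ
    Submodule.quotEquivOfEq _ _ hf' ≪≫ₗ f'.quotKerEquivRange
  have hα : ∀ m, (α (e m) : N) = f m := fun m => by
    have : (e.quotKerEquivOfSurjective he).symm (e m) = Submodule.Quotient.mk m := by
      rw [LinearEquiv.symm_apply_eq]; rfl
    simp only [α, LinearEquiv.trans_apply, this]
    rfl
  have hα' : ∀ m, (α' (e' m) : N) = f' m := fun m => by
    have : (e'.quotKerEquivOfSurjective he').symm (e' m) = Submodule.Quotient.mk m := by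
      rw [LinearEquiv.symm_apply_eq]; rfl
    simp only [α', LinearEquiv.trans_apply, this]
    rfl
  refine ⟨α ≪≫ₗ LinearEquiv.ofEq _ _ hff ≪≫ₗ α'.symm, fun m m' h => ?_⟩
  rw [LinearEquiv.trans_apply, LinearEquiv.trans_apply, LinearEquiv.symm_apply_eq] at h
  rw [← hα, ← hα', ← h]
  rfl

/-- The summands `R / (p ^ (k + 1))` of a module, up to isomorphism of the corresponding spaces
over the residue field. -/
theorem exists_residue_equiv [IsDomain R] {p : R} (hp0 : p ≠ 0) {k : ℕ}
    {L : Type*} [Field L] (ev : R →+* L) (hev : Function.Surjective ev)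
    (hker : ∀ r, ev r = 0 ↔ p ∣ r)
    {T T' : Type*} [Fintype T] [Fintype T'] {g : T → R} {w : T → V} {g' : T' → R} {w' : T' → V}
    (h : IsCyclicDecomposition g w) (h' : IsCyclicDecomposition g' w')
    {J J' : Type*} [Fintype J] [Fintype J'] {ι : J → T} {ι' : J' → T'}
    (hι : Function.Injective ι) (hι' : Function.Injective ι')
    (hJ : ∀ j, Associated (g (ι j)) (p ^ (k + 1)))
    (hJ' : ∀ j, Associated (g' (ι' j)) (p ^ (k + 1)))
    (hT : ∀ t, t ∉ Set.range ι → NoSummand p k (g t))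
    (hT' : ∀ t, t ∉ Set.range ι' → NoSummand p k (g' t)) :
    ∃ e : (J → L) ≃ₗ[L] (J' → L), ∀ (x : J → R) (y : J' → R),
      (e fun j => ev (x j)) = (fun j => ev (y j)) →
      ∃ z : V, p ^ k • (∑ j, x j • w (ι j) - ∑ j, y j • w' (ι' j)) = p ^ (k + 1) • z := by
  let _ : Module R L := Module.compHom L ev
  have hsmul : ∀ (r : R) (l : L), r • l = ev r * l := fun r l => rfl
  -- The vectors that pᵏ maps into p^(k+1)V. The residue space lives in V / Q.
  let Q : Submodule R V := (LinearMap.range (LinearMap.lsmul R V (p ^ (k + 1)))).comap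
    (LinearMap.lsmul R V (p ^ k))
  have hQ : ∀ v, v ∈ Q ↔ ∃ z, p ^ k • v = p ^ (k + 1) • z := fun v =>
    ⟨fun ⟨z, hz⟩ => ⟨z, hz.symm⟩, fun ⟨z, hz⟩ => ⟨z, hz.symm⟩⟩
  let evJ : ∀ I : Type _, (I → R) →ₗ[R] (I → L) := fun I =>
    { toFun := fun x i => ev (x i)
      map_add' := fun x y => by ext; simp
      map_smul' := fun r x => by ext; simp [hsmul] }
  let evJ' : ∀ I : Type _, (I → R) →ₗ[R] (I → L) := fun I =>
    { toFun := fun x i => ev (x i)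
      map_add' := fun x y => by ext; simp
      map_smul' := fun r x => by ext; simp [hsmul] }
  let f : (J → R) →ₗ[R] V ⧸ Q := Q.mkQ ∘ₗ Fintype.linearCombination R (w ∘ ι)
  let f' : (J' → R) →ₗ[R] V ⧸ Q := Q.mkQ ∘ₗ Fintype.linearCombination R (w' ∘ ι')
  have hf : ∀ x, f x = Q.mkQ (∑ j, x j • w (ι j)) := fun x => rfl
  have hf' : ∀ x, f' x = Q.mkQ (∑ j, x j • w' (ι' j)) := fun x => rfl
  obtain ⟨θ, hθ⟩ := exists_linearEquiv_of_ker_eq f f' (evJ J) (evJ' J')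
    (fun x => by
      choose y hy using fun j => hev (x j)
      exact ⟨y, funext hy⟩)
    (fun x => by
      choose y hy using fun j => hev (x j)
      exact ⟨y, funext hy⟩)
    (by
      ext x
      rw [LinearMap.mem_ker, LinearMap.mem_ker, hf, Submodule.mkQ_apply,
        Submodule.Quotient.mk_eq_zero, hQ, h.exists_smul_sum_eq_iff hp0 hι hJ]
      simp only [← hker]
      exact funext_iff)
    (by
      ext x
      rw [LinearMap.mem_ker, LinearMap.mem_ker, hf', Submodule.mkQ_apply,
        Submodule.Quotient.mk_eq_zero, hQ, h'.exists_smul_sum_eq_iff hp0 hι' hJ']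
      simp only [← hker]
      exact funext_iff)
    (by
      -- Both ranges are the image in V / Q of the vectors killed by p^(k+1).
      apply le_antisymm
      · rintro _ ⟨x, rfl⟩
        obtain ⟨y, hy⟩ := h'.exists_smul_sub_sum_eq hι' hT' (h.smul_sum_eq_zero hJ x)
        refine ⟨y, ?_⟩
        rw [hf, hf', eq_comm, ← sub_eq_zero, ← map_sub, Submodule.mkQ_apply,
          Submodule.Quotient.mk_eq_zero, hQ]
        exact hy
      · rintro _ ⟨x, rfl⟩
        obtain ⟨y, hy⟩ := h.exists_smul_sub_sum_eq hι hT (h'.smul_sum_eq_zero hJ' x)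
        refine ⟨y, ?_⟩
        rw [hf, hf', eq_comm, ← sub_eq_zero, ← map_sub, Submodule.mkQ_apply,
          Submodule.Quotient.mk_eq_zero, hQ]
        exact hy)
  -- As `ev` is surjective, an R-linear map between spaces over L is L-linear.
  refine ⟨{ θ with
    map_smul' := fun l x => by
      obtain ⟨r, rfl⟩ := hev l
      exact θ.map_smul r x }, fun x y hxy => ?_⟩
  have := hθ x y hxy
  rw [hf, hf', ← sub_eq_zero, ← map_sub, Submodule.mkQ_apply, Submodule.Quotient.mk_eq_zero,
    hQ] at this
  exact this

end Multiplicity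

/-! ### The Hermitian form over the residue field as an invariant. -/

section Invariants

variable {K R V : Type*} [Field K] [StarRing K] [CommRing R] [Algebra K R]
  [AddCommGroup V] [Module K V] [Module R V] [IsScalarTower K R V]
  {σ : R →+* R} {ε : K} {F : V →ₗ⋆[K] V →ₗ[K] K}

/-- Sums of mutually orthogonal cyclic forms. -/
theorem apply_sum_smul (hF : IsInvariantForm σ ε F) {J : Type*} [Fintype J] {y : J → V} {g : R}
    {ℓ : R →ₗ[K] K} {q : J → R} (hy : ∀ j, IsCyclicForm F g (fun r => ℓ (q j * r)) (y j))
    (horth : ∀ i j, i ≠ j → ∀ r : R, F (y i) (r • y j) = 0) (a b : J → R) (r : R) :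
    F (∑ j, a j • y j) (r • ∑ j, b j • y j) = ℓ (r * ∑ j, q j * σ (a j) * b j) := by
  classical
  rw [map_sum, LinearMap.sum_apply, Finset.mul_sum, map_sum]
  refine Finset.sum_congr rfl fun i _ => ?_
  rw [hF.adjoint, Finset.smul_sum, Finset.smul_sum, map_sum, Finset.sum_eq_single i]
  · rw [smul_smul, smul_smul, (hy i).apply_smul]
    congr 1; ring
  · intro j _ hj
    rw [smul_smul, smul_smul, horth i j (Ne.symm hj)]
  · simp

/-- The Hermitian forms over the residue field attached to two decompositions are equivalent. -/
theorem hermitianEquivalent_of_decompositions [IsDomain R] (hF : IsInvariantForm σ ε F)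
    (hσ : IsInvolution K σ) {p : R} (hp0 : p ≠ 0) (hpσ : p ∣ σ p) {k : ℕ}
    {L : Type*} [Field L] (ev : R →+* L) (hev : Function.Surjective ev)
    (hker : ∀ r, ev r = 0 ↔ p ∣ r) (τ : L →+* L) (hτ : ∀ r, τ (ev r) = ev (σ r))
    {ℓ : R →ₗ[K] K} (hℓ : IsFrobenius (p ^ (k + 1)) ℓ)
    {T T' : Type*} [Fintype T] [Fintype T'] {g : T → R} {w : T → V} {g' : T' → R} {w' : T' → V}
    (h : IsCyclicDecomposition g w) (h' : IsCyclicDecomposition g' w')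
    {J J' : Type*} [Fintype J] [Fintype J'] {ι : J → T} {ι' : J' → T'}
    (hι : Function.Injective ι) (hι' : Function.Injective ι')
    (hJ : ∀ j, Associated (g (ι j)) (p ^ (k + 1)))
    (hJ' : ∀ j, Associated (g' (ι' j)) (p ^ (k + 1)))
    (hT : ∀ t, t ∉ Set.range ι → NoSummand p k (g t))
    (hT' : ∀ t, t ∉ Set.range ι' → NoSummand p k (g' t))
    {q : J → R} (hq : ∀ j, IsCyclicForm F (p ^ (k + 1)) (fun r => ℓ (q j * r)) (w (ι j)))
    (horth : ∀ i j, i ≠ j → ∀ r : R, F (w (ι i)) (r • w (ι j)) = 0)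
    {q' : J' → R} (hq' : ∀ j, IsCyclicForm F (p ^ (k + 1)) (fun r => ℓ (q' j * r)) (w' (ι' j)))
    (horth' : ∀ i j, i ≠ j → ∀ r : R, F (w' (ι' i)) (r • w' (ι' j)) = 0) :
    HermitianEquivalent τ (fun j => ev (q j)) (fun j => ev (q' j)) := by
  obtain ⟨e, he⟩ := exists_residue_equiv hp0 ev hev hker h h' hι hι' hJ hJ' hT hT'
  refine ⟨e, fun x y => ?_⟩
  choose a ha using fun j => hev (x j)
  choose b hb using fun j => hev (y j)
  choose a' ha' using fun j => hev (e x j)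
  choose b' hb' using fun j => hev (e y j)
  obtain ⟨z, hz⟩ := he a a' (by rw [funext ha, funext ha'])
  obtain ⟨z', hz'⟩ := he b b' (by rw [funext hb, funext hb'])
  simp only [← ha, ← hb, ← ha', ← hb', hτ, ← map_mul, ← map_sum]
  rw [← sub_eq_zero, ← map_sub, hker]
  set δ := ∑ j, q' j * σ (a' j) * b' j - ∑ j, q j * σ (a j) * b j with hδ
  -- The factor pᵏ makes δ computable from F: ℓ(t·pᵏ·δ) is a difference of two values of F, and
  -- these depend only on classes in the residue space.
  suffices p ^ (k + 1) ∣ p ^ k * δ by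
    rw [pow_succ] at this
    exact (mul_dvd_mul_iff_left (pow_ne_zero _ hp0)).mp this
  refine hℓ.dvd _ fun t => ?_
  have e1 : ℓ (t * (p ^ k * δ)) =
      F (∑ j, a' j • w' (ι' j)) ((t * p ^ k) • ∑ j, b' j • w' (ι' j)) -
        F (∑ j, a j • w (ι j)) ((t * p ^ k) • ∑ j, b j • w (ι j)) := by
    rw [apply_sum_smul hF hq horth, apply_sum_smul hF hq' horth', ← map_sub, hδ]
    congr 1; ring
  rw [e1]
  have kx' := h'.smul_sum_eq_zero hJ' a'
  have ky := h.smul_sum_eq_zero hJ b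
  set x' := ∑ j, a' j • w' (ι' j)
  set y' := ∑ j, b' j • w' (ι' j)
  set x₀ := ∑ j, a j • w (ι j)
  set y₀ := ∑ j, b j • w (ι j)
  obtain ⟨u, hu⟩ := pow_dvd_map_pow hpσ (k + 1)
  -- pᵏ(y' - y₀) lies in p^(k+1)V, and moving p^(k+1) to the other argument kills x'.
  have f1 : F x' ((t * p ^ k) • y') = F x' ((t * p ^ k) • y₀) := by
    rw [← sub_eq_zero, ← map_sub, ← smul_sub, mul_smul, ← neg_sub y₀ y', smul_neg, hz',
      smul_neg, smul_smul, map_neg, neg_eq_zero, hF.adjoint' hσ, map_mul, hu,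
      show σ t * (p ^ (k + 1) * u) = σ t * u * p ^ (k + 1) by ring, mul_smul, kx', smul_zero,
      map_zero, LinearMap.zero_apply]
  -- The same argument on the left, where now y₀ is killed by p^(k+1).
  have f2 : F x' ((t * p ^ k) • y₀) = F x₀ ((t * p ^ k) • y₀) := by
    obtain ⟨u', hu'⟩ := pow_dvd_map_pow hpσ k
    rw [eq_comm, ← sub_eq_zero, ← LinearMap.sub_apply, ← map_sub, hF.adjoint' hσ, map_mul, hu',
      show σ t * (p ^ k * u') = σ t * u' * p ^ k by ring, mul_smul, hz, smul_smul, hF.adjoint,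
      map_mul, hu, show σ (σ t * u') * (p ^ (k + 1) * u) = σ (σ t * u') * u * p ^ (k + 1) by ring,
      mul_smul, ky, smul_zero, map_zero]
  rw [f1, f2, sub_self]

end Invariants

end IsometricPairs

namespace IsometricPairs

open Polynomial
open scoped LaurentPolynomial Matrix

/-! ### Lifting a congruence of Hermitian matrices through a nilpotent ideal. -/

section MatrixLifting

/-- A Hermitian matrix over a commutative ring with involution `τ` that is congruent to an
invertible diagonal matrix modulo nilpotent elements is equivalent to it. -/
theorem exists_transform_of_isNilpotent {S J : Type*} [CommRing S] [Fintype J] [DecidableEq J]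
    (τ : S →+* S) (h2 : IsUnit (2 : S)) {d : J → S} (hd : ∀ j, τ (d j) = d j)
    (hd' : ∀ j, IsUnit (d j)) {H : Matrix J J S} (hH : (H.map τ)ᵀ = H) {π : S} (hπ : IsNilpotent π)
    (hHd : ∀ i j, π ∣ H i j - Matrix.diagonal d i j) :
    ∃ t : Matrix J J S, (t.map τ)ᵀ * H * t = Matrix.diagonal d := by
  set D := Matrix.diagonal d with hD
  choose u hu using hd'
  set D' := Matrix.diagonal fun j => ((u j)⁻¹ : Sˣ).val with hD'
  have hDD' : D * D' = 1 := by
    rw [hD, hD', Matrix.diagonal_mul_diagonal]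
    simp [← hu]
  have hD'D : D' * D = 1 := by
    rw [hD, hD', Matrix.diagonal_mul_diagonal]
    simp [← hu]
  have hDτ : (D.map τ)ᵀ = D := by
    rw [hD, Matrix.diagonal_map (map_zero τ), Matrix.diagonal_transpose]
    congr 1
    exact funext hd
  have hmul : ∀ A B : Matrix J J S, ((A * B).map τ)ᵀ = (B.map τ)ᵀ * (A.map τ)ᵀ := fun A B => by
    rw [Matrix.map_mul, Matrix.transpose_mul]
  have hD'τ : (D'.map τ)ᵀ = D' := by
    have h1 := hmul D D'
    rw [hDD', Matrix.map_one _ (map_zero τ) (map_one τ), Matrix.transpose_one, hDτ] at h1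
    calc (D'.map τ)ᵀ = (D'.map τ)ᵀ * (D * D') := by rw [hDD', mul_one]
      _ = D' := by rw [← mul_assoc, ← h1, one_mul]
  choose Z hZ using hHd
  -- D' is the inverse of D, so D'H is unipotent and has a square root s.
  have hN : D' * H - 1 = π • (D' * Matrix.of Z) := by
    have : H = D + π • Matrix.of Z := by
      ext i j
      simp [← hZ]
    rw [this, mul_add, hD'D, add_sub_cancel_left, Matrix.mul_smul]
  have hnil : IsNilpotent (D' * H - 1) := by
    obtain ⟨n, hn⟩ := hπ
    exact ⟨n, by rw [hN, _root_.smul_pow, hn, zero_smul]⟩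
  obtain ⟨v, hv⟩ := h2
  set h : Matrix J J S := ((v⁻¹ : Sˣ) : S) • 1 with hh
  have h2h : 2 * h = 1 := by
    rw [hh, Matrix.mul_smul, mul_one, show (2 : Matrix J J S) = (2 : S) • 1 by
      ext i j; simp [Matrix.one_apply, Matrix.ofNat_apply, ← hv], smul_smul, ← hv, Units.inv_mul,
      one_smul]
  have hvτ : τ ((v⁻¹ : Sˣ) : S) = ((v⁻¹ : Sˣ) : S) := by
    have : τ ((v⁻¹ : Sˣ) : S) * v = 1 := by
      have := congrArg τ (v.inv_mul)
      rwa [map_mul, hv, map_ofNat, map_one, ← hv] at this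
    rw [← mul_one (τ _), ← v.mul_inv, ← mul_assoc, this, one_mul]
  have hcomm : ∀ x : Matrix J J S, x * h = h * x := fun x => by simp [hh]
  obtain ⟨s, hs, hss⟩ := exists_sq_eq_of_isNilpotent_sub_one h2h hnil
  -- D'H and the scalar 1/2 are self-adjoint with respect to D, and in a commutative subring
  -- self-adjointness passes to products. Thus the square root s, a member of this subring, is
  -- self-adjoint too.
  have hadj : ∀ x ∈ Subring.closure {D' * H, h}, (x.map τ)ᵀ * D = D * x := by
    have hC : IsMulCommutative (Subring.closure {D' * H, h}) :=
      Subring.isMulCommutative_closure (by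
        rintro x (rfl | rfl) y (rfl | rfl) <;> first | rfl | exact hcomm _ | exact (hcomm _).symm)
    intro x hx
    induction hx using Subring.closure_induction with
    | mem x hx =>
      rcases hx with rfl | rfl
      · rw [hmul, hH, hD'τ, mul_assoc, hD'D, mul_one, ← mul_assoc, hDD', one_mul]
      · rw [hcomm]
        congr 1
        rw [hh]
        ext i j
        by_cases hij : i = j
        · subst hij; simp [hvτ]
        · simp [Matrix.one_apply_ne hij, Matrix.one_apply_ne (Ne.symm hij)]
    | zero => simp [Matrix.map_zero _ (map_zero τ)]
    | one => simp [Matrix.map_one _ (map_zero τ) (map_one τ)]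
    | add x y _ _ hx hy =>
      rw [Matrix.map_add _ (map_add τ), Matrix.transpose_add, add_mul, mul_add, hx, hy]
    | neg x _ hx =>
      have : (-x).map τ = -(x.map τ) := by ext; simp
      rw [this, Matrix.transpose_neg, neg_mul, mul_neg, hx]
    | mul x y hx' hy' hx hy =>
      have hxy : y * x = x * y := congrArg Subtype.val
        (mul_comm' (⟨y, hy'⟩ : Subring.closure {D' * H, h}) ⟨x, hx'⟩)
      rw [hmul, mul_assoc, hx, ← mul_assoc, hy, mul_assoc, hxy]
  have hunit : IsUnit (s * s) := by
    rw [hss]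
    have := hnil.isUnit_one_add
    rwa [add_sub_cancel] at this
  have hsu : IsUnit s := (Commute.isUnit_mul_iff (Commute.refl s)).mp hunit |>.1
  obtain ⟨s, rfl⟩ := hsu
  -- Self-adjointness gives s*Ds = Ds² = H, so s⁻¹ carries H to D.
  refine ⟨(s⁻¹ : (Matrix J J S)ˣ), ?_⟩
  have e1 : H = ((s : Matrix J J S).map τ)ᵀ * D * s := by
    rw [hadj _ hs, mul_assoc, hss, ← mul_assoc, hDD', one_mul]
  have e2 : (((s⁻¹ : (Matrix J J S)ˣ) : Matrix J J S).map τ)ᵀ * ((s : Matrix J J S).map τ)ᵀ = 1 := by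
    rw [← hmul, Units.mul_inv, Matrix.map_one _ (map_zero τ) (map_one τ), Matrix.transpose_one]
  rw [e1]
  calc _ = ((((s⁻¹ : (Matrix J J S)ˣ) : Matrix J J S).map τ)ᵀ * ((s : Matrix J J S).map τ)ᵀ) * D *
      (s * ((s⁻¹ : (Matrix J J S)ˣ) : Matrix J J S)) := by simp only [mul_assoc]
    _ = D := by rw [e2, Units.mul_inv, one_mul, mul_one]

end MatrixLifting

/-! ### Replacing a group of cyclic summands by another with equivalent residue form. -/

section Replacement

variable {K R V : Type*} [Field K] [StarRing K] [CommRing R] [Algebra K R]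
  [AddCommGroup V] [Module K V] [Module R V] [IsScalarTower K R V]
  {σ : R →+* R} {ε : K} {F : V →ₗ⋆[K] V →ₗ[K] K}

/-- A family of mutually orthogonal cyclic forms of the same kind can be replaced by another one
if the Hermitian forms over the residue field are equivalent. -/
theorem exists_replacement (hF : IsInvariantForm σ ε F)
    (hσ : IsInvolution K σ) (h2 : (2 : K) ≠ 0) {p : R} (hpσ : p ∣ σ p) {k : ℕ}
    {L : Type*} [Field L] (ev : R →+* L) (hev : Function.Surjective ev)
    (hker : ∀ r, ev r = 0 ↔ p ∣ r) (τ : L →+* L) (hτ : ∀ r, τ (ev r) = ev (σ r))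
    {ℓ : R →ₗ[K] K} (hℓ : IsFrobenius (p ^ (k + 1)) ℓ)
    {J J' : Type*} [Fintype J] [Fintype J'] {y : J → V}
    {q : J → R} (hq : ∀ j, IsCyclicForm F (p ^ (k + 1)) (fun r => ℓ (q j * r)) (y j))
    (horth : ∀ i j, i ≠ j → ∀ r : R, F (y i) (r • y j) = 0)
    {q' : J' → R} (hqσ : ∀ j, σ (q j) = q j) (hqσ' : ∀ j, σ (q' j) = q' j)
    (hqp : ∀ j, IsCoprime p (q' j))
    (he : HermitianEquivalent τ (fun j => ev (q j)) (fun j => ev (q' j))) :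
    ∃ y' : J' → V, (∀ j, IsCyclicForm F (p ^ (k + 1)) (fun r => ℓ (q' j * r)) (y' j)) ∧
      (∀ i j, i ≠ j → ∀ r : R, F (y' i) (r • y' j) = 0) ∧
      Submodule.span R (Set.range y') = Submodule.span R (Set.range y) := by
  classical
  obtain ⟨e, he⟩ := he
  set g := p ^ (k + 1) with hg
  have hgσ : g ∣ σ g := pow_dvd_map_pow hpσ _
  set S := R ⧸ Ideal.span {g}
  set π : R →+* S := Ideal.Quotient.mk (Ideal.span {g}) with hπ
  set ρ : S →+* S := quotientInvolution σ hgσ with hρ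
  have hρπ : ∀ r, ρ (π r) = π (σ r) := fun r => rfl
  -- Arbitrary lifts to R of the matrix of e⁻¹. Their Gram matrix H agrees with diag(q') modulo p
  -- only.
  choose G hG using fun (j : J) (a : J') => hev (e.symm (Pi.single a 1) j)
  set H : Matrix J' J' S := Matrix.of fun a b => π (∑ j, q j * σ (G j a) * G j b) with hH
  have hHdvd : ∀ a b, π p ∣ H a b - Matrix.diagonal (fun j => π (q' j)) a b := by
    intro a b
    have h1 := he (e.symm (Pi.single a 1)) (e.symm (Pi.single b 1))
    simp only [LinearEquiv.apply_symm_apply, ← hG, hτ, ← map_mul, ← map_sum] at h1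
    have h3 : ∑ j, ev (q' j) * τ ((Pi.single a 1 : J' → L) j) * (Pi.single b 1 : J' → L) j =
        ev (if a = b then q' a else 0) := by
      rw [Finset.sum_eq_single a]
      · by_cases hab : a = b
        · subst hab; simp
        · simp [hab]
      · intro j _ hj; simp [hj]
      · simp
    rw [h3, eq_comm, ← sub_eq_zero, ← map_sub, hker] at h1
    have h4 : Matrix.diagonal (fun j => π (q' j)) a b = π (if a = b then q' a else 0) := by
      rw [Matrix.diagonal_apply]; split_ifs <;> simp
    rw [h4, hH, Matrix.of_apply, ← map_sub]
    exact map_dvd π h1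
  have h2S : IsUnit (2 : S) := by
    have := (isUnit_iff_ne_zero.mpr h2).map (algebraMap K S)
    rwa [map_ofNat] at this
  obtain ⟨t, ht⟩ := exists_transform_of_isNilpotent ρ h2S (d := fun j => π (q' j))
    (fun j => by rw [hρπ, hqσ'])
    (fun j => by
      obtain ⟨a, b, hab⟩ := (hqp j).pow_left (m := k + 1)
      refine IsUnit.of_mul_eq_one (π b) ?_
      rw [← map_mul, ← map_one π]
      exact mk_eq_mk_iff_dvd.mpr ⟨-a, by linear_combination hab⟩)
    (H := H)
    (by
      ext a b
      rw [Matrix.transpose_apply, Matrix.map_apply, hH, Matrix.of_apply, Matrix.of_apply, hρπ,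
        map_sum]
      congr 1
      refine Finset.sum_congr rfl fun j _ => ?_
      rw [map_mul, map_mul, hσ.apply_apply, hqσ]
      ring)
    (π := π p) (isNilpotent_mk_of_dvd dvd_rfl _) hHdvd
  -- The lift G corrected by t, so that the Gram matrix is exactly diag(q') modulo p^(k+1).
  set X : Matrix J J' S := Matrix.of (fun j a => π (G j a)) * t with hX
  have hXX : (X.map ρ)ᵀ * Matrix.diagonal (fun j => π (q j)) * X =
      Matrix.diagonal fun j => π (q' j) := by
    rw [← ht, hX, Matrix.map_mul, Matrix.transpose_mul]
    have : H = ((Matrix.of fun j a => π (G j a)).map ρ)ᵀ * Matrix.diagonal (fun j => π (q j)) *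
        Matrix.of fun j a => π (G j a) := by
      ext a b
      rw [Matrix.mul_apply]
      simp only [hH, Matrix.mul_diagonal, Matrix.of_apply, Matrix.transpose_apply,
        Matrix.map_apply, hρπ, map_sum, map_mul]
      exact Finset.sum_congr rfl fun j _ => by ring
    rw [this]
    simp only [Matrix.mul_assoc]
  choose Y hY using fun (j : J) (a : J') => Ideal.Quotient.mk_surjective (X j a)
  have hcong : ∀ a b, g ∣ (∑ j, q j * σ (Y j a) * Y j b) - if a = b then q' a else 0 := by
    intro a b
    rw [← mk_eq_mk_iff_dvd]
    have h1 := congrFun (congrFun hXX a) b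
    have h2 : ((X.map ρ)ᵀ * Matrix.diagonal (fun j => π (q j)) * X) a b =
        ∑ j, π (σ (Y j a)) * π (q j) * π (Y j b) := by
      rw [Matrix.mul_apply]
      refine Finset.sum_congr rfl fun j _ => ?_
      rw [Matrix.mul_diagonal, Matrix.transpose_apply, Matrix.map_apply, ← hY, ← hY]
      rfl
    rw [h2, Matrix.diagonal_apply] at h1
    change π _ = π _
    rw [map_sum]
    simp only [map_mul]
    rw [show π (if a = b then q' a else 0) = if a = b then π (q' a) else 0 by
      split_ifs <;> simp, ← h1]
    exact Finset.sum_congr rfl fun j _ => by ring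
  refine ⟨fun a => ∑ j, Y j a • y j, fun a => ⟨?_, fun r => ?_⟩, fun a b hab r => ?_, ?_⟩
  · rw [Finset.smul_sum]
    exact Finset.sum_eq_zero fun j _ => by rw [smul_comm, (hq j).smul_eq_zero, smul_zero]
  · rw [apply_sum_smul hF hq horth]
    apply hℓ.map_eq
    have := hcong a a
    rw [if_pos rfl] at this
    rw [mul_comm (q' a), ← mul_sub]
    exact this.mul_left _
  · rw [apply_sum_smul hF hq horth, ← map_zero ℓ]
    apply hℓ.map_eq
    have := hcong a b
    rw [if_neg hab, sub_zero] at this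
    rw [sub_zero]
    exact this.mul_left _
  · apply le_antisymm
    · rw [Submodule.span_le]
      rintro _ ⟨a, rfl⟩
      exact Submodule.sum_mem _ fun j _ => Submodule.smul_mem _ _
        (Submodule.subset_span ⟨j, rfl⟩)
    -- The relation X*·diag(q)·X = diag(q') provides a left inverse W of X. Since J and J' have the
    -- same size, W is also a right inverse, and the old generators are combinations of the new
    -- ones.
    · have hcard : Fintype.card J = Fintype.card J' := by
        have := e.finrank_eq
        simpa using this
      obtain ⟨f⟩ := Fintype.card_eq.mp hcard
      choose b hb using fun j => (hqp j).pow_left (m := k + 1)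
      choose c hc using hb
      set W : Matrix J' J S := Matrix.diagonal (fun j => π (c j)) * (X.map ρ)ᵀ *
        Matrix.diagonal (fun j => π (q j)) with hW
      have hWX : W * X = 1 := by
        rw [hW, Matrix.mul_assoc, Matrix.mul_assoc, ← Matrix.mul_assoc (X.map ρ)ᵀ, hXX, Matrix.diagonal_mul_diagonal,
          ← Matrix.diagonal_one]
        congr 1
        funext j
        rw [← map_mul, ← map_one π]
        exact mk_eq_mk_iff_dvd.mpr ⟨-(b j), by linear_combination hc j⟩
      have hXW : X * W = 1 := (Matrix.mul_eq_one_comm_of_equiv f).mpr hWX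
      choose Z hZ using fun (a : J') (j : J) => Ideal.Quotient.mk_surjective (W a j)
      rw [Submodule.span_le]
      rintro _ ⟨j, rfl⟩
      have : y j = ∑ a, Z a j • ∑ i, Y i a • y i := by
        simp only [Finset.smul_sum, smul_smul]
        rw [Finset.sum_comm]
        simp only [← Finset.sum_smul]
        have : ∀ i, (∑ a, Z a j * Y i a) • y i = (if i = j then (1 : R) else 0) • y i := by
          intro i
          have h1 := congrFun (congrFun hXW i) j
          rw [Matrix.mul_apply, Matrix.one_apply] at h1
          simp only [← hY, ← hZ, ← map_mul, ← map_sum] at h1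
          have h2 : g ∣ (∑ a, Y i a * Z a j) - if i = j then (1 : R) else 0 := by
            rw [← mk_eq_mk_iff_dvd, h1]
            split_ifs <;> simp
          obtain ⟨d, hd⟩ := h2
          rw [← sub_eq_zero, ← sub_smul, show (∑ a, Z a j * Y i a) = ∑ a, Y i a * Z a j from
            Finset.sum_congr rfl fun a _ => mul_comm _ _, hd, mul_comm, mul_smul,
            (hq i).smul_eq_zero, smul_zero]
        simp [this]
      rw [SetLike.mem_coe, this]
      exact Submodule.sum_mem _ fun a _ => Submodule.smul_mem _ _
        (Submodule.subset_span ⟨a, rfl⟩)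

end Replacement

end IsometricPairs

namespace IsometricPairs

open Polynomial
open scoped LaurentPolynomial

/-! ### Laurent polynomials: evaluation at units, quotients and the involution. -/

section Laurent

variable {K : Type*} [Field K]

theorem coeff_toLaurent_natCast (f : K[X]) (i : ℕ) :
    (toLaurent f).coeff (i : ℤ) = f.coeff i := by
  rw [LaurentPolynomial.coeff_toLaurent]
  exact Finsupp.mapDomain_apply Nat.cast_injective _ _

theorem coeff_toLaurent_of_neg (f : K[X]) {i : ℤ} (hi : i < 0) :
    (toLaurent f).coeff i = 0 := by
  rw [LaurentPolynomial.coeff_toLaurent]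
  refine Finsupp.mapDomain_of_notMem_range _ _ ?_
  rintro ⟨n, rfl⟩
  exact absurd hi (by simp)

theorem coeff_mul_T (q : K[T;T⁻¹]) (m k : ℤ) :
    (q * LaurentPolynomial.T m).coeff k = q.coeff (k - m) := by
  rw [LaurentPolynomial.T, AddMonoidAlgebra.coeff_mul_single_apply, mul_one, sub_eq_add_neg]

/-- Evaluation of Laurent polynomials at a unit of a `K`-algebra. -/
noncomputable def evalUnit {B : Type*} [Ring B] [Algebra K B] (x : Bˣ) : K[T;T⁻¹] →ₐ[K] B :=
  AddMonoidAlgebra.lift K B ℤ ((Units.coeHom B).comp (zpowersHom Bˣ x))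

theorem evalUnit_eq_sum {B : Type*} [Ring B] [Algebra K B] (x : Bˣ) (q : K[T;T⁻¹]) :
    evalUnit x q = q.coeff.sum fun k a => a • ((x ^ k : Bˣ) : B) := by
  rw [evalUnit, AddMonoidAlgebra.lift_apply]
  rfl

@[simp] theorem evalUnit_T {B : Type*} [Ring B] [Algebra K B] (x : Bˣ) (k : ℤ) :
    evalUnit (K := K) x (LaurentPolynomial.T k) = ((x ^ k : Bˣ) : B) := by
  rw [evalUnit, LaurentPolynomial.T, AddMonoidAlgebra.lift_single, one_smul]
  rfl

@[simp] theorem evalUnit_C {B : Type*} [Ring B] [Algebra K B] (x : Bˣ) (a : K) :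
    evalUnit (K := K) x (LaurentPolynomial.C a) = algebraMap K B a := by
  rw [LaurentPolynomial.C_eq_algebraMap, AlgHom.commutes]

@[simp] theorem evalUnit_toLaurent {B : Type*} [Ring B] [Algebra K B] (x : Bˣ) (f : K[X]) :
    evalUnit x (toLaurent f) = aeval (x : B) f := by
  have : (evalUnit x).comp toLaurentAlg = aeval (R := K) (x : B) := by
    ext
    simp
  exact DFunLike.congr_fun this f

/-- The root as a unit of `K[x] / (f)`, if `f(0) ≠ 0`. -/
noncomputable def rootUnit {f : K[X]} (hf : f.coeff 0 ≠ 0) : (AdjoinRoot f)ˣ :=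
  -- From f = X·divX(f) + f(0), the inverse of the root is -divX(f)/f(0).
  have h : AdjoinRoot.root f * AdjoinRoot.mk f (C (-(f.coeff 0)⁻¹) * f.divX) = 1 := by
    rw [← AdjoinRoot.mk_X, ← map_mul, ← map_one (AdjoinRoot.mk f), AdjoinRoot.mk_eq_mk]
    refine ⟨C (-(f.coeff 0)⁻¹), ?_⟩
    have h1 : C (f.coeff 0) * C (f.coeff 0)⁻¹ = 1 := by
      rw [← C_mul, mul_inv_cancel₀ hf, C_1]
    rw [C_neg]
    linear_combination (-C (f.coeff 0)⁻¹) * (X_mul_divX_add f) + h1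
  ⟨AdjoinRoot.root f, _, h, (mul_comm _ _).trans h⟩

@[simp] theorem coe_rootUnit {f : K[X]} (hf : f.coeff 0 ≠ 0) :
    (rootUnit hf : AdjoinRoot f) = AdjoinRoot.root f := rfl

theorem evalUnit_rootUnit_toLaurent {f : K[X]} (hf : f.coeff 0 ≠ 0) (g : K[X]) :
    evalUnit (rootUnit hf) (toLaurent g) = AdjoinRoot.mk f g := by
  rw [evalUnit_toLaurent, coe_rootUnit, AdjoinRoot.aeval_eq]

theorem evalUnit_rootUnit_surjective {f : K[X]} (hf : f.coeff 0 ≠ 0) :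
    Function.Surjective (evalUnit (K := K) (rootUnit hf)) := fun z => by
  obtain ⟨g, rfl⟩ := AdjoinRoot.mk_surjective z
  exact ⟨toLaurent g, evalUnit_rootUnit_toLaurent hf g⟩

/-- A power of T turns q into a polynomial, and T is a unit. So K[T;T⁻¹]/(f) is the same ring as
K[x]/(f) when f(0) ≠ 0. -/
theorem evalUnit_rootUnit_eq_zero_iff {f : K[X]} (hf : f.coeff 0 ≠ 0) (q : K[T;T⁻¹]) :
    evalUnit (rootUnit hf) q = 0 ↔ toLaurent f ∣ q := by
  constructor
  · intro h
    obtain ⟨n, g, hg⟩ := LaurentPolynomial.exists_T_pow q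
    have h1 : AdjoinRoot.mk f g = 0 := by
      rw [← evalUnit_rootUnit_toLaurent hf, hg, map_mul, h, zero_mul]
    rw [AdjoinRoot.mk_eq_zero] at h1
    have h2 : toLaurent f ∣ q * LaurentPolynomial.T n := hg ▸ map_dvd toLaurent h1
    exact (LaurentPolynomial.isUnit_T _).dvd_mul_right.mp h2
  · rintro ⟨g, rfl⟩
    rw [map_mul, evalUnit_rootUnit_toLaurent, AdjoinRoot.mk_self, zero_mul]

theorem toLaurent_dvd_toLaurent_iff {f g : K[X]} (hf : f.coeff 0 ≠ 0) :
    toLaurent f ∣ toLaurent g ↔ f ∣ g := by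
  rw [← evalUnit_rootUnit_eq_zero_iff hf, evalUnit_rootUnit_toLaurent, AdjoinRoot.mk_eq_zero]

theorem eq_of_associated_toLaurent {f g : K[X]} (hf : f.coeff 0 ≠ 0) (hg : g.coeff 0 ≠ 0)
    (hf' : f.Monic) (hg' : g.Monic) (h : Associated (toLaurent f) (toLaurent g)) : f = g :=
  eq_of_monic_of_associated hf' hg' (associated_of_dvd_dvd
    ((toLaurent_dvd_toLaurent_iff hf).mp h.dvd) ((toLaurent_dvd_toLaurent_iff hg).mp h.symm.dvd))

theorem ker_evalUnit_rootUnit {f : K[X]} (hf : f.coeff 0 ≠ 0) :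
    RingHom.ker (evalUnit (K := K) (rootUnit hf)) = Ideal.span {toLaurent f} := by
  ext q
  rw [RingHom.mem_ker, Ideal.mem_span_singleton, evalUnit_rootUnit_eq_zero_iff]

theorem isMaximal_span_toLaurent {p : K[X]} (hp : Irreducible p) (hp0 : p.coeff 0 ≠ 0) :
    (Ideal.span {toLaurent p}).IsMaximal := by
  have : Fact (Irreducible p) := ⟨hp⟩
  rw [← ker_evalUnit_rootUnit hp0]
  exact RingHom.ker_isMaximal_of_surjective _ (evalUnit_rootUnit_surjective hp0)

theorem finiteDimensional_quotient_toLaurent {f : K[X]} (hf : f.coeff 0 ≠ 0) :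
    FiniteDimensional K (K[T;T⁻¹] ⧸ Ideal.span {toLaurent f}) := by
  have hf0 : f ≠ 0 := by rintro rfl; simp at hf
  have : FiniteDimensional K (AdjoinRoot f) := (AdjoinRoot.powerBasis hf0).finite
  rw [← ker_evalUnit_rootUnit hf]
  exact FiniteDimensional.of_injective
    (Ideal.quotientKerAlgEquivOfSurjective (evalUnit_rootUnit_surjective hf)).toLinearMap
    (Ideal.quotientKerAlgEquivOfSurjective (evalUnit_rootUnit_surjective hf)).injective

variable [StarRing K]

/-- The involution `∑ aₖ Tᵏ ↦ ∑ āₖ T⁻ᵏ` of the ring of Laurent polynomials. -/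
noncomputable def laurentStar : K[T;T⁻¹] →+* K[T;T⁻¹] :=
  ((LaurentPolynomial.invert (R := K)) : K[T;T⁻¹] →+* K[T;T⁻¹]).comp
    (AddMonoidAlgebra.mapRingHom ℤ (starRingEnd K))

theorem laurentStar_coeff (q : K[T;T⁻¹]) (k : ℤ) :
    (laurentStar q).coeff k = star (q.coeff (-k)) := by
  change (LaurentPolynomial.invert (AddMonoidAlgebra.mapRingHom ℤ (starRingEnd K) q)).coeff k = _
  rw [LaurentPolynomial.invert_apply, AddMonoidAlgebra.coeff_mapRingHom]
  rfl

@[simp] theorem laurentStar_C (a : K) :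
    laurentStar (LaurentPolynomial.C a) = LaurentPolynomial.C (star a) := by
  ext k
  rw [laurentStar_coeff, LaurentPolynomial.C_apply, LaurentPolynomial.C_apply]
  by_cases hk : k = 0 <;> simp [hk]

@[simp] theorem laurentStar_T (m : ℤ) :
    laurentStar (LaurentPolynomial.T m : K[T;T⁻¹]) = LaurentPolynomial.T (-m) := by
  ext k
  rw [laurentStar_coeff, LaurentPolynomial.T_apply, LaurentPolynomial.T_apply]
  by_cases hk : m = -k
  · rw [if_pos hk, if_pos (by omega), star_one]
  · rw [if_neg hk, if_neg (by omega), star_zero]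

variable (K) in
theorem isInvolution_laurentStar : IsInvolution K (laurentStar (K := K)) where
  apply_apply q := by
    ext k
    rw [laurentStar_coeff, laurentStar_coeff, neg_neg, star_star]
  map_algebraMap a := by
    rw [← LaurentPolynomial.C_eq_algebraMap, ← LaurentPolynomial.C_eq_algebraMap, laurentStar_C]

theorem laurentStar_toLaurent (f : K[X]) : laurentStar (toLaurent f) =
    toLaurent (f.map (starRingEnd K)).reverse * LaurentPolynomial.T (-(f.natDegree : ℤ)) := by
  have h : LaurentPolynomial.invert (toLaurent (f.map (starRingEnd K))) =
      laurentStar (toLaurent f) := by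
    ext k
    rw [LaurentPolynomial.invert_apply, laurentStar_coeff]
    rcases lt_or_ge (-k) 0 with hk | hk
    · rw [coeff_toLaurent_of_neg _ hk, coeff_toLaurent_of_neg _ hk, star_zero]
    · obtain ⟨n, hn⟩ := Int.eq_ofNat_of_zero_le hk
      rw [hn, coeff_toLaurent_natCast, coeff_toLaurent_natCast, coeff_map]
      rfl
  rw [LaurentPolynomial.toLaurent_reverse, h, natDegree_map, LaurentPolynomial.mul_T_assoc]
  simp

/-- The passage to χ^∨ is the involution of the Laurent polynomials up to a unit. In particular p =
p^∨ makes p and σ(p) generate the same ideal. -/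
theorem associated_laurentStar {f : K[X]} (hf : f.coeff 0 ≠ 0) :
    Associated (laurentStar (toLaurent f)) (toLaurent (vee f)) := by
  have h1 : IsUnit (LaurentPolynomial.C (star (f.coeff 0))⁻¹) :=
    (isUnit_iff_ne_zero.mpr (inv_ne_zero (star_ne_zero.mpr hf))).map _
  rw [laurentStar_toLaurent, vee, map_mul, toLaurent_C]
  exact (associated_mul_unit_left _ _ (LaurentPolynomial.isUnit_T _)).trans
    (associated_unit_mul_right _ _ h1)

theorem reverse_eq_of_eq_vee {p : K[X]} (h : p = vee p) (h0 : p.coeff 0 ≠ 0) :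
    (p.map (starRingEnd K)).reverse = C (star (p.coeff 0)) * p := by
  symm
  calc C (star (p.coeff 0)) * p = C (star (p.coeff 0)) *
        (C (star (p.coeff 0))⁻¹ * (p.map (starRingEnd K)).reverse) := congrArg _ h
    _ = _ := by rw [← mul_assoc, ← C_mul, mul_inv_cancel₀ (star_ne_zero.mpr h0), C_1, one_mul]

end Laurent

end IsometricPairs

namespace IsometricPairs

open Polynomial
open scoped LaurentPolynomial

/-! ### Stationary polynomials as representatives of the symmetric elements of the residue field. -/

section Residue

variable {K : Type*} [Field K] [StarRing K]

theorem coeff_zero_ne_zero_of_eq_vee {p : K[X]} (hp : p ≠ 0) (h : p = vee p) :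
    p.coeff 0 ≠ 0 := by
  intro h0
  apply hp
  rw [h, vee, h0]
  simp

theorem coeff_zero_mul_star {p : K[X]} (hp : p.Monic) (h : p = vee p) :
    p.coeff 0 * star (p.coeff 0) = 1 := by
  have h0 := coeff_zero_ne_zero_of_eq_vee hp.ne_zero h
  have h1 := congrArg (fun f => f.coeff 0) (reverse_eq_of_eq_vee h h0)
  simp only [coeff_zero_reverse, coeff_C_mul] at h1
  rw [mul_comm, ← h1, leadingCoeff_map, hp, map_one]

theorem laurentEval_eq_evalUnit_field {L : Type*} [Field L] [Algebra K L] (x : Lˣ) (q : K[T;T⁻¹]) :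
    laurentEval q (x : L) = evalUnit x q := by
  rw [laurentEval, evalUnit_eq_sum]
  simp only [Units.val_zpow_eq_zpow_val]

theorem laurentEval_eq_evalUnit_matrix {n : Type*} [Fintype n] [DecidableEq n]
    (x : (Matrix n n K)ˣ) (q : K[T;T⁻¹]) :
    laurentEval q (x : Matrix n n K) = evalUnit x q := by
  rw [laurentEval, evalUnit_eq_sum]
  simp only [Matrix.coe_units_zpow]

/-- Both sides are ring homomorphisms in q, so constants and powers of T suffice. The involution of
the residue field is thus induced by `laurentStar`. -/
theorem circ_evalUnit {p : K[X]} [Fact (Irreducible p)] (h : p = vee p) (h0 : p.coeff 0 ≠ 0)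
    (q : K[T;T⁻¹]) :
    circ p h (evalUnit (rootUnit h0) q) = evalUnit (rootUnit h0) (laurentStar q) := by
  have hroot : circ p h (AdjoinRoot.root p) = (AdjoinRoot.root p)⁻¹ := AdjoinRoot.lift_root _
  have hof : ∀ a, circ p h (algebraMap K _ a) = algebraMap K _ (star a) := fun a =>
    AdjoinRoot.lift_of _
  induction q using LaurentPolynomial.induction_on' with
  | add q r hq hr => rw [map_add, map_add, hq, hr, map_add, map_add]
  | C_mul_T n a =>
    rw [map_mul, map_mul, map_mul laurentStar, map_mul, evalUnit_C, evalUnit_T, hof,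
      laurentStar_C, laurentStar_T, evalUnit_C, evalUnit_T, Units.val_zpow_eq_zpow_val,
      Units.val_zpow_eq_zpow_val, map_zpow₀, coe_rootUnit, hroot, inv_zpow, zpow_neg]

theorem IsStationaryForm.laurentStar_eq {p : K[X]} {q : K[T;T⁻¹]} (h : IsStationaryForm p q) :
    laurentStar q = q := by
  ext k
  rw [laurentStar_coeff, h.1, star_star]

/-- If q vanished at the root, p would divide the polynomial Tʳq of degree at most 2r. This forces
deg p = 2r and Tʳq = a_r·p. The constant coefficients then give ā_r = a_r·p(0), which each of the
three normalizations of a_r excludes for a_r ≠ 0. -/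
theorem IsStationaryForm.evalUnit_ne_zero (h2 : (2 : K) ≠ 0) {p : K[X]} (hp : p.Monic)
    (h0 : p.coeff 0 ≠ 0) {q : K[T;T⁻¹]} (h : IsStationaryForm p q) (hq : q ≠ 0) :
    evalUnit (rootUnit h0) q ≠ 0 := by
  intro hev
  rw [evalUnit_rootUnit_eq_zero_iff] at hev
  set r := p.natDegree / 2 with hr
  obtain ⟨hsym, hbd, heven⟩ := h
  rw [← hr] at hbd heven
  have hbd' : ∀ k : ℤ, k < -r → q.coeff k = 0 := fun k hk => by
    rw [← neg_neg k, hsym, hbd _ (by omega), star_zero]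
  set f : K[X] := ∑ i ∈ Finset.range (2 * r + 1), monomial i (q.coeff ((i : ℤ) - r)) with hf
  have hfc : ∀ i : ℕ, f.coeff i = q.coeff ((i : ℤ) - r) := fun i => by
    rw [hf, finsetSum_coeff]
    simp only [coeff_monomial]
    rw [Finset.sum_ite_eq']
    split_ifs with hi
    · rfl
    · rw [hbd]
      simp only [Finset.mem_range] at hi
      omega
  have hfq : toLaurent f = q * LaurentPolynomial.T r := by
    ext k
    rw [coeff_mul_T]
    rcases lt_or_ge k 0 with hk | hk
    · rw [coeff_toLaurent_of_neg _ hk, hbd' _ (by omega)]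
    · obtain ⟨n, rfl⟩ := Int.eq_ofNat_of_zero_le hk
      rw [coeff_toLaurent_natCast, hfc]
  have hf0 : f ≠ 0 := by
    intro hf0
    rw [hf0, map_zero] at hfq
    exact hq ((LaurentPolynomial.isUnit_T (R := K) r).mul_left_eq_zero.mp hfq.symm)
  have hpf : p ∣ f := by
    rw [← toLaurent_dvd_toLaurent_iff h0, hfq]
    exact hev.mul_right _
  have hdeg : f.natDegree ≤ 2 * r := natDegree_le_iff_coeff_eq_zero.mpr fun i hi => by
    rw [hfc, hbd _ (by omega)]
  have hdeg' := natDegree_le_of_dvd hpf hf0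
  have hpr : p.natDegree = 2 * r := by omega
  have hfp : f = C f.leadingCoeff * p :=
    eq_leadingCoeff_mul_of_monic_of_dvd_of_natDegree_le hp hpf (hpr ▸ hdeg)
  have hfd : f.natDegree = 2 * r := by omega
  have ha : f.leadingCoeff = q.coeff r := by
    rw [leadingCoeff, hfd, hfc]
    congr 1
    push_cast
    ring
  have hstar : star (q.coeff r) = q.coeff r * p.coeff 0 := by
    have := congrArg (fun f => f.coeff 0) hfp
    simp only [coeff_C_mul] at this
    rw [hfc, ha, Nat.cast_zero, zero_sub, hsym] at this
    exact this
  have hne : q.coeff r ≠ 0 := by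
    rw [← ha]
    exact leadingCoeff_ne_zero.mpr hf0
  obtain ⟨hid, hne1, heq1⟩ := heven ⟨r, by omega⟩
  rw [← coeff_zero_eq_eval_zero] at hne1 heq1
  by_cases hK : ∃ a : K, star a ≠ a
  · by_cases h1 : p.coeff 0 = 1
    · have h3 := heq1 hK h1
      rw [h1, mul_one] at hstar
      rw [hstar] at h3
      apply hne
      have : 2 * q.coeff r = 0 := by linear_combination h3
      exact (mul_eq_zero.mp this).resolve_left h2
    · have h3 := hne1 hK h1
      rw [← h3] at hstar
      exact h1 (mul_left_cancel₀ hne (by rw [mul_one, ← hstar]))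
  · push Not at hK
    exact hne (hid hK)

/-- For deg p = 2r the Laurent polynomial c·p·T⁻ʳ vanishes in the residue field, and the condition
on c makes it fixed by the involution. Subtracting t times it, with t̄ = t, changes the highest
coefficient a to a - tc and keeps both the residue and the symmetry. -/
theorem exists_stationary_correction (h2 : (2 : K) ≠ 0) {p : K[X]} (hp : p.Monic)
    (hirr : Irreducible p) (h : p = vee p) (he : Even p.natDegree) (a : K) :
    ∃ c t : K, star c * star (p.coeff 0) = c ∧ star t = t ∧
      ((∀ a : K, star a = a) → a - t * c = 0) ∧
      ((∃ a : K, star a ≠ a) → p.eval 0 ≠ 1 → a - t * c = star (a - t * c)) ∧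
      ((∃ a : K, star a ≠ a) → p.eval 0 = 1 → a - t * c = -star (a - t * c)) := by
  have h1 := coeff_zero_mul_star hp h
  have h0 := coeff_zero_ne_zero_of_eq_vee hp.ne_zero h
  rw [← coeff_zero_eq_eval_zero]
  set b := p.coeff 0 with hb
  have hs2 : star (2 : K) = 2 := star_ofNat 2
  by_cases hK : ∃ a : K, star a ≠ a
  · have hid : ¬ ∀ a : K, star a = a := by push Not; exact hK
    -- For p(0) = 1 one takes c = 1 and removes the symmetric part of a.
    by_cases hb1 : b = 1
    · refine ⟨1, (a + star a) / 2, by simp [hb1], ?_, fun h => absurd h hid,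
        fun _ h => absurd hb1 h, fun _ _ => ?_⟩
      · rw [star_div₀, star_add, star_star, hs2, add_comm]
      · rw [mul_one, star_sub, star_div₀, star_add, star_star, hs2]
        field_simp
        ring
    -- Hilbert 90 for p(0), which has norm 1: c = 1 + b̄ works unless b = -1, where any nonzero d -
    -- d̄ does.
    · obtain ⟨c, hc0, hc⟩ : ∃ c : K, c ≠ 0 ∧ star c * star b = c := by
        by_cases hb2 : b = -1
        · obtain ⟨d, hd⟩ := hK
          refine ⟨d - star d, sub_ne_zero.mpr (Ne.symm hd), ?_⟩
          rw [hb2, star_sub, star_star, star_neg, star_one]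
          ring
        · refine ⟨1 + star b, fun h => hb2 ?_, ?_⟩
          · have := congrArg star h
            rw [star_add, star_one, star_star, star_zero] at this
            linear_combination this
          · rw [star_add, star_one, star_star]
            linear_combination h1
      -- If c were symmetric, then b would be 1. So t = (a - ā)/(c - c̄) is defined and symmetric,
      -- and it makes a - tc symmetric.
      have hcc : c - star c ≠ 0 := fun h => hb1 (by
        rw [sub_eq_zero] at h
        rw [← h] at hc
        have := mul_left_cancel₀ hc0 (hc.trans (mul_one c).symm)
        rw [← star_star b, this, star_one])
      refine ⟨c, (a - star a) / (c - star c), hc, ?_, fun h => absurd h hid,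
        fun _ _ => ?_, fun _ h => absurd h hb1⟩
      · rw [star_div₀, star_sub, star_sub, star_star, star_star, ← neg_sub c, ← neg_sub a, neg_div_neg_eq]
      · have hcc' : star c - c ≠ 0 := fun h => hcc (by linear_combination -h)
        rw [star_sub, star_mul, star_div₀, star_sub, star_sub, star_star, star_star]
        field_simp
        ring
  · push Not at hK
    -- Here b² = 1. If b = -1, the reverse of p is -p, so p(1) = 0 and p is linear, against the even
    -- degree.
    have hb1 : b = 1 := by
      rw [hK] at h1
      rcases mul_self_eq_one_iff.mp h1 with h | hbn
      · exact h
      · exfalso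
        have hrev := reverse_eq_of_eq_vee h h0
        have hmap : p.map (starRingEnd K) = p := by
          ext i
          rw [coeff_map]
          exact hK _
        rw [hmap, hK, ← hb, hbn] at hrev
        let _ : Invertible (1 : K) := invertibleOne
        have h3 := eval₂_reverse_mul_pow (RingHom.id K) (1 : K) p
        simp only [invOf_one, one_pow, mul_one] at h3
        rw [hrev] at h3
        simp only [eval₂_id, eval_mul, eval_C] at h3
        have h4 : p.eval 1 = 0 := by
          have : 2 * p.eval 1 = 0 := by linear_combination -h3
          exact (mul_eq_zero.mp this).resolve_left h2
        have h5 := degree_eq_one_of_irreducible_of_root hirr h4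
        rw [natDegree_eq_of_degree_eq_some h5] at he
        exact absurd he (by decide)
    refine ⟨1, a, by simp [hb1], hK a, fun _ => by ring, fun ⟨d, hd⟩ => absurd (hK d) hd,
      fun ⟨d, hd⟩ => absurd (hK d) hd⟩

/-- Take a representative with exponents between -r and r, average it with its image under the
involution, and for even degree adjust the coefficient at r by `exists_stationary_correction`. -/
theorem exists_isStationaryForm (h2 : (2 : K) ≠ 0) {p : K[X]} [Fact (Irreducible p)] (hp : p.Monic)
    (h : p = vee p) (h0 : p.coeff 0 ≠ 0) {z : AdjoinRoot p} (hz : circ p h z = z) :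
    ∃ q, IsStationaryForm p q ∧ evalUnit (rootUnit h0) q = z := by
  set r := p.natDegree / 2 with hr
  have hirr : Irreducible p := Fact.out
  set ev := evalUnit (K := K) (rootUnit h0) with hev
  -- The factor Tʳ centres the exponents: the remainder of f modulo p has degree at most 2r, so
  -- dividing it by Tʳ leaves the range from -r to r.
  obtain ⟨f, hf⟩ := AdjoinRoot.mk_surjective (z * ev (LaurentPolynomial.T r))
  have hfm : AdjoinRoot.mk p (f %ₘ p) = z * ev (LaurentPolynomial.T r) := by
    rw [← hf, AdjoinRoot.mk_eq_mk]
    exact ⟨-(f /ₘ p), by linear_combination modByMonic_add_div f p⟩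
  have hfd : (f %ₘ p).natDegree < p.natDegree :=
    natDegree_modByMonic_lt f hp hirr.ne_one
  set q₀ := toLaurent (f %ₘ p) * LaurentPolynomial.T (-(r : ℤ)) with hq₀
  have hev0 : ev q₀ = z := by
    rw [hq₀, map_mul, evalUnit_rootUnit_toLaurent, hfm, mul_assoc, ← map_mul,
      ← LaurentPolynomial.T_add, add_neg_cancel, LaurentPolynomial.T_zero, map_one, mul_one]
  have hq₀c : ∀ k : ℤ, (k < -r ∨ r < k) → q₀.coeff k = 0 := fun k hk => by
    rw [hq₀, coeff_mul_T]
    rcases hk with hk | hk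
    · rw [coeff_toLaurent_of_neg _ (by omega)]
    · obtain ⟨n, hn⟩ := Int.eq_ofNat_of_zero_le (a := k - -r) (by omega)
      rw [hn, coeff_toLaurent_natCast, coeff_eq_zero_of_natDegree_lt (by omega)]
  set q₁ := (2⁻¹ : K) • (q₀ + laurentStar q₀) with hq₁
  have hs2 : star (2⁻¹ : K) = 2⁻¹ := by rw [star_inv₀, star_ofNat]
  have hev1 : ev q₁ = z := by
    rw [hq₁, map_smul, map_add, ← circ_evalUnit h h0, ← hev, hev0, hz, ← two_smul K, smul_smul,
      inv_mul_cancel₀ h2, one_smul]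
  have hq₁c : ∀ k, q₁.coeff k = 2⁻¹ * (q₀.coeff k + star (q₀.coeff (-k))) := fun k => by
    rw [hq₁, AddMonoidAlgebra.coeff_smul_apply, AddMonoidAlgebra.coeff_add, Finsupp.add_apply,
      laurentStar_coeff, smul_eq_mul]
  have hq₁s : ∀ k, q₁.coeff (-k) = star (q₁.coeff k) := fun k => by
    rw [hq₁c, hq₁c, star_mul, star_add, star_star, neg_neg, hs2]
    ring
  have hq₁b : ∀ k : ℤ, r < k → q₁.coeff k = 0 := fun k hk => by
    rw [hq₁c, hq₀c k (Or.inr hk), hq₀c (-k) (Or.inl (by omega)), star_zero, add_zero, mul_zero]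
  clear_value q₁
  by_cases he : Even p.natDegree
  · obtain ⟨c, t, hc, ht, hcond⟩ :=
      exists_stationary_correction h2 hp hirr h he (q₁.coeff r)
    have hpr : p.natDegree = r + r := by
      obtain ⟨m, hm⟩ := he
      omega
    set β := toLaurent (C c * p) * LaurentPolynomial.T (-(r : ℤ)) with hβ
    have hβσ : laurentStar β = β := by
      rw [hβ, map_mul, map_mul toLaurent, map_mul, toLaurent_C, laurentStar_C,
        laurentStar_toLaurent, reverse_eq_of_eq_vee h h0, laurentStar_T, map_mul, toLaurent_C,
        neg_neg, ← mul_assoc, ← mul_assoc, ← map_mul, hc, mul_assoc, ← LaurentPolynomial.T_add]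
      congr 2
      rw [hpr]
      push_cast
      ring
    have hβev : ev β = 0 := by
      rw [hβ, map_mul, evalUnit_rootUnit_toLaurent, map_mul, AdjoinRoot.mk_self, mul_zero, zero_mul]
    have hβr : β.coeff r = c := by
      rw [hβ, coeff_mul_T, show ((r : ℤ) - -r) = (p.natDegree : ℕ) by rw [hpr]; push_cast; ring,
        coeff_toLaurent_natCast, coeff_C_mul, coeff_natDegree, hp, mul_one]
    have hβb : ∀ k : ℤ, r < k → β.coeff k = 0 := fun k hk => by
      obtain ⟨n, hn⟩ := Int.eq_ofNat_of_zero_le (a := k - -r) (by omega)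
      rw [hβ, coeff_mul_T, hn, coeff_toLaurent_natCast, coeff_C_mul,
        coeff_eq_zero_of_natDegree_lt (by omega), mul_zero]
    have hβs : ∀ k, β.coeff (-k) = star (β.coeff k) := fun k => by
      conv_lhs => rw [← hβσ]
      rw [laurentStar_coeff, neg_neg]
    have hco : ∀ k, (q₁ - t • β).coeff k = q₁.coeff k - t * β.coeff k := fun k => by
      rw [AddMonoidAlgebra.coeff_sub, Finsupp.sub_apply, AddMonoidAlgebra.coeff_smul_apply,
        smul_eq_mul]
    refine ⟨q₁ - t • β, ⟨fun k => ?_, fun k hk => ?_, fun _ => ?_⟩, ?_⟩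
    · rw [hco, hco, hq₁s, hβs, star_sub, star_mul, ht, mul_comm t]
    · rw [hco, hq₁b k hk, hβb k hk, mul_zero, sub_zero]
    · rw [← hr, hco, hβr]
      exact hcond
    · rw [map_sub, map_smul, hβev, smul_zero, sub_zero, hev1]
  · exact ⟨q₁, ⟨hq₁s, hq₁b, fun h => absurd h he⟩, hev1⟩

end Residue

end IsometricPairs

namespace IsometricPairs

open Polynomial
open scoped LaurentPolynomial

/-! ### Frobenius blocks and coordinates modulo the characteristic polynomial. -/

namespace FrobeniusBlock

variable {K : Type*} [Field K] (Φ : FrobeniusBlock K)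

theorem chi_monic : Φ.chi.Monic := Φ.monic.pow Φ.s

theorem size_pos : 0 < Φ.size := by
  rw [size, chi, natDegree_pow]
  exact Nat.mul_pos Φ.s_pos Φ.irreducible.natDegree_pos

theorem coeff_zero_chi : Φ.chi.coeff 0 = Φ.p.coeff 0 ^ Φ.s := by
  rw [coeff_zero_eq_eval_zero, chi, eval_pow, coeff_zero_eq_eval_zero]

theorem coeff_zero_chi_ne_zero_iff : Φ.chi.coeff 0 ≠ 0 ↔ Φ.p.coeff 0 ≠ 0 := by
  rw [coeff_zero_chi, pow_ne_zero_iff Φ.s_pos.ne']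

theorem isUnit_mat_iff : IsUnit Φ.mat ↔ Φ.chi.coeff 0 ≠ 0 := by
  rw [Matrix.isUnit_iff_isUnit_det, isUnit_iff_ne_zero, Matrix.det_eq_sign_charpoly_coeff,
    charpoly_mat]
  simp

/-- Blocks with the same characteristic polynomial coincide. -/
theorem eq_of_chi_eq {Φ Ψ : FrobeniusBlock K} (h : Φ.chi = Ψ.chi) : Φ = Ψ := by
  have hp : Φ.p = Ψ.p := by
    have h1 : Φ.p ∣ Ψ.p := Φ.irreducible.prime.dvd_of_dvd_pow
      ((dvd_pow_self Φ.p Φ.s_pos.ne').trans (dvd_of_eq h : Φ.chi ∣ Ψ.chi))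
    exact eq_of_monic_of_associated Φ.monic Ψ.monic
      (Φ.irreducible.associated_of_dvd Ψ.irreducible h1)
  have hs : Φ.s = Ψ.s := by
    have := congrArg natDegree h
    rw [chi, chi, natDegree_pow, natDegree_pow, hp] at this
    exact Nat.eq_of_mul_eq_mul_right Ψ.irreducible.natDegree_pos this
  cases Φ; cases Ψ
  simp only at hp hs
  subst hp hs
  rfl

/-- The reduction of a Laurent polynomial modulo the characteristic polynomial. -/
noncomputable def reduce {Φ : FrobeniusBlock K} (h0 : Φ.chi.coeff 0 ≠ 0) : K[T;T⁻¹] →ₗ[K] K[X] :=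
  AdjoinRoot.modByMonicHom Φ.chi_monic ∘ₗ (evalUnit (rootUnit h0)).toLinearMap

variable {Φ} (h0 : Φ.chi.coeff 0 ≠ 0)

theorem mk_reduce (r : K[T;T⁻¹]) :
    AdjoinRoot.mk Φ.chi (reduce h0 r) = evalUnit (rootUnit h0) r :=
  AdjoinRoot.mk_leftInverse Φ.chi_monic _

theorem dvd_sub_reduce (r : K[T;T⁻¹]) : toLaurent Φ.chi ∣ r - toLaurent (reduce h0 r) := by
  rw [← evalUnit_rootUnit_eq_zero_iff h0, map_sub, evalUnit_rootUnit_toLaurent, mk_reduce, sub_self]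

theorem reduce_eq_zero_iff {r : K[T;T⁻¹]} : reduce h0 r = 0 ↔ toLaurent Φ.chi ∣ r := by
  constructor
  · intro h
    simpa [h] using dvd_sub_reduce h0 r
  · intro h
    rw [← evalUnit_rootUnit_eq_zero_iff h0] at h
    rw [reduce, LinearMap.comp_apply, AlgHom.toLinearMap_apply, h, map_zero]

theorem reduce_toLaurent {f : K[X]} (hf : f.degree < Φ.chi.degree) :
    reduce h0 (toLaurent f) = f := by
  rw [reduce, LinearMap.comp_apply, AlgHom.toLinearMap_apply, evalUnit_rootUnit_toLaurent,
    AdjoinRoot.modByMonicHom_mk, (modByMonic_eq_self_iff Φ.chi_monic).mpr hf]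

theorem degree_reduce_lt (r : K[T;T⁻¹]) : (reduce h0 r).degree < Φ.chi.degree := by
  obtain ⟨f, hf⟩ := AdjoinRoot.mk_surjective (evalUnit (K := K) (rootUnit h0) r)
  rw [reduce, LinearMap.comp_apply, AlgHom.toLinearMap_apply, ← hf, AdjoinRoot.modByMonicHom_mk]
  exact degree_modByMonic_lt _ Φ.chi_monic

theorem degree_chi : Φ.chi.degree = Φ.size := degree_eq_natDegree Φ.chi_monic.ne_zero

/-- The coordinates of a Laurent polynomial modulo the characteristic polynomial. -/
noncomputable def coordinate (i : ℕ) : K[T;T⁻¹] →ₗ[K] K := lcoeff K i ∘ₗ reduce h0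

theorem coordinate_apply (i : ℕ) (r : K[T;T⁻¹]) :
    coordinate h0 i r = (reduce h0 r).coeff i := rfl

theorem coordinate_T (i : ℕ) {j : ℕ} (hj : j < Φ.size) :
    coordinate h0 i (LaurentPolynomial.T j) = if j = i then 1 else 0 := by
  rw [coordinate_apply, ← toLaurent_X_pow, reduce_toLaurent, coeff_X_pow]
  · simp only [eq_comm]
  · rw [degree_X_pow, degree_chi]
    exact_mod_cast hj

theorem coordinate_mul_eq_zero (i : ℕ) (r : K[T;T⁻¹]) :
    coordinate h0 i (toLaurent Φ.chi * r) = 0 := by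
  rw [coordinate_apply, (reduce_eq_zero_iff h0).mpr (dvd_mul_right _ _), coeff_zero]

theorem dvd_of_coordinate_eq_zero {r : K[T;T⁻¹]} (h : ∀ i < Φ.size, coordinate h0 i r = 0) :
    toLaurent Φ.chi ∣ r := by
  rw [← reduce_eq_zero_iff h0]
  ext i
  rw [coeff_zero]
  by_cases hi : i < Φ.size
  · exact h i hi
  · apply coeff_eq_zero_of_degree_lt
    refine (degree_reduce_lt h0 r).trans_le ?_
    rw [degree_chi]
    exact_mod_cast not_lt.mp hi

theorem toLaurent_eq_sum {f : K[X]} {n : ℕ} (hf : f.degree < n) :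
    toLaurent f = ∑ i : Fin n, f.coeff i • (LaurentPolynomial.T (i : ℕ) : K[T;T⁻¹]) := by
  rcases eq_or_ne f 0 with rfl | hf0
  · simp
  · conv_lhs => rw [as_sum_range_C_mul_X_pow' f ((natDegree_lt_iff_degree_lt hf0).mpr hf)]
    rw [map_sum, Finset.sum_range]
    refine Finset.sum_congr rfl fun i _ => ?_
    rw [toLaurent_C_mul_X_pow, LaurentPolynomial.smul_eq_C_mul]

theorem dvd_sub_sum_coordinate (r : K[T;T⁻¹]) : toLaurent Φ.chi ∣
    r - ∑ i : Fin Φ.size, coordinate h0 i r • (LaurentPolynomial.T (i : ℕ) : K[T;T⁻¹]) := by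
  have := dvd_sub_reduce h0 r
  rwa [toLaurent_eq_sum (f := reduce h0 r) (n := Φ.size)
    (degree_chi (Φ := Φ) ▸ degree_reduce_lt h0 r)] at this

/-- The coefficient at the highest power is a generating functional. -/
theorem isFrobenius_coordinate :
    IsFrobenius (toLaurent Φ.chi) (coordinate h0 (Φ.size - 1)) where
  map_mul_eq_zero := coordinate_mul_eq_zero h0 _
  dvd r hr := by
    by_contra hd
    have hf : reduce h0 r ≠ 0 := fun h => hd ((reduce_eq_zero_iff h0).mp h)
    set f := reduce h0 r with hf_def
    have hlt : f.natDegree < Φ.size := by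
      have := degree_reduce_lt h0 r
      rwa [degree_chi, ← hf_def, degree_eq_natDegree hf, Nat.cast_lt] at this
    -- For r with nonzero remainder f, a suitable power of T moves the leading coefficient of f to
    -- the highest position n - 1, where the functional reads it.
    have h1 : coordinate h0 (Φ.size - 1) (LaurentPolynomial.T (Φ.size - 1 - f.natDegree : ℕ) * r) =
        f.leadingCoeff := by
      have e : reduce h0 (LaurentPolynomial.T (Φ.size - 1 - f.natDegree : ℕ) * r) =
          X ^ (Φ.size - 1 - f.natDegree) * f := by
        rw [← reduce_toLaurent h0 (f := X ^ (Φ.size - 1 - f.natDegree) * f), ← sub_eq_zero,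
          ← map_sub, reduce_eq_zero_iff, map_mul, toLaurent_X_pow, ← mul_sub]
        · exact (dvd_sub_reduce h0 r).mul_left _
        · rw [degree_mul, degree_X_pow, degree_eq_natDegree hf, degree_chi, ← Nat.cast_add,
            Nat.cast_lt]
          omega
      rw [coordinate_apply, e, leadingCoeff]
      conv_lhs => rw [show Φ.size - 1 = f.natDegree + (Φ.size - 1 - f.natDegree) by omega]
      rw [show f.natDegree + (Φ.size - 1 - f.natDegree) - f.natDegree =
        Φ.size - 1 - f.natDegree by omega, coeff_X_pow_mul]
    rw [hr] at h1
    exact hf (leadingCoeff_eq_zero.mp h1.symm)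

variable {V : Type*} [AddCommGroup V] [Module K V] [Module K[T;T⁻¹] V]
  [IsScalarTower K K[T;T⁻¹] V]

theorem smul_eq_sum_coordinate {w : V} (hw : toLaurent Φ.chi • w = 0) (r : K[T;T⁻¹]) :
    r • w = ∑ i : Fin Φ.size, coordinate h0 i r • (LaurentPolynomial.T (i : ℕ) : K[T;T⁻¹]) • w := by
  obtain ⟨c, hc⟩ := dvd_sub_sum_coordinate h0 r
  have : (r - ∑ i : Fin Φ.size, coordinate h0 i r •
      (LaurentPolynomial.T (i : ℕ) : K[T;T⁻¹])) • w = 0 := by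
    rw [hc, mul_comm, mul_smul, hw, smul_zero]
  rw [sub_smul, sub_eq_zero, Finset.sum_smul] at this
  rw [this]
  simp only [smul_assoc]

theorem T_smul_last {w : V} : toLaurent Φ.chi • w =
    (LaurentPolynomial.T (Φ.size : ℤ) : K[T;T⁻¹]) • w +
      ∑ i : Fin Φ.size, Φ.chi.coeff i • (LaurentPolynomial.T (i : ℕ) : K[T;T⁻¹]) • w := by
  have h1 : Φ.chi.degree < (Φ.size + 1 : ℕ) := by
    rw [degree_chi, Nat.cast_lt]
    exact Nat.lt_succ_self _
  have h2 : Φ.chi.coeff Φ.size = 1 := Φ.chi_monic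
  rw [toLaurent_eq_sum h1, Fin.sum_univ_castSucc, add_smul, Finset.sum_smul, add_comm]
  simp only [Fin.val_last, Fin.val_castSucc, h2, one_smul, smul_assoc]

/-- The powers of `T` applied to a vector annihilated by the characteristic polynomial are
transformed by the matrix of the block. -/
theorem T_smul_eq_sum_mat {w : V} (hw : toLaurent Φ.chi • w = 0) (j : Fin Φ.size) :
    (LaurentPolynomial.T 1 : K[T;T⁻¹]) • (LaurentPolynomial.T (j : ℕ) : K[T;T⁻¹]) • w =
      ∑ i, Φ.mat i j • (LaurentPolynomial.T (i : ℕ) : K[T;T⁻¹]) • w := by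
  rw [smul_smul, ← LaurentPolynomial.T_add]
  by_cases hj : (j : ℕ) + 1 = Φ.size
  · rw [T_smul_last] at hw
    simp only [mat, Matrix.of_apply, hj, if_true, neg_smul, Finset.sum_neg_distrib]
    rw [← eq_neg_iff_add_eq_zero] at hw
    rw [← hw, show (1 + (j : ℕ) : ℤ) = (Φ.size : ℤ) by omega]
  · have hj' : (j : ℕ) + 1 < Φ.size := by omega
    simp only [mat, Matrix.of_apply, hj, if_false]
    rw [Finset.sum_eq_single ⟨j + 1, hj'⟩]
    · simp [add_comm]
    · intro i _ hi
      rw [if_neg (fun h => hi (Fin.ext h)), zero_smul]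
    · simp

/-- The ones below the diagonal say that T maps each basis vector to the next. -/
theorem eq_T_smul_of_mat {b : Fin Φ.size → V}
    (hb : ∀ j, (LaurentPolynomial.T 1 : K[T;T⁻¹]) • b j = ∑ i, Φ.mat i j • b i) (j : Fin Φ.size) :
    b j = (LaurentPolynomial.T (j : ℕ) : K[T;T⁻¹]) • b ⟨0, Φ.size_pos⟩ := by
  obtain ⟨j, hj⟩ := j
  induction j with
  | zero => simp
  | succ j ih =>
    have h1 := hb ⟨j, by omega⟩
    rw [ih (by omega), smul_smul, ← LaurentPolynomial.T_add] at h1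
    have hne : j + 1 ≠ Φ.size := by omega
    simp only [mat, Matrix.of_apply, hne, if_false] at h1
    rw [Finset.sum_eq_single ⟨j + 1, hj⟩] at h1
    · simp only [if_true, one_smul] at h1
      rw [← h1]
      push_cast
      rw [add_comm]
    · intro i _ hi
      rw [if_neg (fun h => hi (Fin.ext h)), zero_smul]
    · simp

/-- The last column of the block is the relation χ(T)b₀ = 0. -/
theorem smul_eq_zero_of_mat {b : Fin Φ.size → V}
    (hb : ∀ j, (LaurentPolynomial.T 1 : K[T;T⁻¹]) • b j = ∑ i, Φ.mat i j • b i) :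
    toLaurent Φ.chi • b ⟨0, Φ.size_pos⟩ = 0 := by
  have hn := Φ.size_pos
  have h1 := hb ⟨Φ.size - 1, by omega⟩
  rw [eq_T_smul_of_mat hb ⟨Φ.size - 1, _⟩, smul_smul, ← LaurentPolynomial.T_add] at h1
  have hne : Φ.size - 1 + 1 = Φ.size := by omega
  simp only [mat, Matrix.of_apply, hne, if_true, neg_smul, Finset.sum_neg_distrib] at h1
  rw [T_smul_last, ← eq_neg_iff_add_eq_zero,
    show (Φ.size : ℤ) = 1 + ((Φ.size - 1 : ℕ) : ℤ) by omega, h1]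
  congr 1
  exact Finset.sum_congr rfl fun i _ => by rw [eq_T_smul_of_mat hb i]

end FrobeniusBlock

end IsometricPairs

namespace IsometricPairs

open Polynomial
open scoped LaurentPolynomial Matrix

/-! ### From isometries and matrices of forms to modules and functionals. -/

section Operators

variable {K : Type*} [Field K]

/-- The module over Laurent polynomials defined by an invertible operator. -/
@[reducible] noncomputable def laurentModule {V : Type*} [AddCommGroup V] [Module K V]
    (A : (Module.End K V)ˣ) : Module K[T;T⁻¹] V :=
  Module.compHom V (evalUnit A).toRingHom

variable {V : Type*} [AddCommGroup V] [Module K V] [Module K[T;T⁻¹] V]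
  [IsScalarTower K K[T;T⁻¹] V]

theorem T_smul_T_smul (k l : ℤ) (x : V) :
    (LaurentPolynomial.T k : K[T;T⁻¹]) • (LaurentPolynomial.T l : K[T;T⁻¹]) • x =
      (LaurentPolynomial.T (k + l) : K[T;T⁻¹]) • x := by
  rw [smul_smul, ← LaurentPolynomial.T_add]

theorem C_smul_eq (a : K) (x : V) : (LaurentPolynomial.C a : K[T;T⁻¹]) • x = a • x := by
  rw [LaurentPolynomial.C_eq_algebraMap, algebraMap_smul]

variable [StarRing K] {ε : K} {F : V →ₗ⋆[K] V →ₗ[K] K}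

/-- Isometry makes T⁻¹ the adjoint of T. This extends to all powers of T and then, by semilinearity
in the first argument, to all Laurent polynomials. -/
theorem isInvariantForm_of_isometry (hF : ∀ x y, F x y = ε * star (F y x))
    (hA : ∀ x y, F ((LaurentPolynomial.T 1 : K[T;T⁻¹]) • x)
      ((LaurentPolynomial.T 1 : K[T;T⁻¹]) • y) = F x y) :
    IsInvariantForm (laurentStar (K := K)) ε F where
  symm := hF
  adjoint r x y := by
    have hn : ∀ (n : ℕ) x y, F ((LaurentPolynomial.T n : K[T;T⁻¹]) • x)
        ((LaurentPolynomial.T n : K[T;T⁻¹]) • y) = F x y := by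
      intro n
      induction n with
      | zero => intro x y; simp
      | succ n ih =>
        intro x y
        rw [Nat.cast_succ, ← T_smul_T_smul, ← T_smul_T_smul, ih, hA]
    have hk : ∀ (k : ℤ) x y, F ((LaurentPolynomial.T k : K[T;T⁻¹]) • x) y =
        F x ((LaurentPolynomial.T (-k) : K[T;T⁻¹]) • y) := by
      intro k x y
      obtain ⟨n, rfl | rfl⟩ := Int.eq_nat_or_neg k
      · rw [← hn n x, T_smul_T_smul, add_neg_cancel, LaurentPolynomial.T_zero, one_smul]
      · rw [← hn n _ y, T_smul_T_smul, add_neg_cancel, LaurentPolynomial.T_zero, one_smul, neg_neg]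
    induction r using LaurentPolynomial.induction_on' with
    | add q r hq hr => 
      rw [add_smul, map_add F, LinearMap.add_apply, hq, hr, map_add laurentStar, add_smul,
        map_add (F x)]
    | C_mul_T n a =>
      rw [map_mul, laurentStar_C, laurentStar_T, mul_smul, mul_smul, C_smul_eq, C_smul_eq,
        map_smulₛₗ F, LinearMap.smul_apply, hk, (F x).map_smul (star a)]
      rfl

end Operators

namespace FrobeniusBlock

variable {K : Type*} [Field K] [StarRing K] {Φ : FrobeniusBlock K} {ε : K}

theorem HasForm.coeff_zero_ne_zero (h : Φ.HasForm ε) : Φ.p.coeff 0 ≠ 0 :=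
  coeff_zero_ne_zero_of_eq_vee Φ.monic.ne_zero h.p_eq_vee

/-- The functional that describes a form on a block. -/
theorem IsForm.exists_functional {B : Matrix (Fin Φ.size) (Fin Φ.size) K} (hB : Φ.IsForm ε B) :
    ∃ ℓ : K[T;T⁻¹] →ₗ[K] K, IsFrobenius (toLaurent Φ.chi) ℓ ∧
      (∀ r, ℓ (laurentStar r) = ε * star (ℓ r)) ∧
      ∀ (q : K[T;T⁻¹]) (i j : Fin Φ.size), (B * laurentEval q Φ.mat) i j =
        ℓ (q * LaurentPolynomial.T ((j : ℕ) - (i : ℕ) : ℤ)) := by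
  have hform : Φ.HasForm ε := ⟨B, hB⟩
  have h0 : Φ.chi.coeff 0 ≠ 0 := Φ.coeff_zero_chi_ne_zero_iff.mpr hform.coeff_zero_ne_zero
  obtain ⟨hBu, hBε, hBΦ⟩ := hB
  obtain ⟨M, hM⟩ := Φ.isUnit_mat_iff.mpr h0
  -- The model space Kⁿ, where T acts by the block and the form is x*By.
  let A : (Module.End K (Fin Φ.size → K))ˣ := Units.map (Matrix.toLinAlgEquiv' (R := K) (n := Fin Φ.size) :
    Matrix (Fin Φ.size) (Fin Φ.size) K →* Module.End K (Fin Φ.size → K)) M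
  let _ : Module K[T;T⁻¹] (Fin Φ.size → K) := laurentModule A
  have hsmul : ∀ (r : K[T;T⁻¹]) (x : (Fin Φ.size → K)), r • x = evalUnit M r *ᵥ x := fun r x => by
    have h1 : evalUnit A r = Matrix.toLinAlgEquiv' (evalUnit M r) := by
      rw [evalUnit_eq_sum, evalUnit_eq_sum, map_finsuppSum]
      refine Finset.sum_congr rfl fun k _ => ?_
      simp only [A, ← map_zpow, map_smul]
      rfl
    change evalUnit A r x = _
    rw [h1, Matrix.toLinAlgEquiv'_apply]
  have : IsScalarTower K K[T;T⁻¹] (Fin Φ.size → K) := ⟨fun a r x => by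
    rw [hsmul, hsmul, map_smul, Matrix.smul_mulVec]⟩
  let F : (Fin Φ.size → K) →ₗ⋆[K] (Fin Φ.size → K) →ₗ[K] K := LinearMap.mk₂'ₛₗ (starRingEnd K) (RingHom.id K)
    (fun x y => star x ⬝ᵥ B *ᵥ y)
    (fun x y z => by rw [star_add, add_dotProduct]) (fun a x y => by
      rw [star_smul, smul_dotProduct]; rfl)
    (fun x y z => by rw [Matrix.mulVec_add, dotProduct_add])
    (fun a x y => by rw [Matrix.mulVec_smul, dotProduct_smul]; rfl)
  have hFa : ∀ x y, F x y = star x ⬝ᵥ B *ᵥ y := fun x y => rfl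
  have hT1 : ∀ x : (Fin Φ.size → K), (LaurentPolynomial.T 1 : K[T;T⁻¹]) • x = Φ.mat *ᵥ x := fun x => by
    rw [hsmul, evalUnit_T, zpow_one, hM]
  have hF : IsInvariantForm (laurentStar (K := K)) ε F := by
    apply isInvariantForm_of_isometry
    · intro x y
      rw [hFa, hFa, ← Matrix.star_dotProduct, Matrix.star_mulVec, ← Matrix.dotProduct_mulVec]
      conv_lhs => rw [hBε]
      rw [Matrix.smul_mulVec, dotProduct_smul, smul_eq_mul]
    · intro x y
      rw [hT1, hT1, hFa, hFa, Matrix.star_mulVec, ← Matrix.dotProduct_mulVec, Matrix.mulVec_mulVec,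
        Matrix.mulVec_mulVec, ← hBΦ]
  let e : Fin Φ.size → (Fin Φ.size → K) := fun j => Pi.single j 1
  have he : ∀ j, (LaurentPolynomial.T 1 : K[T;T⁻¹]) • e j = ∑ i, Φ.mat i j • e i := fun j => by
    rw [hT1, Matrix.mulVec_single_one]
    ext i
    simp [e, Finset.sum_apply, Pi.single_apply]
  have heT := eq_T_smul_of_mat he
  have hg := smul_eq_zero_of_mat he
  set e₀ := e ⟨0, Φ.size_pos⟩ with he₀
  have hentry : ∀ (q : K[T;T⁻¹]) (i j : Fin Φ.size), F (e i) (q • e j) =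
      (B * evalUnit M q) i j := fun q i j => by
    rw [hFa, hsmul, Matrix.mulVec_mulVec]
    simp [e]
  -- ℓ(r) = F(e₀, re₀) for the cyclic vector e₀. The Frobenius property is the nonsingularity of B,
  -- and the entries follow from eⱼ = Tʲe₀.
  refine ⟨coefficientFunctional _ F e₀ e₀, ⟨fun r => ?_, fun r hr => ?_⟩, fun r => ?_,
    fun q i j => ?_⟩
  · rw [coefficientFunctional_apply, mul_comm, mul_smul, hg, smul_zero, map_zero]
  · have h1 : ∀ i, F (e i) (r • e₀) = 0 := fun i => by
      rw [heT i, hF.adjoint, smul_smul]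
      exact hr _
    have h2 : r • e₀ = 0 := by
      have h3 : B *ᵥ (r • e₀) = 0 := by
        ext i
        have := h1 i
        rw [hFa] at this
        simpa [e, ← Pi.single_star] using this
      exact Matrix.mulVec_injective_of_isUnit hBu (h3.trans (Matrix.mulVec_zero B).symm)
    apply dvd_of_coordinate_eq_zero h0
    intro i hi
    rw [smul_eq_sum_coordinate h0 hg] at h2
    have h3 := congrFun h2 ⟨i, hi⟩
    simp only [← heT] at h3
    simpa [e, Finset.sum_apply, Pi.single_apply] using h3
  · rw [coefficientFunctional_apply, coefficientFunctional_apply, hF.apply_smul,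
      (isInvolution_laurentStar K).apply_apply]
  · rw [← hM, laurentEval_eq_evalUnit_matrix, ← hentry, heT i, heT j, hF.adjoint, smul_smul,
      smul_smul, laurentStar_T, coefficientFunctional_apply]
    congr 2
    rw [mul_comm (LaurentPolynomial.T _) q, mul_assoc, ← LaurentPolynomial.T_add]
    congr 2
    ring

variable {V : Type*} [AddCommGroup V] [Module K V] [Module K[T;T⁻¹] V]
  [IsScalarTower K K[T;T⁻¹] V] {F : V →ₗ⋆[K] V →ₗ[K] K}

/-- A nondegenerate cyclic submodule defines a form on the block. -/
theorem hasForm_of_isFrobenius (hF : IsInvariantForm (laurentStar (K := K)) ε F)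
    (h0 : Φ.chi.coeff 0 ≠ 0) {y : V} (hy : toLaurent Φ.chi • y = 0)
    (hfrob : IsFrobenius (toLaurent Φ.chi) (coefficientFunctional K[T;T⁻¹] F y y)) :
    Φ.HasForm ε := by
  have hT := T_smul_eq_sum_mat hy
  set b : Fin Φ.size → V := fun j => (LaurentPolynomial.T (j : ℕ) : K[T;T⁻¹]) • y with hb
  have hA : ∀ x z, F ((LaurentPolynomial.T 1 : K[T;T⁻¹]) • x)
      ((LaurentPolynomial.T 1 : K[T;T⁻¹]) • z) = F x z := fun x z => by
    rw [hF.adjoint, laurentStar_T, T_smul_T_smul, neg_add_cancel, LaurentPolynomial.T_zero, one_smul]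
  -- The Gram matrix of y, Ty, …, T^(n-1)y is the required B. A vector in its kernel is a Laurent
  -- polynomial f with fy orthogonal to Ry, hence divisible by χ, hence with zero coordinates.
  refine ⟨Matrix.of fun i j => F (b i) (b j), ?_, ?_, ?_⟩
  · refine Matrix.mulVec_injective_iff_isUnit.mp
      ((injective_iff_map_eq_zero (Matrix.mulVecLin _)).mpr ?_)
    intro x hx
    set f : K[T;T⁻¹] := ∑ j, x j • LaurentPolynomial.T (j : ℕ) with hf
    have hfy : f • y = ∑ j, x j • b j := by
      rw [hf, Finset.sum_smul]
      simp only [smul_assoc, hb]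
    have h1 : ∀ i, F (b i) (f • y) = 0 := fun i => by
      have := congrFun hx i
      rw [Matrix.mulVecLin_apply, Matrix.mulVec, dotProduct] at this
      rw [hfy, map_sum]
      simp only [map_smul, smul_eq_mul]
      simp only [Matrix.of_apply, Pi.zero_apply] at this
      rw [← this]
      exact Finset.sum_congr rfl fun j _ => mul_comm _ _
    have h2 : toLaurent Φ.chi ∣ f := by
      refine hfrob.dvd _ fun t => ?_
      rw [coefficientFunctional_apply, mul_smul, hF.adjoint' (isInvolution_laurentStar K),
        smul_eq_sum_coordinate h0 hy, map_sum F, LinearMap.sum_apply]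
      refine Finset.sum_eq_zero fun i _ => ?_
      rw [map_smulₛₗ F, LinearMap.smul_apply, h1 i, smul_zero]
    have h3 := (reduce_eq_zero_iff h0).mpr h2
    funext i
    have h4 : coordinate h0 i f = x i := by
      rw [hf, map_sum, Finset.sum_eq_single i]
      · rw [map_smul, coordinate_T h0 _ i.2, if_pos rfl, smul_eq_mul, mul_one]
      · intro j _ hj
        rw [map_smul, coordinate_T h0 _ j.2, if_neg (fun h => hj (Fin.ext h)), smul_zero]
      · simp
    rw [← h4, coordinate_apply, h3, coeff_zero, Pi.zero_apply]
  · ext i j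
    simp only [Matrix.of_apply, Matrix.smul_apply, Matrix.conjTranspose_apply, smul_eq_mul]
    exact hF.symm _ _
  · ext i j
    simp only [Matrix.of_apply, Matrix.mul_apply, Matrix.conjTranspose_apply]
    rw [← hA, hT i, hT j, map_sum F, LinearMap.sum_apply]
    simp only [map_smulₛₗ, LinearMap.smul_apply, map_sum, smul_eq_mul, RingHom.id_apply,
      Finset.sum_mul, starRingEnd_apply]
    rw [Finset.sum_comm]
    refine Finset.sum_congr rfl fun k _ => Finset.sum_congr rfl fun l _ => ?_
    ring

/-- The first vector of a basis in which a form is given by a block is a generator. -/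
theorem isCyclicForm_of_mat (h0 : Φ.chi.coeff 0 ≠ 0) {ℓ : K[T;T⁻¹] →ₗ[K] K}
    (hℓ : IsFrobenius (toLaurent Φ.chi) ℓ) {q : K[T;T⁻¹]} {b : Fin Φ.size → V}
    (hb : ∀ j, (LaurentPolynomial.T 1 : K[T;T⁻¹]) • b j = ∑ i, Φ.mat i j • b i)
    (hbF : ∀ i j, F (b i) (b j) = ℓ (q * LaurentPolynomial.T ((j : ℕ) - (i : ℕ) : ℤ))) :
    IsCyclicForm F (toLaurent Φ.chi) (fun r => ℓ (q * r)) (b ⟨0, Φ.size_pos⟩) where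
  smul_eq_zero := smul_eq_zero_of_mat hb
  apply_smul r := by
    rw [smul_eq_sum_coordinate h0 (smul_eq_zero_of_mat hb), map_sum]
    simp only [← eq_T_smul_of_mat hb, map_smul, hbF]
    rw [hℓ.map_eq (a := q * r) (b := q * ∑ i : Fin Φ.size, coordinate h0 i r •
      (LaurentPolynomial.T (i : ℕ) : K[T;T⁻¹]))]
    · rw [Finset.mul_sum, map_sum]
      simp
    · rw [← mul_sub]
      exact (dvd_sub_sum_coordinate h0 r).mul_left _

theorem mem_span_of_mem_span_singleton (h0 : Φ.chi.coeff 0 ≠ 0) {y : V}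
    (hy : toLaurent Φ.chi • y = 0) {x : V} (hx : x ∈ Submodule.span K[T;T⁻¹] {y}) :
    x ∈ Submodule.span K (Set.range fun j : Fin Φ.size =>
      (LaurentPolynomial.T (j : ℕ) : K[T;T⁻¹]) • y) := by
  obtain ⟨r, rfl⟩ := Submodule.mem_span_singleton.mp hx
  rw [smul_eq_sum_coordinate h0 hy]
  exact Submodule.sum_mem _ fun i _ => Submodule.smul_mem _ _ (Submodule.subset_span ⟨i, rfl⟩)

end FrobeniusBlock

end IsometricPairs

/-! ### Bases adapted to cyclic and hyperbolic submodules. -/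

namespace IsometricPairs

open Polynomial
open scoped LaurentPolynomial Matrix

variable {K : Type*} [Field K] {V : Type*} [AddCommGroup V] [Module K V] [Module K[T;T⁻¹] V]
  [IsScalarTower K K[T;T⁻¹] V]

/-- A finite-dimensional subspace that is stable under `T` is a submodule. -/
theorem smul_mem_of_T_smul_mem {S : Submodule K V} [FiniteDimensional K S]
    (hS : ∀ x ∈ S, (LaurentPolynomial.T 1 : K[T;T⁻¹]) • x ∈ S) (r : K[T;T⁻¹]) {x : V}
    (hx : x ∈ S) : r • x ∈ S := by
  have hcomm : ∀ (a : K) (r : K[T;T⁻¹]) (x : V), r • a • x = a • r • x := fun a r x => by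
    rw [← algebraMap_smul K[T;T⁻¹] a x, smul_smul, mul_comm, mul_smul, algebraMap_smul]
  -- T is injective on the finite-dimensional S, hence surjective onto S, so T⁻¹ preserves S too.
  have hS' : ∀ x ∈ S, (LaurentPolynomial.T (-1) : K[T;T⁻¹]) • x ∈ S := by
    intro x hx
    let f : S →ₗ[K] S :=
      { toFun := fun x => ⟨(LaurentPolynomial.T 1 : K[T;T⁻¹]) • (x : V), hS x x.2⟩
        map_add' := fun x y => Subtype.ext (smul_add _ _ _)
        map_smul' := fun a x => Subtype.ext (hcomm _ _ _) }
    have hinv : ∀ x : V, (LaurentPolynomial.T (-1) : K[T;T⁻¹]) •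
        (LaurentPolynomial.T 1 : K[T;T⁻¹]) • x = x := fun x => by
      rw [T_smul_T_smul, neg_add_cancel, LaurentPolynomial.T_zero, one_smul]
    have hf : Function.Injective f := fun x y hxy => by
      have := congrArg (fun z : S => (LaurentPolynomial.T (-1) : K[T;T⁻¹]) • (z : V)) hxy
      simp only [f, LinearMap.coe_mk, AddHom.coe_mk, hinv] at this
      exact Subtype.ext this
    obtain ⟨y, hy⟩ := LinearMap.surjective_of_injective hf ⟨x, hx⟩
    have : (LaurentPolynomial.T 1 : K[T;T⁻¹]) • (y : V) = x := congrArg Subtype.val hy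
    rw [← this, hinv]
    exact y.2
  have hn : ∀ (n : ℕ), ∀ x ∈ S, (LaurentPolynomial.T n : K[T;T⁻¹]) • x ∈ S := by
    intro n
    induction n with
    | zero => intro x hx; simpa using hx
    | succ n ih =>
      intro x hx
      rw [Nat.cast_succ, ← T_smul_T_smul]
      exact ih _ (hS x hx)
  have hn' : ∀ (n : ℕ), ∀ x ∈ S, (LaurentPolynomial.T (-n) : K[T;T⁻¹]) • x ∈ S := by
    intro n
    induction n with
    | zero => intro x hx; simpa using hx
    | succ n ih =>
      intro x hx
      rw [Nat.cast_succ, neg_add, ← T_smul_T_smul]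
      exact ih _ (hS' x hx)
  induction r using LaurentPolynomial.induction_on' with
  | add q r hq hr => rw [add_smul]; exact S.add_mem hq hr
  | C_mul_T n a =>
    rw [mul_smul, C_smul_eq]
    apply S.smul_mem
    obtain ⟨n, rfl | rfl⟩ := Int.eq_nat_or_neg n
    · exact hn n x hx
    · exact hn' n x hx

theorem smul_mem_span_range {ι : Type*} [Finite ι] {b : ι → V}
    (hb : ∀ j, (LaurentPolynomial.T 1 : K[T;T⁻¹]) • b j ∈ Submodule.span K (Set.range b))
    (r : K[T;T⁻¹]) {x : V} (hx : x ∈ Submodule.span K (Set.range b)) :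
    r • x ∈ Submodule.span K (Set.range b) := by
  have := FiniteDimensional.span_of_finite K (Set.finite_range b)
  refine smul_mem_of_T_smul_mem (fun x hx => ?_) r hx
  induction hx using Submodule.span_induction with
  | mem x hx => obtain ⟨j, rfl⟩ := hx; exact hb j
  | zero => rw [smul_zero]; exact Submodule.zero_mem _
  | add x y _ _ hx hy => rw [smul_add]; exact Submodule.add_mem _ hx hy
  | smul a x _ hx =>
    rw [← algebraMap_smul K[T;T⁻¹] a x, smul_smul, mul_comm, mul_smul, algebraMap_smul]
    exact Submodule.smul_mem _ _ hx

variable [StarRing K] {F : V →ₗ⋆[K] V →ₗ[K] K} {ε : K}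

/-- The submodule is generated by a hyperbolic pair. -/
def IsHyperbolicSubmodule (F : V →ₗ⋆[K] V →ₗ[K] K) (g : K[T;T⁻¹])
    (U : Submodule K[T;T⁻¹] V) : Prop :=
  ∃ u v, IsHyperbolic laurentStar F g u v ∧ U = Submodule.span K[T;T⁻¹] {u, v}

/-- The submodule is generated by a vector `y` with `g • y = 0` and `F y (r • y) = ℓ r`. -/
def IsCyclicSubmodule (F : V →ₗ⋆[K] V →ₗ[K] K) (g : K[T;T⁻¹]) (ℓ : K[T;T⁻¹] → K)
    (U : Submodule K[T;T⁻¹] V) : Prop :=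
  ∃ y, IsCyclicForm F g ℓ y ∧ U = Submodule.span K[T;T⁻¹] {y}

namespace FrobeniusBlock

variable {Φ : FrobeniusBlock K}

theorem isCyclicSubmodule_of_mat (h0 : Φ.chi.coeff 0 ≠ 0) {ℓ : K[T;T⁻¹] →ₗ[K] K}
    (hℓ : IsFrobenius (toLaurent Φ.chi) ℓ) {q : K[T;T⁻¹]} {b : Fin Φ.size → V}
    (hb : ∀ j, (LaurentPolynomial.T 1 : K[T;T⁻¹]) • b j = ∑ i, Φ.mat i j • b i)
    (hbF : ∀ i j, F (b i) (b j) = ℓ (q * LaurentPolynomial.T ((j : ℕ) - (i : ℕ) : ℤ))) :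
    ∃ U : Submodule K[T;T⁻¹] V, IsCyclicSubmodule F (toLaurent Φ.chi) (fun r => ℓ (q * r)) U ∧
      U.restrictScalars K = Submodule.span K (Set.range b) := by
  refine ⟨_, ⟨_, isCyclicForm_of_mat h0 hℓ hb hbF, rfl⟩, le_antisymm (fun x hx => ?_) ?_⟩
  · have := mem_span_of_mem_span_singleton h0 (smul_eq_zero_of_mat hb) hx
    simpa only [← eq_T_smul_of_mat hb] using this
  · rw [Submodule.span_le]
    rintro _ ⟨j, rfl⟩
    rw [eq_T_smul_of_mat hb j]
    exact Submodule.smul_mem _ _ (Submodule.mem_span_singleton_self _)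

theorem exists_mat_of_isCyclicSubmodule (hF : IsInvariantForm (laurentStar (K := K)) ε F)
    (h0 : Φ.chi.coeff 0 ≠ 0) {ℓ : K[T;T⁻¹] →ₗ[K] K}
    {q : K[T;T⁻¹]} {U : Submodule K[T;T⁻¹] V}
    (hU : IsCyclicSubmodule F (toLaurent Φ.chi) (fun r => ℓ (q * r)) U) :
    ∃ b : Fin Φ.size → V,
      (∀ j, (LaurentPolynomial.T 1 : K[T;T⁻¹]) • b j = ∑ i, Φ.mat i j • b i) ∧
      (∀ i j, F (b i) (b j) = ℓ (q * LaurentPolynomial.T ((j : ℕ) - (i : ℕ) : ℤ))) ∧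
      U.restrictScalars K = Submodule.span K (Set.range b) := by
  obtain ⟨y, hy, rfl⟩ := hU
  refine ⟨fun j => (LaurentPolynomial.T (j : ℕ) : K[T;T⁻¹]) • y,
    T_smul_eq_sum_mat hy.smul_eq_zero, fun i j => ?_, le_antisymm
      (fun x hx => mem_span_of_mem_span_singleton h0 hy.smul_eq_zero hx) ?_⟩
  · rw [hF.adjoint, laurentStar_T, T_smul_T_smul, hy.apply_smul, neg_add_eq_sub]
  · rw [Submodule.span_le]
    rintro _ ⟨j, rfl⟩
    exact Submodule.smul_mem _ _ (Submodule.mem_span_singleton_self _)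

theorem sum_smul_eq_zero {b b' : Fin Φ.size → V}
    (hb'b : ∀ i j, F (b' i) (b j) = if i = j then 1 else 0) {x : V}
    (hx : x ∈ Submodule.span K (Set.range b')) (h : ∀ i, F x (b i) = 0) : x = 0 := by
  obtain ⟨c, rfl⟩ := (Submodule.mem_span_range_iff_exists_fun K).mp hx
  have hc : ∀ i, c i = 0 := fun i => by
    have := h i
    rw [map_sum F, LinearMap.sum_apply, Finset.sum_eq_single i] at this
    · rw [map_smulₛₗ F, LinearMap.smul_apply, hb'b, if_pos rfl] at this
      simpa using this
    · intro j _ hj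
      rw [map_smulₛₗ F, LinearMap.smul_apply, hb'b, if_neg hj, smul_zero]
    · simp
  simp [hc]

/-- The last vector of the dual basis b' reads off the highest coordinate, a generating functional
on R/(χ). So w = b₀ and w' = b'_(n-1) form the hyperbolic pair. -/
theorem isHyperbolicSubmodule_of_mat (hF : IsInvariantForm (laurentStar (K := K)) ε F)
    (h0 : Φ.chi.coeff 0 ≠ 0) {b b' : Fin Φ.size → V}
    (hb : ∀ j, (LaurentPolynomial.T 1 : K[T;T⁻¹]) • b j = ∑ i, Φ.mat i j • b i)
    (hb' : ∀ j, (LaurentPolynomial.T 1 : K[T;T⁻¹]) • b' j = ∑ i, (Φ.matᴴ)⁻¹ i j • b' i)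
    (hbb : ∀ i j, F (b i) (b j) = 0) (hbb' : ∀ i j, F (b' i) (b' j) = 0)
    (hb'b : ∀ i j, F (b' i) (b j) = if i = j then 1 else 0) :
    ∃ U : Submodule K[T;T⁻¹] V, IsHyperbolicSubmodule F (toLaurent Φ.chi) U ∧
      U.restrictScalars K = Submodule.span K (Set.range (Sum.elim b b')) := by
  have hσ := isInvolution_laurentStar K
  have hn := Φ.size_pos
  have hbT := eq_T_smul_of_mat hb
  have hg := smul_eq_zero_of_mat hb
  set w := b ⟨0, hn⟩ with hw
  set l : Fin Φ.size := ⟨Φ.size - 1, by omega⟩ with hl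
  set w' := b' l with hw'
  have hstab : ∀ (r : K[T;T⁻¹]), ∀ x ∈ Submodule.span K (Set.range b'),
      r • x ∈ Submodule.span K (Set.range b') := fun r x hx =>
    smul_mem_span_range (fun j => by
      rw [hb']
      exact Submodule.sum_mem _ fun i _ =>
        Submodule.smul_mem _ _ (Submodule.subset_span ⟨i, rfl⟩)) r hx
  have hmem : ∀ i, b' i ∈ Submodule.span K (Set.range b') := fun i => Submodule.subset_span ⟨i, rfl⟩
  have hiso' : ∀ i, ∀ x ∈ Submodule.span K (Set.range b'), F (b' i) x = 0 := fun i x hx => by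
    obtain ⟨c, rfl⟩ := (Submodule.mem_span_range_iff_exists_fun K).mp hx
    rw [map_sum (F (b' i))]
    exact Finset.sum_eq_zero fun j _ => by rw [map_smul (F (b' i)), hbb', smul_zero]
  have hcoord : ∀ r, F w' (r • w) = coordinate h0 (Φ.size - 1) r := fun r => by
    rw [smul_eq_sum_coordinate h0 hg, map_sum (F w'), Finset.sum_eq_single l]
    · rw [← hbT, map_smul (F w'), hw', hb'b, if_pos rfl, smul_eq_mul, mul_one]
    · intro j _ hj
      rw [← hbT, map_smul (F w'), hw', hb'b, if_neg hj.symm, smul_zero]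
    · simp
  have hfrob := isFrobenius_coordinate h0
  have hyp : IsHyperbolic laurentStar F (toLaurent Φ.chi) w w' :=
    { isotropic := fun r => by
        rw [smul_eq_sum_coordinate h0 hg, map_sum (F w)]
        exact Finset.sum_eq_zero fun j _ => by rw [← hbT, map_smul (F w), hw, hbb, smul_zero]
      isotropic' := fun r => hiso' l _ (hstab r _ (hmem l))
      smul_eq_zero := hg
      smul_eq_zero' := sum_smul_eq_zero hb'b (hstab _ _ (hmem l)) fun i => by
        rw [hF.adjoint, hσ.apply_apply, hbT, smul_smul, mul_comm, mul_smul, hg, smul_zero, map_zero]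
      dvd := fun r hr => hfrob.dvd r fun t => by rw [← hcoord]; exact hr t }
  have : FiniteDimensional K (K[T;T⁻¹] ⧸ Ideal.span {toLaurent Φ.chi}) :=
    finiteDimensional_quotient_toLaurent h0
  refine ⟨_, ⟨w, w', hyp, rfl⟩, le_antisymm ?_ ?_⟩
  · intro x hx
    obtain ⟨r, s, rfl⟩ := Submodule.mem_span_pair.mp hx
    refine Submodule.add_mem _ ?_ ?_
    · rw [smul_eq_sum_coordinate h0 hg]
      exact Submodule.sum_mem _ fun i _ => Submodule.smul_mem _ _
        (Submodule.subset_span ⟨Sum.inl i, (hbT i)⟩)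
    · refine Submodule.span_mono ?_ (hstab s _ (hmem l))
      rintro _ ⟨i, rfl⟩
      exact ⟨Sum.inr i, rfl⟩
  · rw [Submodule.span_le]
    rintro _ ⟨k | k, rfl⟩
    · rw [Sum.elim_inl, hbT]
      exact Submodule.smul_mem _ _ (Submodule.subset_span (by simp))
    -- Each coordinate functional is a multiple of the highest one, so each b'ₖ is a multiple of w'.
    · obtain ⟨n, hn⟩ := hfrob.exists_eq (coordinate_mul_eq_zero h0 k)
      have : b' k = laurentStar n • w' := by
        rw [← sub_eq_zero]
        refine sum_smul_eq_zero hb'b (Submodule.sub_mem _ (hmem k) (hstab _ _ (hmem l))) fun i => ?_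
        rw [map_sub F, LinearMap.sub_apply, hF.adjoint, hσ.apply_apply, hbT i, smul_smul, hcoord,
          ← hn, coordinate_T h0 _ i.2, ← hbT i, hb'b, sub_eq_zero]
        simp only [Fin.ext_iff, eq_comm]
      rw [Sum.elim_inr, this]
      exact Submodule.smul_mem _ _ (Submodule.subset_span (by simp))

/-- The coordinate functionals on Rw have the form F(w', nₖ·), so the vectors σ(nₖ)w' are dual to
the basis Tʲw. Because T is an isometry, it acts on the dual basis by the inverse conjugate
transpose. -/
theorem exists_mat_of_isHyperbolicSubmodule (hF : IsInvariantForm (laurentStar (K := K)) ε F)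
    (h0 : Φ.chi.coeff 0 ≠ 0) {U : Submodule K[T;T⁻¹] V}
    (hU : IsHyperbolicSubmodule F (toLaurent Φ.chi) U) :
    ∃ b b' : Fin Φ.size → V,
      (∀ j, (LaurentPolynomial.T 1 : K[T;T⁻¹]) • b j = ∑ i, Φ.mat i j • b i) ∧
      (∀ j, (LaurentPolynomial.T 1 : K[T;T⁻¹]) • b' j = ∑ i, (Φ.matᴴ)⁻¹ i j • b' i) ∧
      (∀ i j, F (b i) (b j) = 0) ∧ (∀ i j, F (b' i) (b' j) = 0) ∧
      (∀ i j, F (b' i) (b j) = if i = j then 1 else 0) ∧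
      U.restrictScalars K = Submodule.span K (Set.range (Sum.elim b b')) := by
  have hσ := isInvolution_laurentStar K
  obtain ⟨w, w', h, rfl⟩ := hU
  have : FiniteDimensional K (K[T;T⁻¹] ⧸ Ideal.span {toLaurent Φ.chi}) :=
    finiteDimensional_quotient_toLaurent h0
  have hex : ∀ k : Fin Φ.size, ∃ n, ∀ r, coordinate h0 k r = F w' ((n * r) • w) := fun k =>
    h.isFrobenius.exists_eq (coordinate_mul_eq_zero h0 k)
  choose n hn using hex
  have hT := T_smul_eq_sum_mat h.smul_eq_zero
  set b : Fin Φ.size → V := fun j => (LaurentPolynomial.T (j : ℕ) : K[T;T⁻¹]) • w with hb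
  set b' : Fin Φ.size → V := fun j => laurentStar (n j) • w' with hb'
  have hsum : ∀ r : K[T;T⁻¹], r • w = ∑ i : Fin Φ.size, coordinate h0 i r • b i :=
    smul_eq_sum_coordinate h0 h.smul_eq_zero
  have hb'b : ∀ i j, F (b' i) (b j) = if i = j then 1 else 0 := fun i j => by
    rw [hb', hF.adjoint, hσ.apply_apply, hb, smul_smul, ← hn, coordinate_T h0 _ j.2]
    simp only [Fin.ext_iff, eq_comm]
  have hzero : ∀ x ∈ Submodule.span K[T;T⁻¹] {w'}, (∀ i, F x (b i) = 0) → x = 0 := by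
    intro x hx hxb
    refine h.eq_zero_of_mem_span hF hσ hx fun t => ?_
    rw [hsum, map_sum (F x)]
    exact Finset.sum_eq_zero fun i _ => by rw [map_smul (F x), hxb, smul_zero]
  have hmem : ∀ r : K[T;T⁻¹], r • w' ∈ Submodule.span K[T;T⁻¹] {w'} := fun r =>
    Submodule.smul_mem _ _ (Submodule.mem_span_singleton_self _)
  have hKmem : ∀ c : Fin Φ.size → K, ∑ i, c i • b' i ∈ Submodule.span K[T;T⁻¹] {w'} := fun c =>
    Submodule.sum_mem _ fun i _ => by
      rw [← algebraMap_smul K[T;T⁻¹] (c i) (b' i)]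
      exact Submodule.smul_mem _ _ (hmem _)
  have hFsum : ∀ (c : Fin Φ.size → K) i, F (∑ j, c j • b' j) (b i) = star (c i) := fun c i => by
    rw [map_sum F, LinearMap.sum_apply, Finset.sum_eq_single i]
    · rw [map_smulₛₗ F, LinearMap.smul_apply, hb'b, if_pos rfl, smul_eq_mul, mul_one,
        starRingEnd_apply]
    · intro j _ hj
      rw [map_smulₛₗ F, LinearMap.smul_apply, hb'b, if_neg hj, smul_zero]
    · simp
  have hexp : ∀ x ∈ Submodule.span K[T;T⁻¹] {w'}, x = ∑ i, star (F x (b i)) • b' i := by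
    intro x hx
    rw [← sub_eq_zero]
    refine hzero _ (Submodule.sub_mem _ hx (hKmem _)) fun i => ?_
    rw [map_sub F, LinearMap.sub_apply, hFsum, star_star, sub_self]
  refine ⟨b, b', hT, fun j => ?_, fun i j => ?_, fun i j => ?_, hb'b, le_antisymm ?_ ?_⟩
  · have hMu : IsUnit Φ.mat := Φ.isUnit_mat_iff.mpr h0
    have hinv : LaurentPolynomial.T (R := K) 1 • b' j -
        ∑ i, (Φ.matᴴ)⁻¹ i j • b' i = 0 := by
      refine h.eq_zero_of_mem_span hF hσ (Submodule.sub_mem _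
        (Submodule.smul_mem _ _ (hmem _)) (hKmem _)) fun t => ?_
      -- The vectors T·bₖ also span Rw over K. Against them the two candidates for T·b'ⱼ have the
      -- same values.
      have ht : t • w = ∑ k : Fin Φ.size, coordinate h0 k (LaurentPolynomial.T (-1) * t) •
          ((LaurentPolynomial.T 1 : K[T;T⁻¹]) • b k) := by
        have h1 : t • w = (LaurentPolynomial.T 1 : K[T;T⁻¹]) •
            (LaurentPolynomial.T (-1) * t : K[T;T⁻¹]) • w := by
          rw [smul_smul, ← mul_assoc, ← LaurentPolynomial.T_add, add_neg_cancel,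
            LaurentPolynomial.T_zero, one_mul]
        rw [h1, hsum, Finset.smul_sum]
        refine Finset.sum_congr rfl fun k _ => ?_
        rw [← algebraMap_smul K[T;T⁻¹] (coordinate h0 k _) (b k), smul_smul, mul_comm, mul_smul,
          algebraMap_smul]
      rw [ht, map_sum (F _)]
      refine Finset.sum_eq_zero fun k _ => ?_
      rw [map_smul (F _)]
      have h2 : F ((LaurentPolynomial.T 1 : K[T;T⁻¹]) • b' j)
          ((LaurentPolynomial.T 1 : K[T;T⁻¹]) • b k) = F (b' j) (b k) := by
        rw [hF.adjoint, laurentStar_T, T_smul_T_smul, neg_add_cancel, LaurentPolynomial.T_zero,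
          one_smul]
      have h3 : F (∑ i, (Φ.matᴴ)⁻¹ i j • b' i) ((LaurentPolynomial.T 1 : K[T;T⁻¹]) • b k) =
          if j = k then 1 else 0 := by
        rw [hT, map_sum (F _)]
        have h4 : ∀ i, F (∑ i, (Φ.matᴴ)⁻¹ i j • b' i) (Φ.mat i k • b i) =
            (Φ.mat)⁻¹ j i * Φ.mat i k := fun i => by
          rw [map_smul (F _), hFsum, smul_eq_mul, mul_comm, ← Matrix.conjTranspose_nonsing_inv,
            Matrix.conjTranspose_apply, star_star]
        rw [Finset.sum_congr rfl fun i _ => h4 i, ← Matrix.mul_apply,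
          Matrix.nonsing_inv_mul _ ((Matrix.isUnit_iff_isUnit_det _).mp hMu), Matrix.one_apply]
      rw [map_sub F, LinearMap.sub_apply, h2, h3, hb'b, sub_self, smul_zero]
    exact sub_eq_zero.mp hinv
  · rw [hb, hF.adjoint, smul_smul, h.isotropic]
  · rw [hb', hF.adjoint, smul_smul, h.isotropic']
  · intro x hx
    obtain ⟨r, s, rfl⟩ := Submodule.mem_span_pair.mp hx
    refine Submodule.add_mem _ ?_ ?_
    · rw [hsum]
      exact Submodule.sum_mem _ fun i _ => Submodule.smul_mem _ _
        (Submodule.subset_span ⟨Sum.inl i, rfl⟩)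
    · rw [hexp _ (hmem s)]
      exact Submodule.sum_mem _ fun i _ => Submodule.smul_mem _ _
        (Submodule.subset_span ⟨Sum.inr i, rfl⟩)
  · rw [Submodule.span_le]
    rintro _ ⟨k | k, rfl⟩
    · exact Submodule.smul_mem _ _ (Submodule.subset_span (by simp))
    · exact Submodule.smul_mem _ _ (Submodule.subset_span (by simp))

end FrobeniusBlock

end IsometricPairs

/-! ### Direct sums of matrices and orthogonal decompositions of the module. -/

namespace IsometricPairs

open Polynomial
open scoped LaurentPolynomial Matrix

theorem sum_blockDiagonal'_smul {K V o : Type*} [Semiring K] [AddCommMonoid V] [Module K V]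
    [Fintype o] [DecidableEq o] {κ : o → Type*} [∀ i, Fintype (κ i)]
    (N : ∀ i, Matrix (κ i) (κ i) K) (v : (Σ i, κ i) → V) (i : o) (x : κ i) :
    ∑ p, Matrix.blockDiagonal' N p ⟨i, x⟩ • v p = ∑ y, N i y x • v ⟨i, y⟩ := by
  rw [Fintype.sum_sigma, Finset.sum_eq_single i]
  · simp only [Matrix.blockDiagonal'_apply_eq]
  · intro j _ hj
    exact Finset.sum_eq_zero fun y _ => by
      rw [Matrix.blockDiagonal'_apply_ne _ _ _ hj, zero_smul]
  · simp

theorem isUnit_blockDiagonal' {K o : Type*} [CommRing K] [Fintype o] [DecidableEq o]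
    {κ : o → Type*} [∀ i, Fintype (κ i)] [∀ i, DecidableEq (κ i)]
    {N : ∀ i, Matrix (κ i) (κ i) K} (h : ∀ i, IsUnit (N i)) :
    IsUnit (Matrix.blockDiagonal' N) :=
  (Pi.isUnit_iff.mpr h).map (Matrix.blockDiagonal'RingHom κ K)

section LinearAlgebra

variable {K V : Type*} [Field K] [StarRing K] [AddCommGroup V] [Module K V]

theorem apply_eq_zero_of_mem_span {F : V →ₗ⋆[K] V →ₗ[K] K} {ι ι' : Type*} {f : ι → V} {g : ι' → V}
    (h : ∀ i j, F (f i) (g j) = 0) {x y : V} (hx : x ∈ Submodule.span K (Set.range f))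
    (hy : y ∈ Submodule.span K (Set.range g)) : F x y = 0 := by
  have h1 : ∀ i, F (f i) y = 0 := fun i => by
    have : Submodule.span K (Set.range g) ≤ LinearMap.ker (F (f i)) := by
      rw [Submodule.span_le]
      rintro _ ⟨j, rfl⟩
      exact h i j
    exact this hy
  induction hx using Submodule.span_induction with
  | mem x hx => obtain ⟨i, rfl⟩ := hx; exact h1 i
  | zero => simp
  | add x z _ _ hx hz => rw [map_add F, LinearMap.add_apply, hx, hz, add_zero]
  | smul a x _ hx => rw [map_smulₛₗ F, LinearMap.smul_apply, hx, smul_zero]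

/-- A generating family with nonsingular Gram matrix is a basis. -/
theorem exists_basis_of_isUnit {F : V →ₗ⋆[K] V →ₗ[K] K} {ι : Type*} [Fintype ι] [DecidableEq ι]
    {b : ι → V} (hG : IsUnit (Matrix.of fun i j => F (b i) (b j)))
    (hb : ⊤ ≤ Submodule.span K (Set.range b)) {A : V →ₗ[K] V} {M : Matrix ι ι K}
    (hA : ∀ j, A (b j) = ∑ i, M i j • b i) :
    ∃ b' : Module.Basis ι K V, (∀ i, b' i = b i) ∧ LinearMap.toMatrix b' b' A = M := by
  have hli : LinearIndependent K b := by
    rw [Fintype.linearIndependent_iff]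
    intro c hc
    have h1 : (Matrix.of fun i j => F (b i) (b j)) *ᵥ c = 0 := by
      ext i
      have := congrArg (F (b i)) hc
      rw [map_sum (F (b i)), map_zero] at this
      rw [Matrix.mulVec, dotProduct, Pi.zero_apply, ← this]
      refine Finset.sum_congr rfl fun j _ => ?_
      rw [map_smul (F (b i)), smul_eq_mul, mul_comm, Matrix.of_apply]
    exact congrFun (Matrix.mulVec_injective_of_isUnit hG (h1.trans (Matrix.mulVec_zero _).symm))
  refine ⟨Module.Basis.mk hli hb, fun i => Module.Basis.mk_apply hli hb i, ?_⟩
  ext i j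
  rw [LinearMap.toMatrix_apply, Module.Basis.mk_apply, hA]
  have : ∑ i, M i j • b i = ∑ i, M i j • Module.Basis.mk hli hb i :=
    Finset.sum_congr rfl fun i _ => by rw [Module.Basis.mk_apply]
  rw [this, Module.Basis.repr_sum_self]

theorem isUnit_hyperbolicMatrix {ε : K} (hε : ε * ε = 1) (n : Type*) [Fintype n] [DecidableEq n] :
    IsUnit (Matrix.fromBlocks 0 (ε • 1) 1 0 : Matrix (n ⊕ n) (n ⊕ n) K) := by
  refine IsUnit.of_mul_eq_one (Matrix.fromBlocks 0 1 (ε • 1) 0) ?_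
  rw [Matrix.fromBlocks_multiply]
  simp [smul_smul, hε]

end LinearAlgebra

variable {K : Type*} [Field K] [StarRing K] {V : Type*} [AddCommGroup V] [Module K V]
  [Module K[T;T⁻¹] V] [IsScalarTower K K[T;T⁻¹] V] {F : V →ₗ⋆[K] V →ₗ[K] K} {ε : K}

theorem FrobeniusBlock.isCoprime_toLaurent (h2 : (2 : K) ≠ 0) {Φ : FrobeniusBlock K}
    (h0 : Φ.p.coeff 0 ≠ 0) {q : K[T;T⁻¹]} (hq : q ≠ 0) (hq' : IsStationaryForm Φ.p q) :
    IsCoprime (toLaurent Φ.p) q :=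
  (dvd_or_isCoprime (isMaximal_span_toLaurent Φ.irreducible h0) q).resolve_left fun h =>
    hq'.evalUnit_ne_zero h2 Φ.monic h0 hq ((evalUnit_rootUnit_eq_zero_iff h0 q).mpr h)

/-- A Bézout relation between χ and q, evaluated at the block, gives an inverse of q(Φ), because
χ(Φ) = 0 by Cayley–Hamilton. -/
theorem FrobeniusBlock.isUnit_laurentEval {Φ : FrobeniusBlock K}
    (h0 : Φ.p.coeff 0 ≠ 0) {q : K[T;T⁻¹]} (hq : IsCoprime (toLaurent Φ.p) q) :
    IsUnit (laurentEval q Φ.mat) := by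
  obtain ⟨M, hM⟩ := Φ.isUnit_mat_iff.mpr (Φ.coeff_zero_chi_ne_zero_iff.mpr h0)
  rw [← hM, laurentEval_eq_evalUnit_matrix]
  obtain ⟨a, b, hab⟩ := hq.pow_left (m := Φ.s)
  have h1 : evalUnit (K := K) M (toLaurent Φ.p ^ Φ.s) = 0 := by
    rw [← map_pow, evalUnit_toLaurent, hM]
    have := Matrix.aeval_self_charpoly Φ.mat
    rwa [FrobeniusBlock.charpoly_mat] at this
  refine IsUnit.of_mul_eq_one_right (evalUnit M b) ?_
  have := congrArg (evalUnit (K := K) M) hab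
  rwa [map_add, map_mul, map_mul, h1, mul_zero, zero_add, map_one] at this

namespace Summands

/-- An orthogonal decomposition of the submodule `U` into hyperbolic and cyclic summands. -/
structure IsDecomposition (D : Summands K) (ℓ : FrobeniusBlock K → K[T;T⁻¹] →ₗ[K] K)
    (F : V →ₗ⋆[K] V →ₗ[K] K) (U : Submodule K[T;T⁻¹] V)
    (C : Fin D.m ⊕ Fin D.l → Submodule K[T;T⁻¹] V) : Prop where
  hyperbolic : ∀ i, IsHyperbolicSubmodule F (toLaurent (D.block₁ i).chi) (C (Sum.inl i))
  cyclic : ∀ j, IsCyclicSubmodule F (toLaurent (D.block₂ j).chi)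
    (fun r => ℓ (D.block₂ j) (D.q j * r)) (C (Sum.inr j))
  orthogonal : ∀ s t, s ≠ t → ∀ x ∈ C s, ∀ y ∈ C t, F x y = 0
  iSup_eq : ⨆ t, C t = U

/-- The functionals `ℓ Φ` describe the forms `Φ_(ε)` on the blocks. -/
structure IsFunctionalFamily (ε : K)
    (c : (Φ : FrobeniusBlock K) → Matrix (Fin Φ.size) (Fin Φ.size) K)
    (ℓ : FrobeniusBlock K → K[T;T⁻¹] →ₗ[K] K) : Prop where
  isFrobenius : ∀ Φ : FrobeniusBlock K, Φ.HasForm ε → IsFrobenius (toLaurent Φ.chi) (ℓ Φ)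
  map_star : ∀ Φ : FrobeniusBlock K, Φ.HasForm ε →
    ∀ r, ℓ Φ (laurentStar r) = ε * star (ℓ Φ r)
  entry : ∀ Φ : FrobeniusBlock K, Φ.HasForm ε → ∀ (q : K[T;T⁻¹]) (i j : Fin Φ.size),
    (c Φ * laurentEval q Φ.mat) i j = ℓ Φ (q * LaurentPolynomial.T ((j : ℕ) - (i : ℕ) : ℤ))

theorem exists_isFunctionalFamily
    {c : (Φ : FrobeniusBlock K) → Matrix (Fin Φ.size) (Fin Φ.size) K}
    (hc : ∀ Φ : FrobeniusBlock K, Φ.HasForm ε → Φ.IsForm ε (c Φ)) :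
    ∃ ℓ, IsFunctionalFamily ε c ℓ := by
  have : ∀ Φ : FrobeniusBlock K, ∃ ℓ : K[T;T⁻¹] →ₗ[K] K, Φ.HasForm ε →
      IsFrobenius (toLaurent Φ.chi) ℓ ∧
      (∀ r, ℓ (laurentStar r) = ε * star (ℓ r)) ∧
      ∀ (q : K[T;T⁻¹]) (i j : Fin Φ.size), (c Φ * laurentEval q Φ.mat) i j =
        ℓ (q * LaurentPolynomial.T ((j : ℕ) - (i : ℕ) : ℤ)) := fun Φ => by
    by_cases h : Φ.HasForm ε
    · obtain ⟨ℓ, hℓ⟩ := (hc Φ h).exists_functional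
      exact ⟨ℓ, fun _ => hℓ⟩
    -- The conditions on the family concern only blocks that carry a form, so the value 0 elsewhere
    -- is harmless.
    · exact ⟨0, fun h' => absurd h' h⟩
  choose ℓ hℓ using this
  exact ⟨ℓ, fun Φ h => (hℓ Φ h).1, fun Φ h => (hℓ Φ h).2.1, fun Φ h => (hℓ Φ h).2.2⟩

variable {D : Summands K} {c : (Φ : FrobeniusBlock K) → Matrix (Fin Φ.size) (Fin Φ.size) K}
  {ℓ : FrobeniusBlock K → K[T;T⁻¹] →ₗ[K] K}

theorem sum_opMatrix_inl (b : D.Index → V) (i : Fin D.m)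
    (x : Fin (D.block₁ i).size ⊕ Fin (D.block₁ i).size) :
    ∑ k, D.opMatrix k (Sum.inl ⟨i, x⟩) • b k =
      ∑ y, Matrix.fromBlocks (D.block₁ i).mat 0 0 ((D.block₁ i).matᴴ)⁻¹ y x •
        b (Sum.inl ⟨i, y⟩) := by
  rw [Fintype.sum_sum_type]
  simp only [opMatrix, Matrix.fromBlocks_apply₁₁, Matrix.fromBlocks_apply₂₁, Matrix.zero_apply,
    zero_smul, Finset.sum_const_zero, add_zero]
  exact sum_blockDiagonal'_smul (fun i => Matrix.fromBlocks (D.block₁ i).mat 0 0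
    ((D.block₁ i).matᴴ)⁻¹) (fun p => b (Sum.inl p)) i x

theorem sum_opMatrix_inr (b : D.Index → V) (j : Fin D.l) (x : Fin (D.block₂ j).size) :
    ∑ k, D.opMatrix k (Sum.inr ⟨j, x⟩) • b k =
      ∑ y, (D.block₂ j).mat y x • b (Sum.inr ⟨j, y⟩) := by
  rw [Fintype.sum_sum_type]
  simp only [opMatrix, Matrix.fromBlocks_apply₁₂, Matrix.fromBlocks_apply₂₂, Matrix.zero_apply,
    zero_smul, Finset.sum_const_zero, zero_add]
  exact sum_blockDiagonal'_smul (fun j => (D.block₂ j).mat) (fun p => b (Sum.inr p)) j x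

theorem IsAdmissible.coeff_zero_ne_zero₁ (hD : D.IsAdmissible ε) (i : Fin D.m) :
    (D.block₁ i).chi.coeff 0 ≠ 0 := (D.block₁ i).isUnit_mat_iff.mp (hD.1 i).1

theorem IsAdmissible.coeff_zero_ne_zero₂ (hD : D.IsAdmissible ε) (j : Fin D.l) :
    (D.block₂ j).chi.coeff 0 ≠ 0 :=
  (D.block₂ j).coeff_zero_chi_ne_zero_iff.mpr (hD.2 j).1.coeff_zero_ne_zero

theorem isUnit_formMatrix (hD : D.IsAdmissible ε) (h2 : (2 : K) ≠ 0) (hε : ε * ε = 1)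
    (hc : ∀ Φ : FrobeniusBlock K, Φ.HasForm ε → Φ.IsForm ε (c Φ)) :
    IsUnit (D.formMatrix ε c) := by
  rw [formMatrix, Matrix.isUnit_fromBlocks_zero₂₁]
  refine ⟨isUnit_blockDiagonal' fun i => isUnit_hyperbolicMatrix hε _,
    isUnit_blockDiagonal' fun j => ?_⟩
  obtain ⟨h1, h3, h4⟩ := hD.2 j
  exact (hc _ h1).1.mul (FrobeniusBlock.isUnit_laurentEval h1.coeff_zero_ne_zero
    (FrobeniusBlock.isCoprime_toLaurent h2 h1.coeff_zero_ne_zero h3 h4))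

/-- With `IsDecomposition.represents`, a dictionary between matrix representations and orthogonal
decompositions: the basis vectors of one block of the direct sum span one summand. -/
theorem exists_isDecomposition_of_represents (hD : D.IsAdmissible ε)
    (hF : IsInvariantForm (laurentStar (K := K)) ε F)
    (hℓ : IsFunctionalFamily ε c ℓ) {A : V →ₗ[K] V}
    (hA : ∀ x, A x = (LaurentPolynomial.T 1 : K[T;T⁻¹]) • x) (h : D.Represents ε c A F) :
    ∃ C, D.IsDecomposition ℓ F ⊤ C := by
  obtain ⟨b, hb, hG⟩ := h
  have hT : ∀ k, (LaurentPolynomial.T 1 : K[T;T⁻¹]) • b k = ∑ i, D.opMatrix i k • b i := fun k => by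
    rw [← hA, ← hb, ← b.sum_repr (A (b k))]
    simp only [LinearMap.toMatrix_apply]
  have hf : ∀ k k', F (b k) (b k') = D.formMatrix ε c k k' := fun k k' => by rw [← hG]; rfl
  have hU : ∀ i, ∃ U : Submodule K[T;T⁻¹] V,
      IsHyperbolicSubmodule F (toLaurent (D.block₁ i).chi) U ∧ U.restrictScalars K =
        Submodule.span K (Set.range (Sum.elim (fun x => b (Sum.inl ⟨i, Sum.inl x⟩))
          (fun x => b (Sum.inl ⟨i, Sum.inr x⟩)))) := by
    intro i
    apply FrobeniusBlock.isHyperbolicSubmodule_of_mat hF (hD.coeff_zero_ne_zero₁ i)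
    · intro x
      rw [hT, sum_opMatrix_inl, Fintype.sum_sum_type]
      simp
    · intro x
      rw [hT, sum_opMatrix_inl, Fintype.sum_sum_type]
      simp
    all_goals
      intro x y
      rw [hf]
      simp [formMatrix, Matrix.blockDiagonal'_apply_eq, Matrix.one_apply]
  have hW : ∀ j, ∃ U : Submodule K[T;T⁻¹] V,
      IsCyclicSubmodule F (toLaurent (D.block₂ j).chi)
        (fun r => ℓ (D.block₂ j) (D.q j * r)) U ∧ U.restrictScalars K =
        Submodule.span K (Set.range (fun x => b (Sum.inr ⟨j, x⟩))) := by
    intro j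
    apply FrobeniusBlock.isCyclicSubmodule_of_mat (hD.coeff_zero_ne_zero₂ j)
      (hℓ.isFrobenius _ (hD.2 j).1)
    · intro x
      rw [hT, sum_opMatrix_inr]
    · intro x y
      rw [hf, ← hℓ.entry _ (hD.2 j).1, formMatrix, Matrix.fromBlocks_apply₂₂,
        Matrix.blockDiagonal'_apply_eq]
  choose U hU hU' using hU
  choose W hW hW' using hW
  have hUmem : ∀ i x, x ∈ U i → x ∈ Submodule.span K (Set.range (Sum.elim
      (fun x => b (Sum.inl ⟨i, Sum.inl x⟩)) (fun x => b (Sum.inl ⟨i, Sum.inr x⟩)))) :=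
    fun i x hx => hU' i ▸ hx
  have hWmem : ∀ j x, x ∈ W j → x ∈ Submodule.span K (Set.range (fun x => b (Sum.inr ⟨j, x⟩))) :=
    fun j x hx => hW' j ▸ hx
  have hUb : ∀ i x, b (Sum.inl ⟨i, x⟩) ∈ U i := fun i x => by
    rw [← Submodule.restrictScalars_mem K, hU']
    apply Submodule.subset_span
    rcases x with x | x
    · exact ⟨Sum.inl x, rfl⟩
    · exact ⟨Sum.inr x, rfl⟩
  have hWb : ∀ j x, b (Sum.inr ⟨j, x⟩) ∈ W j := fun j x => by
    rw [← Submodule.restrictScalars_mem K, hW']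
    exact Submodule.subset_span ⟨x, rfl⟩
  refine ⟨Sum.elim U W, hU, hW, ?_, ?_⟩
  · rintro (i | j) (i' | j') hne x hx y hy
    · have hne' : i ≠ i' := fun h => hne (congrArg _ h)
      refine apply_eq_zero_of_mem_span ?_ (hUmem i x hx) (hUmem i' y hy)
      rintro (k | k) (k' | k') <;>
        simp [hf, formMatrix, Matrix.blockDiagonal'_apply_ne _ _ _ hne']
    · refine apply_eq_zero_of_mem_span ?_ (hUmem i x hx) (hWmem j' y hy)
      rintro (k | k) k' <;> simp [hf, formMatrix]
    · refine apply_eq_zero_of_mem_span ?_ (hWmem j x hx) (hUmem i' y hy)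
      rintro k (k' | k') <;> simp [hf, formMatrix]
    · have hne' : j ≠ j' := fun h => hne (congrArg _ h)
      refine apply_eq_zero_of_mem_span ?_ (hWmem j x hx) (hWmem j' y hy)
      intro k k'
      rw [hf, formMatrix, Matrix.fromBlocks_apply₂₂, Matrix.blockDiagonal'_apply_ne _ _ _ hne']
  · rw [eq_top_iff]
    have : Submodule.span K (Set.range b) ≤
        (⨆ t, (Sum.elim U W) t : Submodule K[T;T⁻¹] V).restrictScalars K := by
      rw [Submodule.span_le]
      rintro _ ⟨⟨i, x⟩ | ⟨j, x⟩, rfl⟩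
      · exact (le_iSup (Sum.elim U W) (Sum.inl i)) (hUb i x)
      · exact (le_iSup (Sum.elim U W) (Sum.inr j)) (hWb j x)
    intro x _
    exact this (b.span_eq ▸ Submodule.mem_top)

theorem IsDecomposition.represents (hD : D.IsAdmissible ε) (h2 : (2 : K) ≠ 0) (hε : ε * ε = 1)
    (hF : IsInvariantForm (laurentStar (K := K)) ε F)
    (hc : ∀ Φ : FrobeniusBlock K, Φ.HasForm ε → Φ.IsForm ε (c Φ))
    (hℓ : IsFunctionalFamily ε c ℓ) {A : V →ₗ[K] V} {C : Fin D.m ⊕ Fin D.l → Submodule K[T;T⁻¹] V}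
    (hA : ∀ x, A x = (LaurentPolynomial.T 1 : K[T;T⁻¹]) • x) (h : D.IsDecomposition ℓ F ⊤ C) :
    D.Represents ε c A F := by
  choose b b' hb hb' hbb hbb' hb'b hbU using fun i =>
    FrobeniusBlock.exists_mat_of_isHyperbolicSubmodule hF (hD.coeff_zero_ne_zero₁ i)
      (h.hyperbolic i)
  choose d hd hdF hdU using fun j =>
    FrobeniusBlock.exists_mat_of_isCyclicSubmodule hF (hD.coeff_zero_ne_zero₂ j) (h.cyclic j)
  have hbm : ∀ i x, Sum.elim (b i) (b' i) x ∈ C (Sum.inl i) := fun i x => by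
    rw [← Submodule.restrictScalars_mem K, hbU]
    exact Submodule.subset_span ⟨x, rfl⟩
  have hdm : ∀ j x, d j x ∈ C (Sum.inr j) := fun j x => by
    rw [← Submodule.restrictScalars_mem K, hdU]
    exact Submodule.subset_span ⟨x, rfl⟩
  have hbb'' : ∀ i x y, F (b i x) (b' i y) = if x = y then ε else 0 := fun i x y => by
    rw [hF.symm, hb'b]
    simp only [eq_comm (a := y)]
    split_ifs <;> simp
  let e : D.Index → V := Sum.elim (fun k => Sum.elim (b k.1) (b' k.1) k.2) (fun k => d k.1 k.2)
  have heF : (Matrix.of fun i j => F (e i) (e j)) = D.formMatrix ε c := by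
    ext k k'
    rw [Matrix.of_apply]
    rcases k with ⟨i, x⟩ | ⟨j, x⟩ <;> rcases k' with ⟨i', x'⟩ | ⟨j', x'⟩
    · rcases eq_or_ne i i' with rfl | hne
      · rw [formMatrix, Matrix.fromBlocks_apply₁₁, Matrix.blockDiagonal'_apply_eq]
        rcases x with x | x <;> rcases x' with x' | x' <;>
          simp [e, hbb, hbb', hb'b, hbb'', Matrix.one_apply]
      · rw [formMatrix, Matrix.fromBlocks_apply₁₁, Matrix.blockDiagonal'_apply_ne _ _ _ hne]
        exact h.orthogonal _ _ (fun h => hne (Sum.inl_injective h)) _ (hbm i x) _ (hbm i' x')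
    · rw [formMatrix, Matrix.fromBlocks_apply₁₂, Matrix.zero_apply]
      exact h.orthogonal _ _ (by simp) _ (hbm i x) _ (hdm j' x')
    · rw [formMatrix, Matrix.fromBlocks_apply₂₁, Matrix.zero_apply]
      exact h.orthogonal _ _ (by simp) _ (hdm j x) _ (hbm i' x')
    · rcases eq_or_ne j j' with rfl | hne
      · rw [formMatrix, Matrix.fromBlocks_apply₂₂, Matrix.blockDiagonal'_apply_eq,
          hℓ.entry _ (hD.2 j).1, ← hdF]
        rfl
      · rw [formMatrix, Matrix.fromBlocks_apply₂₂, Matrix.blockDiagonal'_apply_ne _ _ _ hne]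
        exact h.orthogonal _ _ (fun h => hne (Sum.inr_injective h)) _ (hdm j x) _ (hdm j' x')
  have heA : ∀ k, A (e k) = ∑ i, D.opMatrix i k • e i := by
    rintro (⟨i, x⟩ | ⟨j, x⟩)
    · rw [sum_opMatrix_inl, Fintype.sum_sum_type, hA]
      rcases x with x | x
      · simp [e, hb]
      · simp [e, hb']
    · rw [sum_opMatrix_inr, hA]
      exact hd j x
  have hspan : ⊤ ≤ Submodule.span K (Set.range e) := by
    have hC : ∀ t, ∀ x ∈ C t, x ∈ Submodule.span K (Set.range e) := by
      rintro (i | j) x hx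
      · rw [← Submodule.restrictScalars_mem K, hbU] at hx
        refine Submodule.span_mono ?_ hx
        rintro _ ⟨y, rfl⟩
        exact ⟨Sum.inl ⟨i, y⟩, rfl⟩
      · rw [← Submodule.restrictScalars_mem K, hdU] at hx
        refine Submodule.span_mono ?_ hx
        rintro _ ⟨y, rfl⟩
        exact ⟨Sum.inr ⟨j, y⟩, rfl⟩
    intro x _
    have hx : x ∈ ⨆ t, C t := h.iSup_eq ▸ Submodule.mem_top
    induction hx using Submodule.iSup_induction' with
    | mem t x hx => exact hC t x hx
    | zero => exact Submodule.zero_mem _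
    | add x y _ _ hx hy => exact Submodule.add_mem _ (hx trivial) (hy trivial)
  -- Linear independence comes from the nonsingular Gram matrix, so no count of dimensions is
  -- required.
  obtain ⟨B, hB, hBA⟩ := exists_basis_of_isUnit (F := F) (b := e)
    (heF ▸ isUnit_formMatrix hD h2 hε hc) hspan heA
  exact ⟨B, hBA, by simp only [hB]; exact heF⟩

end Summands

end IsometricPairs

/-! ### Existence: finding one summand and splitting it off. -/

namespace IsometricPairs

open Polynomial
open scoped LaurentPolynomial Matrix

variable {K : Type*} [Field K] [StarRing K] {V : Type*} [AddCommGroup V] [Module K V]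
  [Module K[T;T⁻¹] V] [IsScalarTower K K[T;T⁻¹] V] {F : V →ₗ⋆[K] V →ₗ[K] K} {ε : K}

namespace FrobeniusBlock

variable {Φ : FrobeniusBlock K}

theorem toLaurent_chi (Φ : FrobeniusBlock K) : toLaurent Φ.chi = toLaurent Φ.p ^ Φ.s :=
  map_pow _ _ _

theorem toLaurent_p_ne_zero (Φ : FrobeniusBlock K) : toLaurent Φ.p ≠ 0 :=
  Polynomial.toLaurent_ne_zero.mpr Φ.monic.ne_zero

theorem not_dvd_one (h0 : Φ.p.coeff 0 ≠ 0) : ¬ toLaurent Φ.p ∣ 1 := fun h =>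
  (isMaximal_span_toLaurent Φ.irreducible h0).ne_top
    (Ideal.span_singleton_eq_top.mpr (isUnit_of_dvd_one h))

theorem HasForm.associated (h : Φ.HasForm ε) :
    Associated (laurentStar (toLaurent Φ.p)) (toLaurent Φ.p) := by
  have := associated_laurentStar h.coeff_zero_ne_zero
  rwa [← h.p_eq_vee] at this

end FrobeniusBlock

theorem iSup_fin_cons {α : Type*} [CompleteLattice α] {n : ℕ} (a : α) (f : Fin n → α) :
    ⨆ i, (Fin.cons a f : Fin (n + 1) → α) i = a ⊔ ⨆ i, f i := by
  apply le_antisymm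
  · refine iSup_le (Fin.cases le_sup_left fun i => ?_)
    rw [Fin.cons_succ]
    exact (le_iSup f i).trans le_sup_right
  · refine sup_le (le_iSup (Fin.cons a f : Fin (n + 1) → α) 0) (iSup_le fun i => ?_)
    exact le_iSup (Fin.cons a f : Fin (n + 1) → α) i.succ

/-- In a nonzero space with a nondegenerate form there are a vector annihilated by a power of an
irreducible polynomial and a vector that pairs with it. -/
theorem exists_block_pairing [FiniteDimensional K V] [Nontrivial V]
    (hF : IsInvariantForm (laurentStar (K := K)) ε F)
    (hnd : ∀ x, (∀ y, F x y = 0) → x = 0) :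
    ∃ (Φ : FrobeniusBlock K) (k : ℕ) (v w : V), Φ.p.coeff 0 ≠ 0 ∧ Φ.s = k + 1 ∧
      toLaurent Φ.p ^ (k + 1) • v = 0 ∧ laurentStar (toLaurent Φ.p ^ (k + 1)) • w = 0 ∧
      F w (toLaurent Φ.p ^ k • v) ≠ 0 := by
  have hσ := isInvolution_laurentStar K
  let a : V →ₗ[K] V := Algebra.lsmul K K V (LaurentPolynomial.T 1 : K[T;T⁻¹])
  have ha : ∀ (f : K[X]) (x : V), toLaurent f • x = aeval a f x := fun f x => by
    rw [aeval_algHom_apply, Algebra.lsmul_coe]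
    congr 1
    have h := aeval_algHom_apply (toLaurentAlg (R := K)) X f
    rw [aeval_X_left_apply, toLaurentAlg_apply, toLaurentAlg_apply, toLaurent_X] at h
    exact h.symm
  have hinj : Function.Injective a := by
    intro x y hxy
    have := congrArg ((LaurentPolynomial.T (-1) : K[T;T⁻¹]) • ·) hxy
    simpa only [a, Algebra.lsmul_coe, T_smul_T_smul, neg_add_cancel, LaurentPolynomial.T_zero,
      one_smul] using this
  have hintegral : IsIntegral K a := Algebra.IsIntegral.isIntegral a
  have hμ0 := LinearMap.minpoly_coeff_zero_of_injective hinj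
  obtain ⟨p, hpm, hpi, hpd⟩ := exists_monic_irreducible_factor (minpoly K a)
    (minpoly.not_isUnit K a)
  -- The minimal polynomial is written as p^(k+1)·m with m prime to p. As pᵏm does not annihilate V,
  -- some vector mx is killed by p^(k+1) and not by pᵏ.
  obtain ⟨m, hμ, hm⟩ := (finiteMultiplicity_of_degree_pos_of_monic
    (degree_pos_of_irreducible hpi) hpm (minpoly.ne_zero hintegral)).exists_eq_pow_mul_and_not_dvd
  generalize multiplicity p (minpoly K a) = s at hμ
  obtain ⟨k, rfl⟩ : ∃ k, s = k + 1 := by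
    refine Nat.exists_eq_succ_of_ne_zero ?_
    rintro rfl
    rw [pow_zero, one_mul] at hμ
    exact hm (hμ ▸ hpd)
  have h0 : p.coeff 0 ≠ 0 := by
    intro h
    apply hμ0
    rw [hμ, mul_coeff_zero, pow_succ, mul_coeff_zero, h, mul_zero, zero_mul]
  have hmin : aeval a (p ^ k * m) ≠ 0 := by
    intro h
    have := minpoly.dvd K a h
    rw [hμ, pow_succ, mul_assoc] at this
    have := (mul_dvd_mul_iff_left (pow_ne_zero k hpm.ne_zero)).mp this
    have hm0 : m ≠ 0 := by
      rintro rfl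
      exact hm (dvd_zero _)
    have h1 : p * m ∣ 1 * m := by rwa [one_mul]
    exact hpi.not_isUnit (isUnit_of_dvd_one ((mul_dvd_mul_iff_right hm0).mp h1))
  obtain ⟨x, hx⟩ : ∃ x, aeval a (p ^ k * m) x ≠ 0 := by
    by_contra! h
    exact hmin (LinearMap.ext h)
  rw [← ha, map_mul, mul_smul, map_pow] at hx
  have hkill : ∀ y : V, toLaurent p ^ (k + 1) • toLaurent m • y = 0 := fun y => by
    rw [← map_pow, smul_smul, ← map_mul, ha, ← hμ, minpoly.aeval, LinearMap.zero_apply]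
  obtain ⟨w₀, hw₀⟩ : ∃ w₀, F w₀ (toLaurent p ^ k • toLaurent m • x) ≠ 0 := by
    by_contra! h
    exact hx (hnd _ fun y => hF.eq_zero_comm (h y))
  have hcop : IsCoprime (toLaurent p ^ (k + 1)) (toLaurent m) := by
    have := ((dvd_or_isCoprime (isMaximal_span_toLaurent hpi h0) (toLaurent m)).resolve_left
      fun h => hm ((toLaurent_dvd_toLaurent_iff h0).mp h))
    exact this.pow_left
  obtain ⟨α, β, hαβ⟩ := hcop
  -- βm is 1 modulo p^(k+1), and p^(k+1)βm annihilates V. So the adjoint σ(βm) moves w₀ to a vector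
  -- killed by σ(p^(k+1)) without changing its pairing with pᵏmx.
  refine ⟨⟨p, k + 1, hpm, hpi, k.succ_pos⟩, k, toLaurent m • x, laurentStar (β * toLaurent m) • w₀,
    h0, rfl, hkill x, ?_, ?_⟩
  · refine hnd _ fun y => ?_
    rw [hF.adjoint, hσ.apply_apply, hF.adjoint, hσ.apply_apply]
    have : (β * toLaurent m) • toLaurent p ^ (k + 1) • y = 0 := by
      rw [smul_smul, mul_assoc, mul_smul, mul_comm, mul_smul, hkill, smul_zero]
    rw [this, map_zero]
  · rw [hF.adjoint, hσ.apply_apply]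
    have : (β * toLaurent m) • toLaurent p ^ k • toLaurent m • x =
        toLaurent p ^ k • toLaurent m • x := by
      have h1 : β * toLaurent m = 1 - α * toLaurent p ^ (k + 1) := by rw [← hαβ]; ring
      rw [h1, sub_smul, one_smul, mul_smul, smul_comm (toLaurent p ^ (k + 1)) (toLaurent p ^ k),
        hkill, smul_zero, smul_zero, sub_zero]
    rw [this]
    exact hw₀

/-- A nonzero space with a nondegenerate form contains one of the summands of the canonical
form. -/
theorem exists_summand [FiniteDimensional K V] [Nontrivial V]
    (hF : IsInvariantForm (laurentStar (K := K)) ε F)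
    (hnd : ∀ x, (∀ y, F x y = 0) → x = 0) (h2 : (2 : K) ≠ 0) (hε : ε ≠ 0)
    {c : (Φ : FrobeniusBlock K) → Matrix (Fin Φ.size) (Fin Φ.size) K}
    {ℓ : FrobeniusBlock K → K[T;T⁻¹] →ₗ[K] K} (hℓ : Summands.IsFunctionalFamily ε c ℓ) :
    (∃ Φ : FrobeniusBlock K, IsUnit Φ.mat ∧ ¬ Φ.HasForm ε ∧
      ∃ w w', IsHyperbolic laurentStar F (toLaurent Φ.chi) w w') ∨
    (∃ (Φ : FrobeniusBlock K) (q : K[T;T⁻¹]), Φ.HasForm ε ∧ q ≠ 0 ∧ IsStationaryForm Φ.p q ∧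
      ∃ y, IsCyclicForm F (toLaurent Φ.chi) (fun r => ℓ Φ (q * r)) y) := by
  have hσ := isInvolution_laurentStar K
  obtain ⟨Φ, k, v, w, h0, hs, hv, hw, hwv⟩ := exists_block_pairing hF hnd
  have hchi : toLaurent Φ.chi = toLaurent Φ.p ^ (k + 1) := by rw [Φ.toLaurent_chi, hs]
  have hmax := isMaximal_span_toLaurent Φ.irreducible h0
  have h0' := Φ.coeff_zero_chi_ne_zero_iff.mpr h0
  have hfd : FiniteDimensional K (K[T;T⁻¹] ⧸ Ideal.span {toLaurent Φ.p ^ (k + 1)}) := by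
    rw [← hchi]
    exact finiteDimensional_quotient_toLaurent h0'
  have hw' : laurentStar (toLaurent Φ.p) ∣ toLaurent Φ.p → toLaurent Φ.p ^ (k + 1) • w = 0 := by
    intro h
    obtain ⟨u, hu⟩ := pow_dvd_pow_of_dvd h (k + 1)
    rw [hu, ← map_pow, mul_comm, mul_smul, hw, smul_zero]
  by_cases hform : Φ.HasForm ε
  · refine Or.inr ⟨Φ, ?_⟩
    have hfrob := hℓ.isFrobenius Φ hform
    rw [hchi] at hfrob ⊢
    have hpσ := hform.associated.symm.dvd
    obtain ⟨y, hy, r, hr⟩ := hF.exists_anisotropic hσ h2 hε Φ.toLaurent_p_ne_zero hmax hpσ hfrob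
      (hℓ.map_star Φ hform) hv (hw' hform.associated.dvd) hwv
    obtain ⟨n, hn, hnσ⟩ := hF.exists_eq_mul hσ hfrob (hℓ.map_star Φ hform) hy
    have hpn : ¬ toLaurent Φ.p ∣ n := by
      rintro ⟨n', rfl⟩
      apply hr
      rw [hn, show toLaurent Φ.p * n' * (toLaurent Φ.p ^ k * r) =
        toLaurent Φ.p ^ (k + 1) * (n' * r) by ring, hfrob.map_mul_eq_zero]
    -- n is fixed by σ modulo p^(k+1), so its residue is a symmetric element and has a stationary
    -- representative.
    obtain ⟨q, hq, hqz⟩ := exists_isStationaryForm h2 Φ.monic hform.p_eq_vee h0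
      (z := evalUnit (rootUnit h0) n) (by
        rw [circ_evalUnit, eq_comm, ← sub_eq_zero, ← map_sub, evalUnit_rootUnit_eq_zero_iff]
        exact (dvd_pow_self _ k.succ_ne_zero).trans hnσ)
    rw [← sub_eq_zero, ← map_sub, evalUnit_rootUnit_eq_zero_iff] at hqz
    refine ⟨q, hform, ?_, hq, hF.exists_isCyclicForm h2 hpσ hfrob hy hn hnσ
      ((dvd_or_isCoprime hmax n).resolve_left hpn) hq.laurentStar_eq hqz⟩
    rintro rfl
    rw [zero_sub, dvd_neg] at hqz
    exact hpn hqz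
  · refine Or.inl ⟨Φ, Φ.isUnit_mat_iff.mpr h0', hform, ?_⟩
    rw [hchi]
    by_cases hpσ : toLaurent Φ.p ∣ laurentStar (toLaurent Φ.p)
    -- A nonzero value F(v, pᵏrv) would make r ↦ F(v, rv) a generating functional, and the block
    -- would carry a form.
    · refine hF.exists_isHyperbolic hσ h2 hmax hpσ hv (hw' (hσ.dvd_iff.mpr hpσ)) (fun r => ?_) hwv
      by_contra hr
      refine hform (FrobeniusBlock.hasForm_of_isFrobenius hF h0' (y := v) ?_ ?_)
      · rw [hchi, hv]
      · rw [hchi]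
        refine isFrobenius_of_ne_zero hmax (fun t => ?_) (r₀ := r) hr
        rw [coefficientFunctional_apply, mul_comm, mul_smul, hv, smul_zero, map_zero]
    -- Here p and σ(p) are coprime. On v, killed by p^(k+1), each r acts as a multiple of
    -- σ(p^(k+1)), whose adjoint kills v again. So v is isotropic, and likewise w.
    · have hcop : IsCoprime (toLaurent Φ.p ^ (k + 1)) (laurentStar (toLaurent Φ.p ^ (k + 1))) := by
        rw [map_pow]
        exact ((dvd_or_isCoprime hmax _).resolve_left hpσ).pow
      obtain ⟨α, β, hαβ⟩ := hcop
      have hfrob : IsFrobenius (toLaurent Φ.p ^ (k + 1))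
          (coefficientFunctional K[T;T⁻¹] F w v) := by
        refine isFrobenius_of_ne_zero hmax (fun t => ?_) (r₀ := 1) ?_
        · rw [coefficientFunctional_apply, mul_comm, mul_smul, hv, smul_zero, map_zero]
        · rwa [coefficientFunctional_apply, mul_one]
      refine ⟨v, w, fun r => ?_, fun r => ?_, hv, hw, hfrob.dvd⟩
      · have h1 : r • v = laurentStar (toLaurent Φ.p ^ (k + 1)) • (β * r) • v := by
          have h3 : r = r * (α * toLaurent Φ.p ^ (k + 1)) +
              laurentStar (toLaurent Φ.p ^ (k + 1)) * (β * r) := by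
            linear_combination (-r) * hαβ
          conv_lhs => rw [h3]
          rw [add_smul, mul_smul, mul_smul, hv, smul_zero, smul_zero, zero_add, mul_smul]
        rw [h1, ← hF.adjoint, hv, map_zero, LinearMap.zero_apply]
      · have h1 : r • w = toLaurent Φ.p ^ (k + 1) • (α * r) • w := by
          have h3 : r = r * (β * laurentStar (toLaurent Φ.p ^ (k + 1))) +
              toLaurent Φ.p ^ (k + 1) * (α * r) := by
            linear_combination (-r) * hαβ
          conv_lhs => rw [h3]
          rw [add_smul, mul_smul, mul_smul, hw, smul_zero, smul_zero, zero_add, mul_smul]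
        rw [h1, hF.adjoint' hσ, hw, map_zero, LinearMap.zero_apply]

namespace Summands

variable {D : Summands K} {ℓ : FrobeniusBlock K → K[T;T⁻¹] →ₗ[K] K}
  {U W : Submodule K[T;T⁻¹] V} {C : Fin D.m ⊕ Fin D.l → Submodule K[T;T⁻¹] V}

/-- The list of summands with a summand of the first type added. -/
def consHyperbolic (D : Summands K) (Φ : FrobeniusBlock K) : Summands K :=
  ⟨D.m + 1, Fin.cons Φ D.block₁, D.l, D.block₂, D.q⟩

/-- The list of summands with a summand of the second type added. -/
def consCyclic (D : Summands K) (Φ : FrobeniusBlock K) (q : K[T;T⁻¹]) : Summands K :=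
  ⟨D.m, D.block₁, D.l + 1, Fin.cons Φ D.block₂, Fin.cons q D.q⟩

theorem IsDecomposition.le (h : D.IsDecomposition ℓ F U C) (t : Fin D.m ⊕ Fin D.l) : C t ≤ U :=
  (le_iSup C t).trans h.iSup_eq.le

theorem IsDecomposition.consHyperbolic (h : D.IsDecomposition ℓ F U C)
    (hF : IsInvariantForm (laurentStar (K := K)) ε F) {Φ : FrobeniusBlock K}
    (hW : IsHyperbolicSubmodule F (toLaurent Φ.chi) W) (hUW : U ≤ hF.orth W) :
    ∃ C', (D.consHyperbolic Φ).IsDecomposition ℓ F (W ⊔ U) C' := by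
  refine ⟨Sum.elim (Fin.cons W (C ∘ Sum.inl)) (C ∘ Sum.inr), ?_, h.cyclic, ?_, ?_⟩
  · exact Fin.cases hW h.hyperbolic
  · have h1 : ∀ t, ∀ x ∈ W, ∀ y ∈ C t, F x y = 0 := fun t x hx y hy => hUW (h.le t hy) x hx
    have h2 : ∀ t, ∀ x ∈ C t, ∀ y ∈ W, F x y = 0 := fun t x hx y hy =>
      hF.eq_zero_comm (h1 t y hy x hx)
    rintro (i | j) (i' | j') hne
    · induction i using Fin.cases with
      | zero =>
        induction i' using Fin.cases with
        | zero => exact absurd rfl hne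
        | succ i' => exact h1 (Sum.inl i')
      | succ i =>
        induction i' using Fin.cases with
        | zero => exact h2 (Sum.inl i)
        | succ i' =>
          exact h.orthogonal _ _ fun h => hne (congrArg (Sum.inl ∘ Fin.succ) (Sum.inl_injective h))
    · induction i using Fin.cases with
      | zero => exact h1 (Sum.inr j')
      | succ i => exact h.orthogonal (Sum.inl i) (Sum.inr j') (by simp)
    · induction i' using Fin.cases with
      | zero => exact h2 (Sum.inr j)
      | succ i' => exact h.orthogonal (Sum.inr j) (Sum.inl i') (by simp)
    · exact h.orthogonal (Sum.inr j) (Sum.inr j') fun h => hne (congrArg _ (Sum.inr_injective h))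
  · rw [iSup_sum, ← h.iSup_eq, iSup_sum, ← sup_assoc]
    congr 1
    exact iSup_fin_cons _ _

theorem IsDecomposition.consCyclic (h : D.IsDecomposition ℓ F U C)
    (hF : IsInvariantForm (laurentStar (K := K)) ε F) {Φ : FrobeniusBlock K} {q : K[T;T⁻¹]}
    (hW : IsCyclicSubmodule F (toLaurent Φ.chi) (fun r => ℓ Φ (q * r)) W) (hUW : U ≤ hF.orth W) :
    ∃ C', (D.consCyclic Φ q).IsDecomposition ℓ F (W ⊔ U) C' := by
  refine ⟨Sum.elim (C ∘ Sum.inl) (Fin.cons W (C ∘ Sum.inr)), h.hyperbolic, ?_, ?_, ?_⟩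
  · exact Fin.cases hW h.cyclic
  · have h1 : ∀ t, ∀ x ∈ W, ∀ y ∈ C t, F x y = 0 := fun t x hx y hy => hUW (h.le t hy) x hx
    have h2 : ∀ t, ∀ x ∈ C t, ∀ y ∈ W, F x y = 0 := fun t x hx y hy =>
      hF.eq_zero_comm (h1 t y hy x hx)
    rintro (i | j) (i' | j') hne
    · exact h.orthogonal (Sum.inl i) (Sum.inl i') fun h => hne (congrArg _ (Sum.inl_injective h))
    · induction j' using Fin.cases with
      | zero => exact h2 (Sum.inl i)
      | succ j' => exact h.orthogonal (Sum.inl i) (Sum.inr j') (by simp)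
    · induction j using Fin.cases with
      | zero => exact h1 (Sum.inl i')
      | succ j => exact h.orthogonal (Sum.inr j) (Sum.inl i') (by simp)
    · induction j using Fin.cases with
      | zero =>
        induction j' using Fin.cases with
        | zero => exact absurd rfl hne
        | succ j' => exact h1 (Sum.inr j')
      | succ j =>
        induction j' using Fin.cases with
        | zero => exact h2 (Sum.inr j)
        | succ j' =>
          exact h.orthogonal _ _ fun h => hne (congrArg (Sum.inr ∘ Fin.succ) (Sum.inr_injective h))
  · rw [iSup_sum, ← h.iSup_eq, iSup_sum, sup_left_comm]
    congr 1
    exact iSup_fin_cons _ _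

theorem _root_.IsometricPairs.IsHyperbolicSubmodule.nondegenerateOn
    (hF : IsInvariantForm (laurentStar (K := K)) ε F) {g : K[T;T⁻¹]}
    (h : IsHyperbolicSubmodule F g W) : NondegenerateOn F W := by
  obtain ⟨w, w', hw, rfl⟩ := h
  exact hw.nondegenerateOn hF (isInvolution_laurentStar K)

theorem _root_.IsometricPairs.isFrobenius_mul {g q : K[T;T⁻¹]} {φ : K[T;T⁻¹] →ₗ[K] K}
    (hφ : IsFrobenius g φ) (hq : IsCoprime g q) :
    IsFrobenius g (φ ∘ₗ LinearMap.mulLeft K q) where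
  map_mul_eq_zero r := by
    rw [LinearMap.comp_apply, LinearMap.mulLeft_apply, mul_left_comm, hφ.map_mul_eq_zero]
  dvd r hr := by
    refine hq.dvd_of_dvd_mul_left (hφ.dvd _ fun t => ?_)
    have := hr t
    rwa [LinearMap.comp_apply, LinearMap.mulLeft_apply, mul_left_comm] at this

theorem _root_.IsometricPairs.IsCyclicForm.nondegenerateOn_of_isStationaryForm
    (hF : IsInvariantForm (laurentStar (K := K)) ε F)
    (h2 : (2 : K) ≠ 0) {Φ : FrobeniusBlock K} (hΦ : Φ.HasForm ε)
    {φ : K[T;T⁻¹] →ₗ[K] K} (hφ : IsFrobenius (toLaurent Φ.chi) φ) {q : K[T;T⁻¹]}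
    (hq0 : q ≠ 0) (hq : IsStationaryForm Φ.p q) {y : V}
    (h : IsCyclicForm F (toLaurent Φ.chi) (fun r => φ (q * r)) y) :
    NondegenerateOn F (Submodule.span K[T;T⁻¹] {y}) ∧
      ∀ r : K[T;T⁻¹], r • y = 0 → toLaurent Φ.chi ∣ r := by
  have hfrob : IsFrobenius (toLaurent Φ.chi) (φ ∘ₗ LinearMap.mulLeft K q) := by
    refine isFrobenius_mul hφ ?_
    rw [Φ.toLaurent_chi]
    exact (FrobeniusBlock.isCoprime_toLaurent h2 hΦ.coeff_zero_ne_zero hq0 hq).pow_left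
  refine ⟨IsCyclicForm.nondegenerateOn (ℓ := φ ∘ₗ LinearMap.mulLeft K q) h hF
    (isInvolution_laurentStar K) hfrob, fun r hr => hfrob.dvd r fun t => ?_⟩
  rw [LinearMap.comp_apply, LinearMap.mulLeft_apply]
  have := h.apply_smul (t * r)
  rwa [mul_smul, hr, smul_zero, map_zero, eq_comm] at this

/-- Induction on the dimension of U: a nondegenerate summand W from `exists_summand` leaves U ∩ W^⊥,
which is smaller and again nondegenerate. -/
theorem exists_isDecomposition [FiniteDimensional K V]
    (hF : IsInvariantForm (laurentStar (K := K)) ε F) (h2 : (2 : K) ≠ 0) (hε : ε ≠ 0)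
    {c : (Φ : FrobeniusBlock K) → Matrix (Fin Φ.size) (Fin Φ.size) K}
    (hℓ : IsFunctionalFamily ε c ℓ) (U : Submodule K[T;T⁻¹] V) (hU : NondegenerateOn F U) :
    ∃ (D : Summands K) (C : Fin D.m ⊕ Fin D.l → Submodule K[T;T⁻¹] V),
      D.IsAdmissible ε ∧ D.IsDecomposition ℓ F U C := by
  obtain ⟨n, hn⟩ : ∃ n, Module.finrank K (U.restrictScalars K) = n := ⟨_, rfl⟩
  induction n using Nat.strong_induction_on generalizing U with
  | _ n ih =>
    subst hn
    by_cases hbot : U = ⊥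
    · subst hbot
      refine ⟨⟨0, Fin.elim0, 0, Fin.elim0, Fin.elim0⟩, fun _ => ⊥,
        ⟨fun i => i.elim0, fun j => j.elim0⟩, fun i => i.elim0, fun j => j.elim0, ?_, by simp⟩
      rintro (i | j)
      · exact i.elim0
      · exact j.elim0
    have hcompl : ∀ W ≤ U, NondegenerateOn F W → (∃ x ∈ W, x ≠ 0) →
        ∃ (D : Summands K) (C : Fin D.m ⊕ Fin D.l → Submodule K[T;T⁻¹] V),
          D.IsAdmissible ε ∧ D.IsDecomposition ℓ F (U ⊓ hF.orth W) C := by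
      rintro W hWU hW ⟨x, hx, hx0⟩
      refine ih _ ?_ (U ⊓ hF.orth W) ?_ rfl
      · apply Submodule.finrank_lt_finrank_of_lt
        -- A nonzero vector of W cannot be orthogonal to all of W.
        refine lt_of_le_of_ne (fun y hy => hy.1) fun h => hx0 ?_
        have hx' : x ∈ (U ⊓ hF.orth W).restrictScalars K := h ▸ hWU hx
        exact hW x hx fun y hy => hF.eq_zero_comm (hx'.2 y hy)
      -- Every y in U is a vector of W plus one of U ∩ W^⊥, and x is orthogonal to both.
      · rintro x ⟨hxU, hxW⟩ hx'
        refine hU x hxU fun y hy => ?_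
        obtain ⟨u, hu, hyu⟩ := hF.exists_add_eq hW y
        have h1 := hx' (y - u) ⟨U.sub_mem hy (hWU hu), hyu⟩
        rwa [map_sub, hF.eq_zero_comm (hxW u hu), sub_zero] at h1
    have hsup : ∀ W ≤ U, NondegenerateOn F W → W ⊔ (U ⊓ hF.orth W) = U := by
      intro W hWU hW
      refine le_antisymm (sup_le hWU inf_le_left) fun y hy => ?_
      obtain ⟨u, hu, hyu⟩ := hF.exists_add_eq hW y
      exact Submodule.mem_sup.mpr ⟨u, hu, y - u, ⟨U.sub_mem hy (hWU hu), hyu⟩, by abel⟩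
    have : Nontrivial U := (Submodule.nontrivial_iff_ne_bot).mpr hbot
    have : FiniteDimensional K U :=
      FiniteDimensional.of_injective (U.subtype.restrictScalars K) U.injective_subtype
    rcases exists_summand (hF.restrict U)
      (fun x hx => Subtype.ext (hU x x.2 fun y hy => hx ⟨y, hy⟩)) h2 hε hℓ with
      ⟨Φ, hΦ, hΦ', w, w', hw⟩ | ⟨Φ, q, hΦ, hq0, hq, y, hy⟩
    · have h0 := Φ.coeff_zero_chi_ne_zero_iff.mp (Φ.isUnit_mat_iff.mp hΦ)
      have hw₁ : IsHyperbolic laurentStar F (toLaurent Φ.chi) (w : V) (w' : V) :=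
        ⟨fun r => hw.isotropic r, fun r => hw.isotropic' r, congrArg Subtype.val hw.smul_eq_zero,
          congrArg Subtype.val hw.smul_eq_zero', fun r hr => hw.dvd r hr⟩
      have hW : IsHyperbolicSubmodule F (toLaurent Φ.chi)
        (Submodule.span K[T;T⁻¹] {(w : V), (w' : V)}) := ⟨w, w', hw₁, rfl⟩
      have hWU : Submodule.span K[T;T⁻¹] {(w : V), (w' : V)} ≤ U := by
        rw [Submodule.span_le]
        rintro _ (rfl | rfl)
        · exact w.2
        · exact w'.2
      have hWn := hW.nondegenerateOn hF
      obtain ⟨D, C, hD, hC⟩ := hcompl _ hWU hWn ⟨w, Submodule.subset_span (by simp), fun h => by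
        have h1 := hw₁.dvd_of_smul_eq_zero (r := 1) (by rw [h, smul_zero])
        refine FrobeniusBlock.not_dvd_one h0 ((dvd_pow_self _ Φ.s_pos.ne').trans ?_)
        rwa [Φ.toLaurent_chi] at h1⟩
      obtain ⟨C', hC'⟩ := hC.consHyperbolic hF hW inf_le_right
      rw [hsup _ hWU hWn] at hC'
      exact ⟨_, C', ⟨Fin.cases ⟨hΦ, hΦ'⟩ hD.1, hD.2⟩, hC'⟩
    · have h0 := hΦ.coeff_zero_ne_zero
      have hy₁ : IsCyclicForm F (toLaurent Φ.chi) (fun r => ℓ Φ (q * r)) (y : V) :=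
        ⟨congrArg Subtype.val hy.smul_eq_zero, fun r => hy.apply_smul r⟩
      have hWU : Submodule.span K[T;T⁻¹] {(y : V)} ≤ U := by
        rw [Submodule.span_le]
        rintro _ rfl
        exact y.2
      obtain ⟨hWn, hann⟩ := hy₁.nondegenerateOn_of_isStationaryForm hF h2 hΦ
        (hℓ.isFrobenius Φ hΦ) hq0 hq
      obtain ⟨D, C, hD, hC⟩ := hcompl _ hWU hWn ⟨y, Submodule.subset_span (by simp), fun h => by
        have h1 := hann 1 (by rw [h, smul_zero])
        refine FrobeniusBlock.not_dvd_one h0 ((dvd_pow_self _ Φ.s_pos.ne').trans ?_)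
        rwa [Φ.toLaurent_chi] at h1⟩
      obtain ⟨C', hC'⟩ := hC.consCyclic hF (Φ := Φ) (q := q) ⟨y, hy₁, rfl⟩ inf_le_right
      rw [hsup _ hWU hWn] at hC'
      exact ⟨_, C', ⟨hD.1, Fin.cases ⟨hΦ, hq0, hq⟩ hD.2⟩, hC'⟩

end Summands

end IsometricPairs

namespace IsometricPairs

open Polynomial
open scoped LaurentPolynomial Matrix

/-! ### Matching two families up to an involution by counting. -/

section Counting

variable {X : Type*} {d : X → X}

theorem sym2_mk_involutive_eq_iff (hd : Function.Involutive d) (x y : X) :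
    (s(x, d x) : Sym2 X) = s(y, d y) ↔ x = y ∨ d x = y := by
  rw [Sym2.eq_iff]
  constructor
  · rintro (⟨h1, -⟩ | ⟨-, h1⟩)
    · exact Or.inl h1
    · exact Or.inr h1
  · rintro (rfl | rfl)
    · exact Or.inl ⟨rfl, rfl⟩
    · exact Or.inr ⟨(hd x).symm, rfl⟩

open Classical in
-- For x ≠ d(x) the two conditions on the right exclude each other. For x = d(x) they coincide and
-- every index is counted twice, whence the factor 2.
theorem card_sym2_fiber (hd : Function.Involutive d) {J : Type*} [Fintype J] (a : J → X) (x : X) :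
    (if d x = x then 2 else 1) *
      Fintype.card {j // (s(a j, d (a j)) : Sym2 X) = s(x, d x)} =
        Fintype.card {j // a j = x} + Fintype.card {j // d (a j) = x} := by
  simp only [sym2_mk_involutive_eq_iff hd]
  split_ifs with hx
  · have h1 : ∀ j, d (a j) = x ↔ a j = x := fun j =>
      ⟨fun h1 => by rw [← hd (a j), h1, hx], fun h1 => by rw [h1, hx]⟩
    simp only [h1, or_self, two_mul]
  · rw [one_mul]
    refine Fintype.card_subtype_or_disjoint _ _ ?_
    rw [Pi.disjoint_iff]
    intro j
    rw [Prop.disjoint_iff]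
    rintro ⟨h1, h2⟩
    exact hx (h1 ▸ h2)

open Classical in
-- The hypothesis counts x in each family together with its image under d. This determines how often
-- each unordered pair {x, d(x)} occurs, and indices with the same pair can be matched.
theorem exists_equiv_of_card_fiber_eq {I I' : Type*} [Fintype I] [Fintype I']
    (hd : Function.Involutive d) {b : I → X} {b' : I' → X}
    (h : ∀ x, (x ∈ Set.range b ∨ x ∈ Set.range b') →
      Fintype.card {i // b i = x} + Fintype.card {i // d (b i) = x} =
        Fintype.card {i // b' i = x} + Fintype.card {i // d (b' i) = x}) :
    ∃ e : I ≃ I', ∀ i, b' (e i) = b i ∨ b' (e i) = d (b i) := by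
  have key : ∀ z : Sym2 X, Nonempty ({i // s(b i, d (b i)) = z} ≃ {i // s(b' i, d (b' i)) = z}) := by
    have hx : ∀ x, (x ∈ Set.range b ∨ x ∈ Set.range b') →
        Nonempty ({i // s(b i, d (b i)) = s(x, d x)} ≃ {i // s(b' i, d (b' i)) = s(x, d x)}) := by
      intro x hx
      rw [← Fintype.card_eq]
      have := h x hx
      rw [← card_sym2_fiber hd, ← card_sym2_fiber hd] at this
      exact Nat.eq_of_mul_eq_mul_left (by split_ifs <;> norm_num) this
    intro z
    by_cases h1 : Nonempty {i // s(b i, d (b i)) = z}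
    · obtain ⟨i, rfl⟩ := h1
      exact hx _ (Or.inl ⟨i, rfl⟩)
    by_cases h2 : Nonempty {i // s(b' i, d (b' i)) = z}
    · obtain ⟨i, rfl⟩ := h2
      exact hx _ (Or.inr ⟨i, rfl⟩)
    rw [not_nonempty_iff] at h1 h2
    exact ⟨Equiv.equivOfIsEmpty _ _⟩
  refine ⟨Equiv.ofFiberEquiv (f := fun i => s(b i, d (b i))) (g := fun i => s(b' i, d (b' i)))
    fun z => (key z).some, fun i => ?_⟩
  have := Equiv.ofFiberEquiv_map (f := fun i => s(b i, d (b i)))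
    (g := fun i => s(b' i, d (b' i))) (fun z => (key z).some) i
  exact ((sym2_mk_involutive_eq_iff hd _ _).mp this.symm).imp Eq.symm Eq.symm

end Counting

/-! ### Dual blocks and the decomposition of the module into cyclic summands. -/

variable {K : Type*} [Field K] [StarRing K]

theorem vee_mul (f g : K[X]) : vee (f * g) = vee f * vee g := by
  simp only [vee, Polynomial.map_mul, mul_coeff_zero, star_mul', reverse_mul_of_domain,
    mul_inv, C_mul]
  ring

theorem natDegree_vee {f : K[X]} (h0 : f.coeff 0 ≠ 0) : (vee f).natDegree = f.natDegree := by
  rw [vee, natDegree_C_mul (inv_ne_zero (star_ne_zero.mpr h0)), reverse_natDegree,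
    natTrailingDegree_eq_zero_of_constantCoeff_ne_zero (by simpa using h0), tsub_zero,
    natDegree_map]

theorem monic_vee {f : K[X]} (h0 : f.coeff 0 ≠ 0) : (vee f).Monic := by
  rw [vee, Monic, leadingCoeff_mul, leadingCoeff_C, reverse_leadingCoeff, trailingCoeff,
    natTrailingDegree_eq_zero_of_constantCoeff_ne_zero (by simpa using h0)]
  simpa [starRingEnd_apply] using inv_mul_cancel₀ (star_ne_zero.mpr h0)

theorem coeff_zero_vee {f : K[X]} (hf : f.Monic) : (vee f).coeff 0 = (star (f.coeff 0))⁻¹ := by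
  rw [vee, coeff_C_mul, coeff_zero_reverse, leadingCoeff_map, hf.leadingCoeff, map_one, mul_one]

theorem vee_vee {f : K[X]} (hf : f.Monic) (h0 : f.coeff 0 ≠ 0) : vee (vee f) = f := by
  have h1 : (vee f).coeff 0 ≠ 0 := by
    rw [coeff_zero_vee hf]
    exact inv_ne_zero (star_ne_zero.mpr h0)
  refine eq_of_associated_toLaurent (K := K) ?_ h0 (monic_vee h1) hf ?_
  · rw [coeff_zero_vee (monic_vee h0)]
    exact inv_ne_zero (star_ne_zero.mpr h1)
  · refine (associated_laurentStar h1).symm.trans ?_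
    have := (associated_laurentStar h0).symm.map (laurentStar (K := K))
    rwa [(isInvolution_laurentStar K).apply_apply] at this

/-- `vee` is multiplicative, preserves the degree of polynomials with nonzero constant term, and is
involutive on the monic ones. So a factorization of f^∨ returns to one of f. -/
theorem irreducible_vee {f : K[X]} (hf : f.Monic) (hi : Irreducible f) (h0 : f.coeff 0 ≠ 0) :
    Irreducible (vee f) := by
  have hunit : ∀ g : K[X], g.coeff 0 ≠ 0 → IsUnit (vee g) → IsUnit g := fun g hg hu => by
    have h1 := natDegree_eq_zero_of_isUnit hu
    rw [natDegree_vee hg] at h1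
    rw [eq_C_of_natDegree_eq_zero h1]
    exact (isUnit_iff_ne_zero.mpr hg).map C
  refine ⟨fun hu => hi.not_isUnit (hunit f h0 hu), fun a b hab => ?_⟩
  have h1 : a.coeff 0 * b.coeff 0 ≠ 0 := by
    rw [← mul_coeff_zero, ← hab, coeff_zero_vee hf]
    exact inv_ne_zero (star_ne_zero.mpr h0)
  have h2 : f = vee a * vee b := by rw [← vee_mul, ← hab, vee_vee hf h0]
  exact (hi.isUnit_or_isUnit h2).imp (hunit a (left_ne_zero_of_mul h1))
    (hunit b (right_ne_zero_of_mul h1))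

namespace FrobeniusBlock

open Classical in
/-- The block with characteristic polynomial `χ^∨`; a singular block is left unchanged. -/
noncomputable def dual (Φ : FrobeniusBlock K) : FrobeniusBlock K :=
  if h : Φ.p.coeff 0 ≠ 0 then
    ⟨vee Φ.p, Φ.s, monic_vee h, irreducible_vee Φ.monic Φ.irreducible h, Φ.s_pos⟩
  else Φ

variable {Φ : FrobeniusBlock K} {ε : K}

theorem dual_p (h0 : Φ.p.coeff 0 ≠ 0) : Φ.dual.p = vee Φ.p := by rw [dual, dif_pos h0]

theorem dual_s (Φ : FrobeniusBlock K) : Φ.dual.s = Φ.s := by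
  rw [dual]
  split_ifs <;> rfl

theorem dual_coeff_zero_ne_zero (h0 : Φ.p.coeff 0 ≠ 0) : Φ.dual.p.coeff 0 ≠ 0 := by
  rw [dual_p h0, coeff_zero_vee Φ.monic]
  exact inv_ne_zero (star_ne_zero.mpr h0)

theorem dual_chi (h0 : Φ.p.coeff 0 ≠ 0) : Φ.dual.chi = vee Φ.chi := by
  rw [chi, chi, dual_p h0, dual_s, vee_pow]

theorem eq_of_p_eq {Φ Ψ : FrobeniusBlock K} (hp : Φ.p = Ψ.p) (hs : Φ.s = Ψ.s) : Φ = Ψ :=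
  eq_of_chi_eq (by rw [chi, chi, hp, hs])

theorem dual_involutive : Function.Involutive (dual (K := K)) := fun Φ => by
  by_cases h0 : Φ.p.coeff 0 ≠ 0
  · refine eq_of_p_eq ?_ (by rw [dual_s, dual_s])
    rw [dual_p (dual_coeff_zero_ne_zero h0), dual_p h0, vee_vee Φ.monic h0]
  · have : Φ.dual = Φ := by rw [dual, dif_neg h0]
    rw [this, this]

theorem HasForm.dual_eq (h : Φ.HasForm ε) : Φ.dual = Φ :=
  eq_of_p_eq ((dual_p h.coeff_zero_ne_zero).trans h.p_eq_vee.symm) Φ.dual_s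

end FrobeniusBlock

variable {V : Type*} [AddCommGroup V] [Module K V]
  [Module K[T;T⁻¹] V] [IsScalarTower K K[T;T⁻¹] V] {F : V →ₗ⋆[K] V →ₗ[K] K} {ε : K}

theorem IsHyperbolic.smul_eq_zero_of_add_eq_zero {g : K[T;T⁻¹]} {w w' : V}
    (h : IsHyperbolic laurentStar F g w w') (hF : IsInvariantForm (laurentStar (K := K)) ε F)
    {a b : K[T;T⁻¹]} (hab : a • w + b • w' = 0) : a • w = 0 ∧ b • w' = 0 := by
  have h1 : b • w' = 0 := by
    refine h.eq_zero_of_mem_span hF (isInvolution_laurentStar K)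
      (Submodule.mem_span_singleton.mpr ⟨b, rfl⟩) fun t => ?_
    have := congrArg (fun x => F x (t • w)) hab
    rwa [map_add F, LinearMap.add_apply, hF.adjoint a, smul_smul, h.isotropic, zero_add, map_zero,
      LinearMap.zero_apply] at this
  rw [h1, add_zero] at hab
  exact ⟨hab, h1⟩

/-- Mutually orthogonal nondegenerate submodules are independent. -/
theorem eq_zero_of_sum_eq_zero {ι : Type*} [Fintype ι]
    {C : ι → Submodule K[T;T⁻¹] V} (hC : ∀ t, NondegenerateOn F (C t))
    (horth : ∀ s t, s ≠ t → ∀ x ∈ C s, ∀ y ∈ C t, F x y = 0) {x : ι → V} (hx : ∀ t, x t ∈ C t)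
    (hsum : ∑ t, x t = 0) (t : ι) : x t = 0 := by
  classical
  refine hC t _ (hx t) fun y hy => ?_
  have := congrArg (fun z => F z y) hsum
  rwa [map_sum F, LinearMap.sum_apply, map_zero, LinearMap.zero_apply,
    Finset.sum_eq_single t (fun s _ hs => horth s t hs _ (hx s) y hy) (by simp)] at this

namespace Summands

variable {D : Summands K} {ℓ : FrobeniusBlock K → K[T;T⁻¹] →ₗ[K] K}
  {c : (Φ : FrobeniusBlock K) → Matrix (Fin Φ.size) (Fin Φ.size) K}
  {C : Fin D.m ⊕ Fin D.l → Submodule K[T;T⁻¹] V}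

/-- The blocks of the first member of the direct sum, up to similarity. -/
noncomputable def cyclicBlock (D : Summands K) : (Fin D.m ⊕ Fin D.m) ⊕ Fin D.l → FrobeniusBlock K :=
  Sum.elim (Sum.elim D.block₁ fun i => (D.block₁ i).dual) D.block₂

theorem IsAdmissible.coeff_zero_cyclicBlock_ne_zero (hD : D.IsAdmissible ε)
    (t : (Fin D.m ⊕ Fin D.m) ⊕ Fin D.l) : (D.cyclicBlock t).p.coeff 0 ≠ 0 := by
  have h1 : ∀ i, (D.block₁ i).p.coeff 0 ≠ 0 := fun i =>
    (D.block₁ i).coeff_zero_chi_ne_zero_iff.mp (hD.coeff_zero_ne_zero₁ i)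
  rcases t with (i | i) | j
  · exact h1 i
  · exact FrobeniusBlock.dual_coeff_zero_ne_zero (h1 i)
  · exact (hD.2 j).1.coeff_zero_ne_zero

/-- As a module, a hyperbolic summand is the direct sum of Rw ≅ R/(χ) and Rw' ≅ R/(χ^∨). Orthogonal
nondegenerate summands are independent, so all these cyclic modules together form a direct sum. -/
theorem IsDecomposition.exists_isCyclicDecomposition (h : D.IsDecomposition ℓ F ⊤ C)
    (hD : D.IsAdmissible ε) (h2 : (2 : K) ≠ 0) (hℓ : IsFunctionalFamily ε c ℓ)
    (hF : IsInvariantForm (laurentStar (K := K)) ε F) :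
    ∃ w : (Fin D.m ⊕ Fin D.m) ⊕ Fin D.l → V,
      IsCyclicDecomposition (fun t => toLaurent (D.cyclicBlock t).chi) w ∧
      (∀ j, IsCyclicForm F (toLaurent (D.block₂ j).chi)
        (fun r => ℓ (D.block₂ j) (D.q j * r)) (w (Sum.inr j))) ∧
      ∀ i j, i ≠ j → ∀ r : K[T;T⁻¹], F (w (Sum.inr i)) (r • w (Sum.inr j)) = 0 := by
  have hσ := isInvolution_laurentStar K
  choose w w' hw hwC using h.hyperbolic
  choose y hy hyC using h.cyclic
  have hwm : ∀ i (r : K[T;T⁻¹]), r • w i ∈ C (Sum.inl i) := fun i r => by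
    rw [hwC]
    exact Submodule.smul_mem _ _ (Submodule.subset_span (by simp))
  have hwm' : ∀ i (r : K[T;T⁻¹]), r • w' i ∈ C (Sum.inl i) := fun i r => by
    rw [hwC]
    exact Submodule.smul_mem _ _ (Submodule.subset_span (by simp))
  have hym : ∀ j (r : K[T;T⁻¹]), r • y j ∈ C (Sum.inr j) := fun j r => by
    rw [hyC]
    exact Submodule.smul_mem _ _ (Submodule.subset_span (by simp))
  have hynd := fun j => (hy j).nondegenerateOn_of_isStationaryForm hF h2 (hD.2 j).1
    (hℓ.isFrobenius _ (hD.2 j).1) (hD.2 j).2.1 (hD.2 j).2.2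
  have hnd : ∀ t, NondegenerateOn F (C t) := by
    rintro (i | j)
    · exact (h.hyperbolic i).nondegenerateOn hF
    · rw [hyC]
      exact (hynd j).1
  have hann : ∀ i (a : K[T;T⁻¹]), a • w' i = 0 ↔ toLaurent (D.block₁ i).dual.chi ∣ a := by
    intro i a
    have h0 := hD.coeff_zero_ne_zero₁ i
    rw [FrobeniusBlock.dual_chi ((D.block₁ i).coeff_zero_chi_ne_zero_iff.mp h0),
      ← (associated_laurentStar h0).dvd_iff_dvd_left]
    refine ⟨fun ha => ((hw i).symm hF hσ).dvd_of_smul_eq_zero ha, ?_⟩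
    rintro ⟨b, rfl⟩
    rw [mul_comm, mul_smul, (hw i).smul_eq_zero', smul_zero]
  refine ⟨Sum.elim (Sum.elim w w') y, ⟨fun v => ?_, fun a ha => ?_, ?_⟩, hy, fun i j hij r => ?_⟩
  · have hv : v ∈ ⨆ t, C t := h.iSup_eq ▸ Submodule.mem_top
    induction hv using Submodule.iSup_induction' with
    | mem t x hx =>
      rcases t with i | j
      · rw [hwC] at hx
        obtain ⟨a, b, rfl⟩ := Submodule.mem_span_pair.mp hx
        refine ⟨Sum.elim (Sum.elim (Pi.single i a) (Pi.single i b)) 0, ?_⟩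
        simp [Pi.single_apply, ite_smul]
      · rw [hyC] at hx
        obtain ⟨a, rfl⟩ := Submodule.mem_span_singleton.mp hx
        refine ⟨Sum.elim 0 (Pi.single j a), ?_⟩
        simp [Pi.single_apply, ite_smul]
    | zero => exact ⟨0, by simp⟩
    | add x z _ _ hx hz =>
      obtain ⟨a, rfl⟩ := hx
      obtain ⟨b, rfl⟩ := hz
      exact ⟨a + b, by simp only [Pi.add_apply, add_smul, Finset.sum_add_distrib]⟩
  · have hz := eq_zero_of_sum_eq_zero hnd h.orthogonal
      (x := Sum.elim (fun i => a (Sum.inl (Sum.inl i)) • w i + a (Sum.inl (Sum.inr i)) • w' i)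
        (fun j => a (Sum.inr j) • y j)) (by
        rintro (i | j)
        · exact Submodule.add_mem _ (hwm i _) (hwm' i _)
        · exact hym j _) (by
        rw [← ha]
        simp [Fintype.sum_sum_type, Finset.sum_add_distrib])
    rintro ((i | i) | j)
    · exact ((hw i).smul_eq_zero_of_add_eq_zero hF (hz (Sum.inl i))).1
    · exact ((hw i).smul_eq_zero_of_add_eq_zero hF (hz (Sum.inl i))).2
    · exact hz (Sum.inr j)
  · rintro ((i | i) | j) a
    · refine ⟨(hw i).dvd_of_smul_eq_zero, ?_⟩
      rintro ⟨b, rfl⟩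
      change (toLaurent (D.block₁ i).chi * b) • w i = 0
      rw [mul_comm, mul_smul, (hw i).smul_eq_zero, smul_zero]
    · exact hann i a
    · refine ⟨(hynd j).2 a, ?_⟩
      rintro ⟨b, rfl⟩
      change (toLaurent (D.block₂ j).chi * b) • y j = 0
      rw [mul_comm, mul_smul, (hy j).smul_eq_zero, smul_zero]
  · refine h.orthogonal (Sum.inr i) (Sum.inr j) (fun h => hij (Sum.inr_injective h)) _ ?_ _
      (hym j r)
    have := hym i 1
    rwa [one_smul] at this

end Summands

end IsometricPairs

/-! ### Uniqueness: recovering the summands and exchanging equivalent families. -/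

namespace IsometricPairs

open Polynomial
open scoped LaurentPolynomial Matrix

variable {K : Type*} [Field K] [StarRing K] {V : Type*} [AddCommGroup V] [Module K V]
  [Module K[T;T⁻¹] V] [IsScalarTower K K[T;T⁻¹] V] {F : V →ₗ⋆[K] V →ₗ[K] K} {ε : K}

theorem FrobeniusBlock.noSummand_of_ne {Φ Ψ : FrobeniusBlock K} (hΦ : Φ.p.coeff 0 ≠ 0)
    (hΨ : Ψ.p.coeff 0 ≠ 0) {k : ℕ} (hk : Φ.s = k + 1) (h : Ψ ≠ Φ) :
    NoSummand (toLaurent Φ.p) k (toLaurent Ψ.chi) := by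
  rw [Ψ.toLaurent_chi]
  refine noSummand_of_not_associated (isMaximal_span_toLaurent Φ.irreducible hΦ)
    (isMaximal_span_toLaurent Ψ.irreducible hΨ) Φ.toLaurent_p_ne_zero fun hass => h ?_
  rw [← hk, ← Φ.toLaurent_chi, ← Ψ.toLaurent_chi] at hass
  exact eq_of_chi_eq (eq_of_associated_toLaurent (Ψ.coeff_zero_chi_ne_zero_iff.mpr hΨ)
    (Φ.coeff_zero_chi_ne_zero_iff.mpr hΦ) Ψ.chi_monic Φ.chi_monic hass)

namespace Summands

variable {D D' : Summands K} {ℓ : FrobeniusBlock K → K[T;T⁻¹] →ₗ[K] K}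
  {c : (Φ : FrobeniusBlock K) → Matrix (Fin Φ.size) (Fin Φ.size) K}
  {C : Fin D.m ⊕ Fin D.l → Submodule K[T;T⁻¹] V}
  {C' : Fin D'.m ⊕ Fin D'.l → Submodule K[T;T⁻¹] V}

open Classical in
-- Both numbers are the dimension of the same residue space, the one attached to p and the exponent
-- s of the block.
theorem card_cyclicBlock_eq (hD : D.IsAdmissible ε) (hD' : D'.IsAdmissible ε)
    {w : (Fin D.m ⊕ Fin D.m) ⊕ Fin D.l → V} {w' : (Fin D'.m ⊕ Fin D'.m) ⊕ Fin D'.l → V}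
    (hw : IsCyclicDecomposition (fun t => toLaurent (D.cyclicBlock t).chi) w)
    (hw' : IsCyclicDecomposition (fun t => toLaurent (D'.cyclicBlock t).chi) w')
    {Φ : FrobeniusBlock K} (h0 : Φ.p.coeff 0 ≠ 0) :
    Fintype.card {t // D.cyclicBlock t = Φ} = Fintype.card {t // D'.cyclicBlock t = Φ} := by
  obtain ⟨k, hk⟩ := Nat.exists_eq_succ_of_ne_zero Φ.s_pos.ne'
  have hass : ∀ Ψ : FrobeniusBlock K, Ψ = Φ →
      Associated (toLaurent Ψ.chi) (toLaurent Φ.p ^ (k + 1)) := by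
    rintro _ rfl
    rw [FrobeniusBlock.toLaurent_chi, hk]
  obtain ⟨e, -⟩ := exists_residue_equiv Φ.toLaurent_p_ne_zero
    (evalUnit (rootUnit h0)).toRingHom (evalUnit_rootUnit_surjective h0)
    (evalUnit_rootUnit_eq_zero_iff h0) hw hw'
    (Subtype.val_injective (p := fun t => D.cyclicBlock t = Φ))
    (Subtype.val_injective (p := fun t => D'.cyclicBlock t = Φ))
    (fun t => hass _ t.2) (fun t => hass _ t.2)
    (fun t ht => FrobeniusBlock.noSummand_of_ne h0 (hD.coeff_zero_cyclicBlock_ne_zero t) hk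
      fun h => ht ⟨⟨t, h⟩, rfl⟩)
    (fun t ht => FrobeniusBlock.noSummand_of_ne h0 (hD'.coeff_zero_cyclicBlock_ne_zero t) hk
      fun h => ht ⟨⟨t, h⟩, rfl⟩)
  have := e.finrank_eq
  rwa [Module.finrank_fintype_fun_eq_card, Module.finrank_fintype_fun_eq_card] at this

open Classical in
theorem card_cyclicBlock (hD : D.IsAdmissible ε) {Φ : FrobeniusBlock K} (hΦ : ¬ Φ.HasForm ε) :
    Fintype.card {t // D.cyclicBlock t = Φ} =
      Fintype.card {i // D.block₁ i = Φ} + Fintype.card {i // (D.block₁ i).dual = Φ} := by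
  have : IsEmpty {j // D.block₂ j = Φ} := ⟨fun j => hΦ (j.2 ▸ (hD.2 j).1)⟩
  rw [Fintype.card_congr (Equiv.subtypeSum (p := fun t => D.cyclicBlock t = Φ)), Fintype.card_sum,
    Fintype.card_congr (Equiv.subtypeSum (p := fun t => D.cyclicBlock (Sum.inl t) = Φ)),
    Fintype.card_sum]
  have h1 : Fintype.card {j // D.cyclicBlock (Sum.inr j) = Φ} = 0 :=
    Fintype.card_eq_zero_iff.mpr this
  rw [h1, add_zero]
  rfl

/-- For blocks without a form, the module structure counts Φ together with its dual and so
determines the summands of type (i) up to duality. For blocks with a form, the residue forms are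
compared. -/
theorem IsDecomposition.equivalent (hD : D.IsAdmissible ε) (hD' : D'.IsAdmissible ε)
    (h : D.IsDecomposition ℓ F ⊤ C) (h' : D'.IsDecomposition ℓ F ⊤ C') (h2 : (2 : K) ≠ 0)
    (hℓ : IsFunctionalFamily ε c ℓ) (hF : IsInvariantForm (laurentStar (K := K)) ε F) :
    D.Equivalent ε D' := by
  classical
  obtain ⟨w, hw, hwc, hwo⟩ := h.exists_isCyclicDecomposition hD h2 hℓ hF
  obtain ⟨w', hw', hwc', hwo'⟩ := h'.exists_isCyclicDecomposition hD' h2 hℓ hF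
  constructor
  · obtain ⟨σ, hσ⟩ := exists_equiv_of_card_fiber_eq FrobeniusBlock.dual_involutive
      (b := D.block₁) (b' := D'.block₁) (fun Φ hΦ => by
        have hΦ' : ¬ Φ.HasForm ε ∧ Φ.p.coeff 0 ≠ 0 := by
          rcases hΦ with ⟨i, rfl⟩ | ⟨i, rfl⟩
          · exact ⟨(hD.1 i).2, hD.coeff_zero_cyclicBlock_ne_zero (Sum.inl (Sum.inl i))⟩
          · exact ⟨(hD'.1 i).2, hD'.coeff_zero_cyclicBlock_ne_zero (Sum.inl (Sum.inl i))⟩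
        have := card_cyclicBlock_eq hD hD' hw hw' hΦ'.2
        rw [card_cyclicBlock hD hΦ'.1, card_cyclicBlock hD' hΦ'.1] at this
        convert this)
    refine ⟨σ, fun i => (hσ i).imp (congrArg _) fun h => ?_⟩
    rw [h]
    exact FrobeniusBlock.dual_chi (hD.coeff_zero_cyclicBlock_ne_zero (Sum.inl (Sum.inl i)))
  · intro Φ hΦ
    have h0 := hΦ.coeff_zero_ne_zero
    obtain ⟨k, hk⟩ := Nat.exists_eq_succ_of_ne_zero Φ.s_pos.ne'
    have hchi : toLaurent Φ.chi = toLaurent Φ.p ^ (k + 1) := by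
      rw [FrobeniusBlock.toLaurent_chi, hk]
    have hass : ∀ Ψ : FrobeniusBlock K, Ψ = Φ →
        Associated (toLaurent Ψ.chi) (toLaurent Φ.p ^ (k + 1)) := by
      rintro _ rfl
      rw [hchi]
    have hno : ∀ {E : Summands K} (hE : E.IsAdmissible ε),
        ∀ t, t ∉ Set.range (fun j : {j // E.block₂ j = Φ} => Sum.inr (j : Fin E.l)) →
          NoSummand (toLaurent Φ.p) k (toLaurent (E.cyclicBlock t).chi) := by
      intro E hE t ht
      refine FrobeniusBlock.noSummand_of_ne h0 (hE.coeff_zero_cyclicBlock_ne_zero t) hk ?_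
      rintro rfl
      rcases t with (i | i) | j
      · exact (hE.1 i).2 hΦ
      -- A block with a form is its own dual, so a type (i) summand whose dual block is Φ would
      -- itself have the block Φ, which carries a form.
      · have := hΦ.dual_eq
        change ((E.block₁ i).dual).dual = (E.block₁ i).dual at this
        rw [FrobeniusBlock.dual_involutive] at this
        exact (hE.1 i).2 (by rw [this]; exact hΦ)
      · exact ht ⟨⟨j, rfl⟩, rfl⟩
    have hinj : ∀ {E : Summands K}, Function.Injective
        (fun j : {j // E.block₂ j = Φ} =>
          (Sum.inr (j : Fin E.l) : (Fin E.m ⊕ Fin E.m) ⊕ Fin E.l)) :=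
      fun hij => Subtype.ext (Sum.inr_injective hij)
    have hcyc : ∀ (Ψ : FrobeniusBlock K) (q : K[T;T⁻¹]) (y : V), Ψ = Φ →
        IsCyclicForm F (toLaurent Ψ.chi) (fun r => ℓ Ψ (q * r)) y →
        IsCyclicForm F (toLaurent Φ.p ^ (k + 1)) (fun r => ℓ Φ (q * r)) y := by
      rintro _ q y rfl hy
      rwa [hchi] at hy
    have hfrob := hℓ.isFrobenius Φ hΦ
    rw [hchi] at hfrob
    have key := hermitianEquivalent_of_decompositions hF (isInvolution_laurentStar K)
      Φ.toLaurent_p_ne_zero hΦ.associated.symm.dvd (evalUnit (rootUnit h0)).toRingHom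
      (evalUnit_rootUnit_surjective h0) (evalUnit_rootUnit_eq_zero_iff h0)
      (circ Φ.p hΦ.p_eq_vee) (circ_evalUnit hΦ.p_eq_vee h0) hfrob hw hw' hinj hinj
      (fun j => hass _ j.2) (fun j => hass _ j.2) (hno hD) (hno hD')
      (fun j => hcyc _ _ _ j.2 (hwc j))
      (fun i j hij r => hwo i j (fun h => hij (Subtype.ext h)) r)
      (fun j => hcyc _ _ _ j.2 (hwc' j))
      (fun i j hij r => hwo' i j (fun h => hij (Subtype.ext h)) r)
    simp only [← coe_rootUnit h0, laurentEval_eq_evalUnit_field]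
    exact key

theorem apply_eq_zero_of_mem_iSup {ι ι' : Sort*} {A : ι → Submodule K[T;T⁻¹] V}
    {B : ι' → Submodule K[T;T⁻¹] V} (h : ∀ s t, ∀ x ∈ A s, ∀ y ∈ B t, F x y = 0) {x y : V}
    (hx : x ∈ ⨆ s, A s) (hy : y ∈ ⨆ t, B t) : F x y = 0 := by
  have h1 : ∀ s, ∀ x ∈ A s, F x y = 0 := by
    intro s x hx
    induction hy using Submodule.iSup_induction' with
    | mem t y hy => exact h s t x hx y hy
    | zero => rw [map_zero]
    | add y z _ _ hy hz => rw [map_add (F x), hy, hz, add_zero]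
  induction hx using Submodule.iSup_induction' with
  | mem s x hx => exact h1 s x hx
  | zero => rw [map_zero F, LinearMap.zero_apply]
  | add x z _ _ hx hz => rw [map_add F, LinearMap.add_apply, hx, hz, add_zero]

/-- The group of cyclic summands with a given block can be replaced by a group with equivalent
Hermitian form. -/
theorem IsDecomposition.exists_replacement (hD : D.IsAdmissible ε) (hD' : D'.IsAdmissible ε)
    {U : Submodule K[T;T⁻¹] V} (h : D.IsDecomposition ℓ F U C) (h2 : (2 : K) ≠ 0)
    (hℓ : IsFunctionalFamily ε c ℓ) (hF : IsInvariantForm (laurentStar (K := K)) ε F)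
    (hDD' : D.Equivalent ε D') (Φ : FrobeniusBlock K) (hΦ : Φ.HasForm ε) :
    ∃ y : {j // D'.block₂ j = Φ} → V,
      (∀ j : {j // D'.block₂ j = Φ},
        IsCyclicForm F (toLaurent Φ.chi) (fun r => ℓ Φ (D'.q j * r)) (y j)) ∧
      (∀ i j, i ≠ j → ∀ r : K[T;T⁻¹], F (y i) (r • y j) = 0) ∧
      Submodule.span K[T;T⁻¹] (Set.range y) =
        ⨆ j : {j // D.block₂ j = Φ}, C (Sum.inr (j : Fin D.l)) := by
  classical
  choose y hy hyC using h.cyclic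
  have h0 := hΦ.coeff_zero_ne_zero
  obtain ⟨k, hk⟩ := Nat.exists_eq_succ_of_ne_zero Φ.s_pos.ne'
  have hchi : toLaurent Φ.chi = toLaurent Φ.p ^ (k + 1) := by
    rw [FrobeniusBlock.toLaurent_chi, hk]
  have hcyc : ∀ j : {j // D.block₂ j = Φ},
      IsCyclicForm F (toLaurent Φ.p ^ (k + 1)) (fun r => ℓ Φ (D.q j * r)) (y j) := by
    rintro ⟨j, rfl⟩
    rw [← hchi]
    exact hy j
  have hstat : ∀ {E : Summands K} (_ : E.IsAdmissible ε) (j : {j // E.block₂ j = Φ}),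
      E.q j ≠ 0 ∧ IsStationaryForm Φ.p (E.q j) := by
    rintro E hE ⟨j, rfl⟩
    exact (hE.2 j).2
  have hfrob := hℓ.isFrobenius Φ hΦ
  rw [hchi] at hfrob ⊢
  have he := hDD'.2 Φ hΦ
  simp only [← coe_rootUnit h0, laurentEval_eq_evalUnit_field] at he
  obtain ⟨y', hy', horth', hspan⟩ := IsometricPairs.exists_replacement hF
    (isInvolution_laurentStar K) h2 hΦ.associated.symm.dvd
    (evalUnit (rootUnit h0)).toRingHom (evalUnit_rootUnit_surjective h0)
    (evalUnit_rootUnit_eq_zero_iff h0) (circ Φ.p hΦ.p_eq_vee) (circ_evalUnit hΦ.p_eq_vee h0) hfrob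
    (y := fun j : {j // D.block₂ j = Φ} => y j) (q := fun j => D.q j) hcyc
    (fun i j hij r => by
      refine h.orthogonal (Sum.inr (i : Fin D.l)) (Sum.inr (j : Fin D.l))
        (fun h => hij (Subtype.ext (Sum.inr_injective h))) _ ?_ _ ?_
      · rw [hyC]
        exact Submodule.mem_span_singleton_self _
      · rw [hyC]
        exact Submodule.smul_mem _ _ (Submodule.mem_span_singleton_self _))
    (q' := fun j : {j // D'.block₂ j = Φ} => D'.q j)
    (fun j => (hstat hD j).2.laurentStar_eq) (fun j => (hstat hD' j).2.laurentStar_eq)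
    (fun j => FrobeniusBlock.isCoprime_toLaurent h2 h0 (hstat hD' j).1 (hstat hD' j).2)
    he
  refine ⟨y', hy', horth', hspan.trans ?_⟩
  rw [Submodule.span_range_eq_iSup]
  simp only [hyC]

/-- The same hyperbolic submodules serve for both lists, with the two generators exchanged where a
block is replaced by its dual. The cyclic summands are replaced group by group inside the submodule
that the group generates. -/
theorem IsDecomposition.exists_of_equivalent (hD : D.IsAdmissible ε) (hD' : D'.IsAdmissible ε)
    {U : Submodule K[T;T⁻¹] V} (h : D.IsDecomposition ℓ F U C) (h2 : (2 : K) ≠ 0)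
    (hℓ : IsFunctionalFamily ε c ℓ) (hF : IsInvariantForm (laurentStar (K := K)) ε F)
    (hDD' : D.Equivalent ε D') : ∃ C', D'.IsDecomposition ℓ F U C' := by
  obtain ⟨σ, hσ⟩ := hDD'.1
  choose y hy horth hspan using h.exists_replacement hD hD' h2 hℓ hF hDD'
  let W : Fin D'.l → Submodule K[T;T⁻¹] V := fun j =>
    Submodule.span K[T;T⁻¹] {y (D'.block₂ j) (hD'.2 j).1 ⟨j, rfl⟩}
  have hW : ∀ Φ (hΦ : FrobeniusBlock.HasForm ε Φ) j (hj : D'.block₂ j = Φ),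
      W j = Submodule.span K[T;T⁻¹] {y Φ hΦ ⟨j, hj⟩} := by
    rintro _ hΦ j rfl
    rfl
  have hWle : ∀ Φ (_ : FrobeniusBlock.HasForm ε Φ) j (_ : D'.block₂ j = Φ),
      W j ≤ ⨆ i : {i // D.block₂ i = Φ}, C (Sum.inr (i : Fin D.l)) := by
    intro Φ hΦ j hj
    rw [hW Φ hΦ j hj, ← hspan Φ hΦ]
    exact Submodule.span_mono (Set.singleton_subset_iff.mpr ⟨_, rfl⟩)
  have hWC : ∀ i j, ∀ x ∈ C (Sum.inl i), ∀ z ∈ W j, F x z = 0 := by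
    intro i j x hx z hz
    refine apply_eq_zero_of_mem_iSup (A := fun _ : Unit => C (Sum.inl i))
      (fun _ t x hx z hz => ?_) (Submodule.mem_iSup_of_mem () hx) (hWle _ (hD'.2 j).1 j rfl hz)
    exact h.orthogonal _ _ (by simp) x hx z hz
  refine ⟨Sum.elim (fun i => C (Sum.inl (σ.symm i))) W, fun i => ?_, fun j => ?_, ?_, ?_⟩
  · obtain ⟨w, w', hw, hwC⟩ := h.hyperbolic (σ.symm i)
    have := hσ (σ.symm i)
    rw [Equiv.apply_symm_apply] at this
    rcases this with h1 | h1
    · rw [h1]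
      exact ⟨w, w', hw, hwC⟩
    · rw [h1]
      refine ⟨w', w, (hw.symm hF (isInvolution_laurentStar K)).of_associated
        (associated_laurentStar (hD.coeff_zero_ne_zero₁ _)), ?_⟩
      rw [Set.pair_comm]
      exact hwC
  · exact ⟨_, hy _ (hD'.2 j).1 ⟨j, rfl⟩, rfl⟩
  · rintro (i | j) (i' | j') hne x hx z hz
    · refine h.orthogonal _ _ (fun h => hne ?_) x hx z hz
      rw [σ.symm.injective (Sum.inl_injective h)]
    · exact hWC _ _ x hx z hz
    · exact hF.eq_zero_comm (hWC _ _ z hz x hx)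
    · have hne' : j ≠ j' := fun h => hne (congrArg _ h)
      -- Within one group, orthogonality comes from the replacement. Different groups lie in sums of
      -- different, mutually orthogonal old summands.
      by_cases hb : D'.block₂ j' = D'.block₂ j
      · have hz' : z ∈ W j' := hz
        have hx' : x ∈ W j := hx
        rw [hW _ (hD'.2 j).1 j' hb] at hz'
        obtain ⟨a, rfl⟩ := Submodule.mem_span_singleton.mp hz'
        obtain ⟨b, rfl⟩ := Submodule.mem_span_singleton.mp hx'
        rw [hF.adjoint, smul_smul]
        exact horth _ _ _ _ (fun h => hne' (congrArg Subtype.val h)) _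
      · refine apply_eq_zero_of_mem_iSup (fun s t x hx z hz => ?_)
          (hWle _ (hD'.2 j).1 j rfl hx) (hWle _ (hD'.2 j').1 j' rfl hz)
        refine h.orthogonal _ _ (fun h => hb ?_) x hx z hz
        rw [← s.2, ← t.2, Sum.inr_injective h]
  · rw [← h.iSup_eq]
    apply le_antisymm
    · refine iSup_le ?_
      rintro (i | j)
      · exact le_iSup C _
      · exact (hWle _ (hD'.2 j).1 j rfl).trans (iSup_le fun i => le_iSup C _)
    · refine iSup_le ?_
      rintro (i | j)
      · have := le_iSup (Sum.elim (fun i => C (Sum.inl (σ.symm i))) W) (Sum.inl (σ i))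
        rwa [Sum.elim_inl, Equiv.symm_apply_apply] at this
      · have h1 : C (Sum.inr j) ≤ ⨆ i : {i // D.block₂ i = D.block₂ j}, C (Sum.inr (i : Fin D.l)) :=
          le_iSup (fun i : {i // D.block₂ i = D.block₂ j} => C (Sum.inr (i : Fin D.l))) ⟨j, rfl⟩
        refine h1.trans ?_
        rw [← hspan _ (hD.2 j).1, Submodule.span_le]
        rintro _ ⟨⟨j', hj'⟩, rfl⟩
        refine le_iSup (Sum.elim (fun i => C (Sum.inl (σ.symm i))) W) (Sum.inr j') ?_
        rw [Sum.elim_inr, hW _ (hD.2 j).1 j' hj']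
        exact Submodule.mem_span_singleton_self _

end Summands

end IsometricPairs

/-! ### The classification theorem. -/

open IsometricPairs
theorem theorem5 {K : Type*} [Field K] [StarRing K] (hK : ringChar K ≠ 2)
    (ε : K) (hε : ε = 1 ∨ ε = -1) (hε' : (∃ a : K, star a ≠ a) → ε = 1)
    -- a fixed matrix `Φ_(ε)` for each Frobenius block for which it exists
    (c : (Φ : FrobeniusBlock K) → Matrix (Fin Φ.size) (Fin Φ.size) K)
    (hc : ∀ Φ : FrobeniusBlock K, Φ.HasForm ε → Φ.IsForm ε (c Φ))
    {V : Type*} [AddCommGroup V] [Module K V] [FiniteDimensional K V]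
    (F : V →ₗ⋆[K] V →ₗ[K] K) (hF : ∀ x y, F x y = ε * star (F y x)) (hF' : F.Nondegenerate)
    (A : V →ₗ[K] V) (hA : ∀ x y, F (A x) (A y) = F x y) :
    (∃ D : Summands K, D.IsAdmissible ε ∧ D.Represents ε c A F) ∧
    (∀ D D' : Summands K, D.IsAdmissible ε → D'.IsAdmissible ε → D.Represents ε c A F →
      (D'.Represents ε c A F ↔ D.Equivalent ε D')) := by
  have h2 : (2 : K) ≠ 0 := Ring.two_ne_zero hK
  have hεε : ε * ε = 1 := by rcases hε with rfl | rfl <;> norm_num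
  have hε0 : ε ≠ 0 := left_ne_zero_of_mul_eq_one hεε
  have hnd : ∀ x, (∀ y, F x y = 0) → x = 0 := hF'.1
  -- An isometry of a nondegenerate form is injective, hence invertible in finite dimension, so
  -- negative powers of T can act.
  have hinj : Function.Injective A := (injective_iff_map_eq_zero A).mpr fun x hx =>
    hnd x fun y => by rw [← hA, hx, map_zero, LinearMap.zero_apply]
  obtain ⟨a, ha⟩ : IsUnit A := (LinearMap.isUnit_iff_ker_eq_bot A).mpr (LinearMap.ker_eq_bot.mpr hinj)
  let _ : Module (LaurentPolynomial K) V := laurentModule a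
  have : IsScalarTower K (LaurentPolynomial K) V := ⟨fun b r x => by
    change evalUnit a (b • r) x = b • evalUnit a r x
    rw [map_smul, LinearMap.smul_apply]⟩
  have hT : ∀ x, A x = (LaurentPolynomial.T 1 : LaurentPolynomial K) • x := fun x => by
    change A x = evalUnit a (LaurentPolynomial.T 1) x
    rw [evalUnit_T, zpow_one, ha]
  have hinv : IsInvariantForm (laurentStar (K := K)) ε F :=
    isInvariantForm_of_isometry hF fun x y => by rw [← hT, ← hT, hA]
  obtain ⟨ℓ, hℓ⟩ := Summands.exists_isFunctionalFamily hc
  refine ⟨?_, fun D D' hD hD' h => ?_⟩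
  · obtain ⟨D, C, hD, hC⟩ := Summands.exists_isDecomposition hinv h2 hε0 hℓ ⊤
      fun x _ hx => hnd x fun y => hx y trivial
    exact ⟨D, hD, hC.represents hD h2 hεε hinv hc hℓ hT⟩
  · obtain ⟨C, hC⟩ := Summands.exists_isDecomposition_of_represents hD hinv hℓ hT h
    constructor
    · intro h'
      obtain ⟨C', hC'⟩ := Summands.exists_isDecomposition_of_represents hD' hinv hℓ hT h'
      exact hC.equivalent hD hD' hC' h2 hℓ hinv
    · intro h'
      obtain ⟨C', hC'⟩ := hC.exists_of_equivalent hD hD' h2 hℓ hinv h'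
      exact hC'.represents hD' h2 hεε hinv hc hℓ hT
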